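/- Let $n$ be a natural number, and use min-plus tropical arithmetic. **Matrices.** A real symmetric $n\times n$ matrix $A$ belongs to the space $\mathcal S_n$ of symmetric tropical rank $2$ matrices (that is, of symmetric tropical rank at most $2$) if for every $3\times 3$ minor of the symmetric matrix of variables $(x_{ij})_{i\le j}$, regarded as a polynomial over $\mathbb Q$ in the variables $x_{ij}$, $i\le j$, the minimum in its tropicalization (with trivial valuation on the coefficients) is attained at $A$ by at least two distinct monomials. Let $L=\{(x_i+x_j)_{i,j} : x\in\mathbb R^n\}$. **Trees.** A symbic tree on $2n$ leaves is a finite tree without vertices of degree $2$, whose leaves are labeled bijectively by $1,\dots,n,1',\dots,n'$ (unprimed and primed labels being the two colors), such that (1) for each internal edge (an edge containing no leaf), both components obtained by removing it contain leaves of both colors; (2) there is an involutive automorphism of the tree which swaps the leaves $i$ and $i'$ for all $i$; (3) the fixed points of this involution on the geometric tree form a path (possibly a single point). Two symbic trees have the same type if they are isomorphic as leaf-labeled trees. Edge lengths on a symbic tree $T$ are nonnegative numbers on the internal edges, invariant under the involution, i.e. functions $\ell$ on the set $O(T)$ of orbits of internal edges; leaf edges are assigned no length. **The tree of a matrix.**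 For $A\in\mathcal S_n$ the metric tree $T_A$ is the tropical convex hull of the columns of $A$ in $\mathbb R^n/\mathbb R\mathbf 1$ with the tropical Hilbert metric $d(x,y)=\max_i(x_i-y_i)-\min_i(x_i-y_i)$, with leaf $i$ attached at the $i$-th column and leaf $j'$ attached at the point where the infinite ray in direction $\mathbf e_j$ is attached when the hull is completed to a tropical line; this is the point $p$ of the hull with $p_i-p_j\le x_i-x_j$ for all $i$ and all $x$ in the hull. We write $T_A=(T,\ell)$ if for any two leaves the distance in the hull between their attaching points is the total $\ell$-length of the internal edges of $T$ on the path between them (edges of length $0$ being contracted). For a symbic tree $T$ let $$C_T=\{A\in\mathcal S_n : T_A=(T,\ell)\text{ for some }\ell\ge 0\}.$$ **Claim.** The cones $C_T$, for $T$ ranging over the symbic trees on $2n$ leaves, form a simplicial fan structure on $\mathcal S_n$ with lineality space $L$, indexed by the types of symbic trees. That is: 1. there are finitely many distinct cones $C_T$; each of them is the sum of $L$ and the cone generated by a family of vectors that is linearly independent modulo $L$; each face of a $C_T$ is again of the form $C_{T'}$; and the intersection of any two of these cones is a face of both; 2. $\bigcup_T C_T=\mathcal S_n$; 3. $C_T=C_{T'}$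 if and only if $T$ and $T'$ have the same type; 4. for each $T$ there are matrices $v_o$, $o\in O(T)$, linearly independent modulo $L$, with $C_T=L+\sum_{o}\mathbb R_{\ge0}v_o$, such that for all $\ell\ge0$ and all $n\times n$ matrices $A$: $A\in\mathcal S_n$ and $T_A=(T,\ell)$ if and only if $A-\sum_o\ell_o v_o\in L$. So the cone of $T$ has dimension $|O(T)|$ modulo $L$, and its coordinates modulo $L$ are the edge lengths. -/

import Mathlib

/-! ### Symmetric tropical rank (min-plus convention) -/

/-- The `n × n` symmetric matrix of variables: the variables are `x_{ij}` with `i ≤ j`, and the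
entries at `(i, j)` and `(j, i)` are the same variable. -/
noncomputable def genericSymmMatrix (n : ℕ) :
    Matrix (Fin n) (Fin n) (MvPolynomial (Fin n × Fin n) ℚ) :=
  Matrix.of fun i j => MvPolynomial.X (min i j, max i j)

/-- The value at the point `w` of the tropicalization of the monomial with exponent `m`. -/
noncomputable def tropMonomial {σ : Type*} (m : σ →₀ ℕ) (w : σ → ℝ) : ℝ :=
  m.sum fun s k => (k : ℝ) * w s

/-- The minimum in the tropicalization of `f` (coefficients have valuation zero) is attained at
two different monomials of `f` at the point `w`. -/
def MinAttainedTwice {σ : Type*} (f : MvPolynomial σ ℚ) (w : σ → ℝ) : Prop :=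
  ∃ m ∈ f.support, ∃ m' ∈ f.support, m ≠ m' ∧ tropMonomial m w = tropMonomial m' w ∧
    ∀ m'' ∈ f.support, tropMonomial m w ≤ tropMonomial m'' w

/-- The symmetric matrices of symmetric tropical rank (at most) `r`: the minimum is attained twice
in every `(r+1) × (r+1)` minor, as a polynomial in the variables `x_{ij}`, `i ≤ j`. -/
def symmTropRank (n r : ℕ) : Set (Matrix (Fin n) (Fin n) ℝ) :=
  {A | A.IsSymm ∧ ∀ I J : Fin (r + 1) ↪o Fin n,
    MinAttainedTwice ((genericSymmMatrix n).submatrix I J).det (fun p => A p.1 p.2)}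

/-- The linear space of the matrices `X ⊙ Xᵀ`, with entries `x i + x j`: the translations by
simultaneous tropical scaling of rows and columns. -/
def scalingSpace (n : ℕ) : Submodule ℝ (Matrix (Fin n) (Fin n) ℝ) where
  carrier := {M | ∃ x : Fin n → ℝ, ∀ i j, M i j = x i + x j}
  zero_mem' := ⟨0, by simp⟩
  add_mem' := by
    rintro _ _ ⟨x, hx⟩ ⟨y, hy⟩
    exact ⟨x + y, fun i j => by simp only [Matrix.add_apply, hx, hy, Pi.add_apply]; ring⟩
  smul_mem' := by
    rintro c _ ⟨x, hx⟩
    exact ⟨c • x, fun i j => by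
      simp only [Matrix.smul_apply, hx, Pi.smul_apply, smul_eq_mul]; ring⟩

/-! ### Symbic trees -/

/-- A symbic tree on `2n` leaves, as a combinatorial tree. The leaf label `Sum.inl i` is the label
`i` and `Sum.inr i` is the label `i'`; the two summands are the two colors. -/
structure SymbicTree (n : ℕ) where
  /-- the vertices -/
  V : Type
  [finite_V : Finite V]
  /-- the underlying graph -/
  G : SimpleGraph V
  isTree : G.IsTree
  /-- the labeled leaves -/
  leaf : Fin n ⊕ Fin n → V
  leaf_injective : Function.Injective leaf
  /-- the labeled vertices are exactly the leaves of the tree -/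
  range_leaf : ∀ v, v ∈ Set.range leaf ↔ (G.neighborSet v).ncard = 1
  /-- there are no superfluous vertices in the interior of an edge -/
  ncard_ne_two : ∀ v, (G.neighborSet v).ncard ≠ 2
  /-- removing an internal edge leaves both colors on both sides -/
  bicolored : ∀ e ∈ G.edgeSet, (∀ v ∈ e, v ∉ Set.range leaf) → ∀ v ∈ e,
    (∃ i, (G.deleteEdges {e}).Reachable v (leaf (Sum.inl i))) ∧
    (∃ j, (G.deleteEdges {e}).Reachable v (leaf (Sum.inr j)))
  /-- the symmetry of the tree which swaps the colors -/
  swap : G ≃g G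
  swap_swap : ∀ v, swap (swap v) = v
  swap_leaf : ∀ x, swap (leaf x) = leaf x.swap
  /-- the fixed points of the involution on the geometric tree form a path: either no vertex is
  fixed (and the only fixed point is the midpoint of an edge that is flipped), or the fixed
  vertices are the vertices of a path in the graph -/
  fixed_path : (∀ v, swap v ≠ v) ∨
    ∃ (u w : V) (p : G.Walk u w), p.IsPath ∧ ∀ v, swap v = v ↔ v ∈ p.support

namespace SymbicTree

variable {n : ℕ}

/-- Isomorphism of leaf-labeled trees, that is, equality of combinatorial types. (It automatically
respects the color swap, as an automorphism of a tree is determined by its action on leaves.) -/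
def Iso (T T' : SymbicTree n) : Prop :=
  ∃ φ : T.G ≃g T'.G, ∀ x, φ (T.leaf x) = T'.leaf x

/-- The internal edges: those that contain no leaf. -/
def InternalEdge (T : SymbicTree n) : Type :=
  {e : Sym2 T.V // e ∈ T.G.edgeSet ∧ ∀ v ∈ e, v ∉ Set.range T.leaf}

/-- The internal edges up to the color swap. -/
def EdgeOrbit (T : SymbicTree n) : Type :=
  Quot fun e f : T.InternalEdge => f.1 = e.1.map T.swap

instance (T : SymbicTree n) : Finite T.InternalEdge :=
  haveI := T.finite_V
  inferInstanceAs (Finite {e : Sym2 T.V // _})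

instance (T : SymbicTree n) : Finite T.EdgeOrbit :=
  inferInstanceAs (Finite (Quot _))

noncomputable instance (T : SymbicTree n) : Fintype T.InternalEdge := Fintype.ofFinite _

noncomputable instance (T : SymbicTree n) : Fintype T.EdgeOrbit := Fintype.ofFinite _

/-- The edge `e` lies on the path between the leaves labeled `x` and `y`. -/
def Separates (T : SymbicTree n) (e : T.InternalEdge) (x y : Fin n ⊕ Fin n) : Prop :=
  ¬ (T.G.deleteEdges {e.1}).Reachable (T.leaf x) (T.leaf y)

open Classical in
/-- The total length of the internal edges on the path between the leaves `x` and `y`, for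
edge lengths `ℓ` that are symmetric under the color swap. -/
noncomputable def dist (T : SymbicTree n) (ℓ : T.EdgeOrbit → ℝ) (x y : Fin n ⊕ Fin n) : ℝ :=
  ∑ e : T.InternalEdge, if T.Separates e x y then ℓ (Quot.mk _ e) else 0

end SymbicTree

/-! ### The tree associated with a matrix -/

/-- The tropical convex hull of the columns of `A`: all their tropical linear combinations. -/
def tropicalHull {n : ℕ} (A : Matrix (Fin n) (Fin n) ℝ) : Set (Fin n → ℝ) :=
  {x | ∃ c : Fin n → ℝ, ∀ i, IsLeast (Set.range fun k => c k + A i k) (x i)}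

/-- The tropical Hilbert (pseudo)metric; it is a metric modulo adding constant vectors. -/
noncomputable def hilbertDist {n : ℕ} (x y : Fin n → ℝ) : ℝ :=
  (⨆ i, (x i - y i)) - ⨅ i, (x i - y i)

/-- `p` is the point at which the infinite ray in direction `e_j` is attached to the tropical convex
hull so as to obtain a (balanced) tropical line: the point of the hull that lies farthest
in direction `e_j`. In a tropical line an edge has direction the sum of the `e_i` over the
rays `i` on one side of it. So on every path away from the attaching point of the ray `e_j`
all differences `x i - x j` weakly increase, which forces this choice of `p`,
uniquely up to adding constants. -/
def IsRayFoot {n : ℕ} (A : Matrix (Fin n) (Fin n) ℝ) (j : Fin n) (p : Fin n → ℝ) : Prop :=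
  p ∈ tropicalHull A ∧ ∀ x ∈ tropicalHull A, ∀ i, p i - p j ≤ x i - x j

/-- The attaching points of rays exist, for every matrix. -/
theorem isRayFoot_iInf {n : ℕ} (A : Matrix (Fin n) (Fin n) ℝ) (j : Fin n) :
    IsRayFoot A j (fun i => ⨅ k, (A i k - A j k)) := by
  have : Nonempty (Fin n) := ⟨j⟩
  have hle : ∀ i k, (⨅ k, (A i k - A j k)) ≤ A i k - A j k := fun i k =>
    ciInf_le (Set.finite_range _).bddBelow k
  refine ⟨⟨fun k => - A j k, fun i => ⟨?_, ?_⟩⟩, ?_⟩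
  · obtain ⟨k, hk⟩ := exists_eq_ciInf_of_finite (f := fun k => A i k - A j k)
    exact ⟨k, by simp only [← hk]; ring⟩
  · rintro _ ⟨k, rfl⟩
    have := hle i k
    simp only
    linarith
  · rintro x ⟨c, hc⟩ i
    obtain ⟨k, hk⟩ := (hc i).1
    have h1 := (hc j).2 ⟨k, rfl⟩
    have h2 := hle i k
    simp only [sub_self, ciInf_const] at *
    linarith

/-- The metric tree associated with `A` is the tree `T` with edge lengths `ℓ` (edges of length
zero being contracted). The associated tree is the tropical convex hull of the columns of `A` with
the tropical Hilbert metric, with the leaf `i` attached at column `i` and the leaf `j'` attached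
where the ray in direction `e_j` is attached. As lengths of leaf edges are ignored, a leaf-labeled
metric tree is given by the distances between the points at which its leaves are attached. -/
def HasTree {n : ℕ} (A : Matrix (Fin n) (Fin n) ℝ) (T : SymbicTree n) (ℓ : T.EdgeOrbit → ℝ) :
    Prop :=
  ∃ pt : Fin n ⊕ Fin n → (Fin n → ℝ),
    (∀ k i, pt (Sum.inl k) i = A i k) ∧ (∀ j, IsRayFoot A j (pt (Sum.inr j))) ∧
    ∀ x y, hilbertDist (pt x) (pt y) = T.dist ℓ x y

/-- The cone of `T`: the matrices of symmetric tropical rank (at most) 2 whose associated tree is `T`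
with some nonnegative edge lengths. -/
def SymbicTree.cone {n : ℕ} (T : SymbicTree n) : Set (Matrix (Fin n) (Fin n) ℝ) :=
  {A | A ∈ symmTropRank n 2 ∧ ∃ ℓ : T.EdgeOrbit → ℝ, (∀ o, 0 ≤ ℓ o) ∧ HasTree A T ℓ}

/-! ### Simplicial fans -/

section Fan

variable {E : Type*} [AddCommGroup E] [Module ℝ E]

/-- `F` is a face of the cone `C`: the zero set in `C` of a linear form nonnegative on `C`. -/
def IsConeFace (F C : Set E) : Prop :=
  ∃ f : E →ₗ[ℝ] ℝ, (∀ x ∈ C, 0 ≤ f x) ∧ F = {x ∈ C | f x = 0}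

/-- The cone generated by the family `v` together with the linear space `L`. -/
def coneOver (L : Submodule ℝ E) {ι : Type*} [Fintype ι] (v : ι → E) : Set E :=
  {x | ∃ c : ι → ℝ, (∀ i, 0 ≤ c i) ∧ x - ∑ i, c i • v i ∈ L}

/-- A simplicial cone with lineality space `L`: modulo `L`, it is generated by linearly independent
vectors. -/
def IsSimplicialCone (L : Submodule ℝ E) (C : Set E) : Prop :=
  ∃ (k : ℕ) (v : Fin k → E), LinearIndependent ℝ (fun i => L.mkQ (v i)) ∧ C = coneOver L v

/-- A simplicial fan with lineality space `L`. -/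
structure IsSimplicialFan (L : Submodule ℝ E) (Φ : Set (Set E)) : Prop where
  finite : Φ.Finite
  simplicial : ∀ C ∈ Φ, IsSimplicialCone L C
  face_mem : ∀ C ∈ Φ, ∀ F, IsConeFace F C → F ∈ Φ
  inter_face : ∀ C ∈ Φ, ∀ D ∈ Φ, IsConeFace (C ∩ D) C ∧ IsConeFace (C ∩ D) D

end Fan

/-! ### Three-by-three minors of symmetric matrices -/

section Minors

variable {n : ℕ}

/-- The exponent of the monomial of the permutation `σ` in the minor of the generic symmetric
matrix with rows `r` and columns `c`. -/
noncomputable def minorExponent (r c : Fin 3 → Fin n) (σ : Equiv.Perm (Fin 3)) :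
    Fin n × Fin n →₀ ℕ :=
  ∑ a, Finsupp.single (min (r (σ a)) (c a), max (r (σ a)) (c a)) 1

/-- The value at `A` of the tropical monomial of the permutation `σ`. -/
def minorValue (A : Matrix (Fin n) (Fin n) ℝ) (r c : Fin 3 → Fin n) (σ : Equiv.Perm (Fin 3)) : ℝ :=
  ∑ a, A (r (σ a)) (c a)

theorem min_max_pair_eq {a b c d : Fin n} (h : (min a b, max a b) = (min c d, max c d)) :
    (a = c ∧ b = d) ∨ (a = d ∧ b = c) := by
  simp only [Prod.mk.injEq] at h
  grind

theorem tropMonomial_add {σ : Type*} (m m' : σ →₀ ℕ) (w : σ → ℝ) :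
    tropMonomial (m + m') w = tropMonomial m w + tropMonomial m' w := by
  classical
  unfold tropMonomial
  rw [Finsupp.sum_add_index']
  · simp
  · intros; push_cast; ring

theorem tropMonomial_minorExponent {A : Matrix (Fin n) (Fin n) ℝ} (hA : A.IsSymm)
    (r c : Fin 3 → Fin n) (σ : Equiv.Perm (Fin 3)) :
    tropMonomial (minorExponent r c σ) (fun p => A p.1 p.2) = minorValue A r c σ := by
  have h : ∀ i j : Fin n,
      tropMonomial (Finsupp.single (min i j, max i j) 1) (fun p => A p.1 p.2) = A i j := by
    intro i j
    unfold tropMonomial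
    rw [Finsupp.sum_single_index (by simp)]
    rcases le_total i j with h | h
    · simp [h]
    · simp [h, hA.apply]
  simp only [minorExponent, minorValue, Fin.sum_univ_three, tropMonomial_add, h]

/-- Permutations of opposite sign in `S₃` differ by a transposition. After cancelling the common
variable, equality of monomials would force two rows or two columns to coincide. -/
theorem sign_eq_of_minorExponent_eq {r c : Fin 3 → Fin n} (hr : Function.Injective r)
    (hc : Function.Injective c) {σ τ : Equiv.Perm (Fin 3)}
    (h : minorExponent r c σ = minorExponent r c τ) : Equiv.Perm.sign σ = Equiv.Perm.sign τ := by
  by_contra hs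
  have key : ∀ σ τ : Equiv.Perm (Fin 3), Equiv.Perm.sign σ ≠ Equiv.Perm.sign τ →
      ∃ a b c, a ≠ b ∧ a ≠ c ∧ b ≠ c ∧ τ a = σ b ∧ τ b = σ a ∧ τ c = σ c := by decide
  obtain ⟨a, b, d, hab, had, hbd, h1, h2, h3⟩ := key σ τ hs
  have hsum : ∀ f : Fin 3 → (Fin n × Fin n →₀ ℕ), ∑ x, f x = f a + f b + f d := by
    intro f
    have huniv : ∀ a b d : Fin 3, a ≠ b → a ≠ d → b ≠ d → Finset.univ = {a, b, d} := by decide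
    rw [huniv a b d hab had hbd, Finset.sum_insert (by simp [hab, had]),
      Finset.sum_insert (by simp [hbd]),
      Finset.sum_singleton, add_assoc]
  rw [minorExponent, minorExponent, hsum, hsum, h1, h2, h3] at h
  have h := add_right_cancel h
  have h4 := DFunLike.congr_fun h (min (r (σ a)) (c a), max (r (σ a)) (c a))
  have h5 : (min (r (σ b)) (c a), max (r (σ b)) (c a)) ≠
      (min (r (σ a)) (c a), max (r (σ a)) (c a)) := by
    intro h
    have hne : r (σ b) ≠ r (σ a) := fun h => hab (σ.injective (hr h)).symm
    rcases min_max_pair_eq h with ⟨h, -⟩ | ⟨h, h'⟩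
    · exact hne h
    · exact hne (h.trans h')
  have h6 : (min (r (σ a)) (c b), max (r (σ a)) (c b)) ≠
      (min (r (σ a)) (c a), max (r (σ a)) (c a)) := by
    intro h
    have hne : c b ≠ c a := fun h => hab (hc h).symm
    rcases min_max_pair_eq h with ⟨-, h⟩ | ⟨h, h'⟩
    · exact hne h
    · exact hne (h'.trans h)
  simp [Finsupp.single_apply, h5, h6] at h4

theorem det_submatrix_genericSymmMatrix (r c : Fin 3 → Fin n) :
    ((genericSymmMatrix n).submatrix r c).det =
      ∑ σ : Equiv.Perm (Fin 3), MvPolynomial.monomial (minorExponent r c σ)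
        ((Equiv.Perm.sign σ : ℤ) : ℚ) := by
  rw [Matrix.det_apply]
  refine Finset.sum_congr rfl fun σ _ => ?_
  have : ∏ a, ((genericSymmMatrix n).submatrix r c) (σ a) a =
      MvPolynomial.monomial (minorExponent r c σ) (1 : ℚ) := by
    simp only [genericSymmMatrix, Matrix.submatrix_apply, Matrix.of_apply, minorExponent,
      MvPolynomial.X, Fin.prod_univ_three, Fin.sum_univ_three, MvPolynomial.monomial_mul, mul_one]
  rw [this]
  rcases Int.units_eq_one_or (Equiv.Perm.sign σ) with h | h <;> simp [h]

/-- Different permutations can give the same monomial, but only with equal signs, so nothing cancels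
in the determinant. -/
theorem mem_support_det_iff {r c : Fin 3 → Fin n} (hr : Function.Injective r)
    (hc : Function.Injective c) (m : Fin n × Fin n →₀ ℕ) :
    m ∈ ((genericSymmMatrix n).submatrix r c).det.support ↔ ∃ σ, minorExponent r c σ = m := by
  classical
  rw [det_submatrix_genericSymmMatrix, MvPolynomial.mem_support_iff, MvPolynomial.coeff_sum]
  simp only [MvPolynomial.coeff_monomial]
  constructor
  · intro h
    obtain ⟨σ, -, hσ⟩ := Finset.exists_ne_zero_of_sum_ne_zero h
    exact ⟨σ, by by_contra h'; simp [h'] at hσ⟩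
  · rintro ⟨σ, rfl⟩
    have h : ∀ τ : Equiv.Perm (Fin 3), (if minorExponent r c τ = minorExponent r c σ then
        ((Equiv.Perm.sign τ : ℤ) : ℚ) else 0) = ((Equiv.Perm.sign σ : ℤ) : ℚ) *
        (if minorExponent r c τ = minorExponent r c σ then 1 else 0) := by
      intro τ
      split_ifs with h
      · rw [sign_eq_of_minorExponent_eq hr hc h, mul_one]
      · simp
    rw [Finset.sum_congr rfl fun τ _ => h τ, ← Finset.mul_sum]
    refine mul_ne_zero (by exact_mod_cast (Equiv.Perm.sign σ).ne_zero) (ne_of_gt ?_)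
    exact Finset.sum_pos' (fun τ _ => by split_ifs <;> simp) ⟨σ, Finset.mem_univ _, by simp⟩

/-- The minimum in the minor with rows `r` and columns `c` is attained at two monomials. -/
def MinorSingular (A : Matrix (Fin n) (Fin n) ℝ) (r c : Fin 3 → Fin n) : Prop :=
  ∃ σ τ, minorExponent r c σ ≠ minorExponent r c τ ∧ minorValue A r c σ = minorValue A r c τ ∧
    ∀ ρ, minorValue A r c σ ≤ minorValue A r c ρ

theorem minAttainedTwice_iff_minorSingular {A : Matrix (Fin n) (Fin n) ℝ} (hA : A.IsSymm)
    {r c : Fin 3 → Fin n} (hr : Function.Injective r) (hc : Function.Injective c) :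
    MinAttainedTwice ((genericSymmMatrix n).submatrix r c).det (fun p => A p.1 p.2) ↔
      MinorSingular A r c := by
  simp only [MinAttainedTwice, MinorSingular, mem_support_det_iff hr hc,
    ← tropMonomial_minorExponent hA]
  constructor
  · rintro ⟨_, ⟨σ, rfl⟩, _, ⟨τ, rfl⟩, h1, h2, h3⟩
    exact ⟨σ, τ, h1, h2, fun ρ => h3 _ ⟨ρ, rfl⟩⟩
  · rintro ⟨σ, τ, h1, h2, h3⟩
    exact ⟨_, ⟨σ, rfl⟩, _, ⟨τ, rfl⟩, h1, h2, by rintro _ ⟨ρ, rfl⟩; exact h3 ρ⟩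

theorem exists_orderEmbedding_comp_perm {r : Fin 3 → Fin n} (hr : Function.Injective r) :
    ∃ (I : Fin 3 ↪o Fin n) (π : Equiv.Perm (Fin 3)), r = I ∘ π := by
  have hm : StrictMono (r ∘ Tuple.sort r) :=
    (Tuple.monotone_sort r).strictMono_of_injective (hr.comp (Equiv.injective _))
  refine ⟨OrderEmbedding.ofStrictMono _ hm, (Tuple.sort r)⁻¹, ?_⟩
  ext a
  simp

theorem sum_perm_comp {M : Type*} [AddCommMonoid M] (I J : Fin 3 → Fin n)
    (π κ σ : Equiv.Perm (Fin 3)) (f : Fin n → Fin n → M) :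
    ∑ a, f ((I ∘ π) (σ a)) ((J ∘ κ) a) = ∑ a, f (I ((π * σ * κ⁻¹) a)) (J a) := by
  rw [← Equiv.sum_comp κ fun a => f (I ((π * σ * κ⁻¹) a)) (J a)]
  simp

theorem minorSingular_comp {A : Matrix (Fin n) (Fin n) ℝ} {I J : Fin 3 → Fin n}
    (h : MinorSingular A I J) (π κ : Equiv.Perm (Fin 3)) :
    MinorSingular A (I ∘ π) (J ∘ κ) := by
  obtain ⟨σ, τ, h1, h2, h3⟩ := h
  have hE : ∀ σ, minorExponent (I ∘ π) (J ∘ κ) σ = minorExponent I J (π * σ * κ⁻¹) :=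
    fun σ => sum_perm_comp I J π κ σ fun i j => Finsupp.single (min i j, max i j) 1
  have hV : ∀ σ, minorValue A (I ∘ π) (J ∘ κ) σ = minorValue A I J (π * σ * κ⁻¹) :=
    fun σ => sum_perm_comp I J π κ σ A
  refine ⟨π⁻¹ * σ * κ, π⁻¹ * τ * κ, ?_, ?_, fun ρ => ?_⟩ <;>
    simp only [hE, hV, mul_assoc, mul_inv_cancel, mul_one, mul_inv_cancel_left]
  · exact h1
  · exact h2
  · exact h3 _

/-- Symmetric tropical rank at most two in terms of permutations. -/
theorem mem_symmTropRank_two_iff {A : Matrix (Fin n) (Fin n) ℝ} :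
    A ∈ symmTropRank n 2 ↔ A.IsSymm ∧ ∀ r c : Fin 3 → Fin n, Function.Injective r →
      Function.Injective c → MinorSingular A r c := by
  constructor
  · rintro ⟨hA, h⟩
    refine ⟨hA, fun r c hr hc => ?_⟩
    obtain ⟨I, π, rfl⟩ := exists_orderEmbedding_comp_perm hr
    obtain ⟨J, κ, rfl⟩ := exists_orderEmbedding_comp_perm hc
    exact minorSingular_comp
      ((minAttainedTwice_iff_minorSingular hA I.injective J.injective).1 (h I J)) π κ
  · rintro ⟨hA, h⟩
    exact ⟨hA, fun I J => (minAttainedTwice_iff_minorSingular hA I.injective J.injective).2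
      (h I J I.injective J.injective)⟩

theorem perm_fin_three_cases (ρ : Equiv.Perm (Fin 3)) :
    ρ = 1 ∨ (ρ 0 = 0 ∧ ρ 1 = 2 ∧ ρ 2 = 1) ∨ (ρ 0 = 1 ∧ ρ 1 = 0 ∧ ρ 2 = 2) ∨
      (ρ 0 = 1 ∧ ρ 1 = 2 ∧ ρ 2 = 0) ∨ (ρ 0 = 2 ∧ ρ 1 = 0 ∧ ρ 2 = 1) ∨
      (ρ 0 = 2 ∧ ρ 1 = 1 ∧ ρ 2 = 0) := by
  revert ρ; decide

theorem vec_three_injective {α : Type*} {a b c : α} (hab : a ≠ b) (hac : a ≠ c) (hbc : b ≠ c) :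
    Function.Injective ![a, b, c] := by
  intro i j h
  fin_cases i <;> fin_cases j <;> simp_all

/-- In a matrix of tropical rank two, no permutation attains the minimum of a minor alone. -/
theorem not_unique_min {A : Matrix (Fin n) (Fin n) ℝ} (hA : A ∈ symmTropRank n 2)
    {k l m i j h : Fin n} (hkl : k ≠ l) (hkm : k ≠ m) (hlm : l ≠ m) (hij : i ≠ j) (hih : i ≠ h)
    (hjh : j ≠ h) :
    ¬ (A k i + A l j + A m h < A k i + A m j + A l h ∧
      A k i + A l j + A m h < A l i + A k j + A m h ∧
      A k i + A l j + A m h < A l i + A m j + A k h ∧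
      A k i + A l j + A m h < A m i + A k j + A l h ∧
      A k i + A l j + A m h < A m i + A l j + A k h) := by
  rintro ⟨h1, h2, h3, h4, h5⟩
  obtain ⟨σ, τ, hne, heq, hmin⟩ := (mem_symmTropRank_two_iff.1 hA).2 _ _
    (vec_three_injective hkl hkm hlm) (vec_three_injective hij hih hjh)
  have key : ∀ ρ, minorValue A ![k, l, m] ![i, j, h] ρ ≤ A k i + A l j + A m h → ρ = 1 := by
    intro ρ hρ
    simp only [minorValue, Fin.sum_univ_three] at hρ
    rcases perm_fin_three_cases ρ with h | ⟨e0, e1, e2⟩ | ⟨e0, e1, e2⟩ | ⟨e0, e1, e2⟩ |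
      ⟨e0, e1, e2⟩ | ⟨e0, e1, e2⟩
    · exact h
    all_goals
      exfalso
      rw [e0, e1, e2] at hρ
      simp at hρ
      linarith
  have hone : minorValue A ![k, l, m] ![i, j, h] 1 = A k i + A l j + A m h := by
    simp [minorValue, Fin.sum_univ_three]
  have hσ := key σ ((hmin 1).trans hone.le)
  have hτ := key τ (heq ▸ ((hmin 1).trans hone.le))
  exact hne (by rw [hσ, hτ])

/-- In a principal minor, the two three-cycles do not attain the minimum alone. -/
theorem not_unique_min_principal {A : Matrix (Fin n) (Fin n) ℝ} (hA : A ∈ symmTropRank n 2)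
    {i j k : Fin n} (hij : i ≠ j) (hik : i ≠ k) (hjk : j ≠ k) :
    ¬ (A i j + A i k + A j k < A i i + A j j + A k k ∧
      A i j + A i k + A j k < A i i + 2 * A j k ∧
      A i j + A i k + A j k < A j j + 2 * A i k ∧
      A i j + A i k + A j k < A k k + 2 * A i j) := by
  rintro ⟨h1, h2, h3, h4⟩
  have hs := hA.1
  have hinj := vec_three_injective hij hik hjk
  obtain ⟨σ, τ, hne, heq, hmin⟩ := (mem_symmTropRank_two_iff.1 hA).2 _ _ hinj hinj
  have e1 := hs.apply i j
  have e2 := hs.apply i k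
  have e3 := hs.apply j k
  -- Both three-cycles give the monomial `x_ij x_ik x_jk`. If its value is strictly least, any two
  -- minimizing permutations have this same exponent.
  have key : ∀ ρ, minorValue A ![i, j, k] ![i, j, k] ρ ≤ A i j + A i k + A j k →
      minorExponent ![i, j, k] ![i, j, k] ρ = Finsupp.single (min i j, max i j) 1 +
        Finsupp.single (min i k, max i k) 1 + Finsupp.single (min j k, max j k) 1 := by
    intro ρ hρ
    simp only [minorValue, Fin.sum_univ_three] at hρ
    rcases perm_fin_three_cases ρ with h | ⟨e0, e1, e2⟩ | ⟨e0, e1, e2⟩ | ⟨e0, e1, e2⟩ |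
      ⟨e0, e1, e2⟩ | ⟨e0, e1, e2⟩
    · exfalso
      subst h
      simp at hρ
      linarith
    · exfalso
      rw [e0, e1, e2] at hρ
      simp at hρ
      linarith
    · exfalso
      rw [e0, e1, e2] at hρ
      simp at hρ
      linarith
    · simp only [minorExponent, Fin.sum_univ_three, e0, e1, e2]
      simp [min_comm j i, max_comm j i, min_comm k j, max_comm k j]
      abel
    · simp only [minorExponent, Fin.sum_univ_three, e0, e1, e2]
      simp [min_comm k i, max_comm k i]
      abel
    · exfalso
      rw [e0, e1, e2] at hρ
      simp at hρ
      linarith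
  obtain ⟨ρ, hρ⟩ : ∃ ρ : Equiv.Perm (Fin 3), ρ 0 = 1 ∧ ρ 1 = 2 ∧ ρ 2 = 0 := by decide
  have hv : minorValue A ![i, j, k] ![i, j, k] ρ = A i j + A i k + A j k := by
    simp only [minorValue, Fin.sum_univ_three, hρ.1, hρ.2.1, hρ.2.2]
    simp
    linarith
  have hσ := key σ ((hmin ρ).trans hv.le)
  have hτ := key τ (heq ▸ ((hmin ρ).trans hv.le))
  exact hne (by rw [hσ, hτ])

end Minors

/-! ### Weighted split systems -/

section SplitDist

variable {X : Type*} [Fintype X]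

open Classical in
/-- The distance of `x` and `y` for the weights `w` of splits, where each split is represented by
its two sides. -/
noncomputable def splitDist (w : Set X → ℝ) (x y : X) : ℝ :=
  ∑ B : Set X, if x ∈ B ∧ y ∉ B then w B else 0

open Classical in
/-- The total weight of the splits that separate `x, y` from `z, t`. -/
noncomputable def sepWeight (w : Set X → ℝ) (x y z t : X) : ℝ :=
  ∑ B : Set X, if x ∈ B ∧ y ∈ B ∧ z ∉ B ∧ t ∉ B then w B else 0

theorem sum_compl {M : Type*} [AddCommMonoid M] (f : Set X → M) : ∑ B, f Bᶜ = ∑ B, f B :=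
  Equiv.sum_comp (Function.Involutive.toPerm compl compl_involutive) f

theorem splitDist_comm {w : Set X → ℝ} (hw : ∀ B, w Bᶜ = w B) (x y : X) :
    splitDist w x y = splitDist w y x := by
  classical
  unfold splitDist
  rw [← sum_compl]
  refine Finset.sum_congr rfl fun B _ => ?_
  rw [hw B]
  by_cases h1 : x ∈ B <;> by_cases h2 : y ∈ B <;> simp [h1, h2]

theorem sepWeight_comm {w : Set X → ℝ} (hw : ∀ B, w Bᶜ = w B) (x y z t : X) :
    sepWeight w z t x y = sepWeight w x y z t := by
  classical
  unfold sepWeight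
  rw [← sum_compl]
  refine Finset.sum_congr rfl fun B _ => ?_
  rw [hw B]
  by_cases h1 : x ∈ B <;> by_cases h2 : y ∈ B <;> by_cases h3 : z ∈ B <;>
    by_cases h4 : t ∈ B <;> simp [h1, h2, h3, h4]

@[simp]
theorem splitDist_triangle {w : Set X → ℝ} (hw : ∀ B, 0 ≤ w B) (x y z : X) :
    splitDist w x z ≤ splitDist w x y + splitDist w y z := by
  unfold splitDist
  rw [← Finset.sum_add_distrib]
  refine Finset.sum_le_sum fun B _ => ?_
  have := hw B
  by_cases h1 : x ∈ B <;> by_cases h2 : y ∈ B <;> by_cases h3 : z ∈ B <;> simp [h1, h2, h3, this]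

theorem splitDist_add_of_forall {w : Set X → ℝ} {x y z : X}
    (h : ∀ B, w B ≠ 0 → (x ∈ B ↔ z ∈ B) → (x ∈ B ↔ y ∈ B)) :
    splitDist w x z = splitDist w x y + splitDist w y z := by
  unfold splitDist
  rw [← Finset.sum_add_distrib]
  refine Finset.sum_congr rfl fun B _ => ?_
  by_cases h0 : w B = 0
  · simp [h0]
  have := h B h0
  by_cases h1 : x ∈ B <;> by_cases h2 : y ∈ B <;> by_cases h3 : z ∈ B <;> simp_all

/-- Splits of type `x z | y t`, and splits that cut off at most one of the four points, contribute
equally to both pairs of distances and cancel. -/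
theorem splitDist_four_point {w : Set X → ℝ} (hw : ∀ B, w Bᶜ = w B) (x y z t : X) :
    splitDist w x t + splitDist w z y - splitDist w x y - splitDist w z t =
      2 * (sepWeight w x y z t - sepWeight w x t z y) := by
  have h : splitDist w x t + splitDist w z y - splitDist w x y - splitDist w z t =
      sepWeight w x y z t + sepWeight w z t x y - sepWeight w x t z y - sepWeight w z y x t := by
    unfold splitDist sepWeight
    simp only [← Finset.sum_add_distrib, ← Finset.sum_sub_distrib]
    refine Finset.sum_congr rfl fun B _ => ?_
    by_cases h1 : x ∈ B <;> by_cases h2 : y ∈ B <;> by_cases h3 : z ∈ B <;>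
      by_cases h4 : t ∈ B <;> simp [h1, h2, h3, h4]
  rw [h, sepWeight_comm hw, sepWeight_comm hw z y x t]
  rw [sepWeight_comm hw x t z y]
  ring

theorem le_sepWeight {w : Set X → ℝ} (hw : ∀ B, 0 ≤ w B) {x y z t : X} {B : Set X}
    (hx : x ∈ B) (hy : y ∈ B) (hz : z ∉ B) (ht : t ∉ B) : w B ≤ sepWeight w x y z t := by
  unfold sepWeight
  refine le_trans ?_ (Finset.single_le_sum (fun C _ => ?_) (Finset.mem_univ B))
  · simp [hx, hy, hz, ht]
  · split_ifs <;> simp [hw]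

theorem sepWeight_nonneg {w : Set X → ℝ} (hw : ∀ B, 0 ≤ w B) (x y z t : X) :
    0 ≤ sepWeight w x y z t :=
  Finset.sum_nonneg fun B _ => by split_ifs <;> simp [hw]

theorem sepWeight_eq_of_unique {w : Set X → ℝ} {x y z t : X} {B : Set X}
    (hx : x ∈ B) (hy : y ∈ B) (hz : z ∉ B) (ht : t ∉ B)
    (h : ∀ C, w C ≠ 0 → x ∈ C → y ∈ C → z ∉ C → t ∉ C → C = B) : sepWeight w x y z t = w B := by
  unfold sepWeight
  rw [Finset.sum_eq_single B]
  · simp [hx, hy, hz, ht]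
  · intro C _ hC
    split_ifs with h'
    · by_contra h0
      exact hC (h C h0 h'.1 h'.2.1 h'.2.2.1 h'.2.2.2)
    · rfl
  · simp

theorem sepWeight_eq_zero {w : Set X → ℝ} {x y z t : X}
    (h : ∀ C, w C ≠ 0 → x ∈ C → y ∈ C → z ∉ C → t ∉ C → False) : sepWeight w x y z t = 0 := by
  refine Finset.sum_eq_zero fun C _ => ?_
  split_ifs with h'
  · by_contra h0
    exact h C h0 h'.1 h'.2.1 h'.2.2.1 h'.2.2.2
  · rfl

end SplitDist

/-! ### Symbic split systems -/

section SymbicSplits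

variable {n : ℕ}

/-- The sides of the splits that are induced by the internal edges of a symbic tree. -/
structure IsSymbicSplitSystem (S : Set (Set (Fin n ⊕ Fin n))) : Prop where
  compl_mem : ∀ B ∈ S, Bᶜ ∈ S
  exists_inl : ∀ B ∈ S, ∃ i, Sum.inl i ∈ B
  exists_inr : ∀ B ∈ S, ∃ j, Sum.inr j ∈ B
  compatible : ∀ B ∈ S, ∀ C ∈ S, Disjoint B C ∨ B ⊆ C ∨ C ⊆ B ∨ Bᶜ ⊆ C
  swap_mem : ∀ B ∈ S, Sum.swap ⁻¹' B ∈ S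
  not_three_fixed : ∀ B ∈ S, ∀ C ∈ S, ∀ D ∈ S, Disjoint B C → Disjoint B D → Disjoint C D →
    Sum.swap ⁻¹' B = B → Sum.swap ⁻¹' C = C → Sum.swap ⁻¹' D = D → False

/-- Nonnegative weights on the splits in `S`, invariant under the color swap. -/
structure IsWeight (S : Set (Set (Fin n ⊕ Fin n))) (w : Set (Fin n ⊕ Fin n) → ℝ) : Prop where
  nonneg : ∀ B, 0 ≤ w B
  mem_of_ne_zero : ∀ B, w B ≠ 0 → B ∈ S
  compl : ∀ B, w Bᶜ = w B
  swap : ∀ B, w (Sum.swap ⁻¹' B) = w B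

/-- The matrix `A` is, up to scaling, `-1/2` times the distance matrix of the weights `w`. -/
def HasSplitForm (A : Matrix (Fin n) (Fin n) ℝ) (w : Set (Fin n ⊕ Fin n) → ℝ) : Prop :=
  ∃ x : Fin n → ℝ, ∀ i j, A i j = x i + x j - splitDist w (Sum.inl i) (Sum.inr j) / 2

theorem swap_preimage_swap_preimage (B : Set (Fin n ⊕ Fin n)) :
    Sum.swap ⁻¹' (Sum.swap ⁻¹' B) = B := by
  ext x
  simp

theorem splitDist_swap {w : Set (Fin n ⊕ Fin n) → ℝ} (hw : ∀ B, w (Sum.swap ⁻¹' B) = w B)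
    (x y : Fin n ⊕ Fin n) : splitDist w x.swap y.swap = splitDist w x y := by
  classical
  have hinv : Function.Involutive fun B : Set (Fin n ⊕ Fin n) => Sum.swap ⁻¹' B :=
    swap_preimage_swap_preimage
  unfold splitDist
  rw [← Equiv.sum_comp hinv.toPerm]
  refine Finset.sum_congr rfl fun B _ => ?_
  exact if_congr (by simp) (hw B) rfl

/-- The scaling vector cancels in a `2 × 2` minor, and the factor `-1/2` absorbs the `2` of the
four-point identity. All recovery of weights from `A` passes through this formula. -/
theorem HasSplitForm.minor_eq {A : Matrix (Fin n) (Fin n) ℝ} {w : Set (Fin n ⊕ Fin n) → ℝ}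
    (hA : HasSplitForm A w) (hw : ∀ B, w Bᶜ = w B) (k i l j : Fin n) :
    A k i + A l j - A k j - A l i =
      sepWeight w (Sum.inl k) (Sum.inr i) (Sum.inl l) (Sum.inr j) -
      sepWeight w (Sum.inl k) (Sum.inr j) (Sum.inl l) (Sum.inr i) := by
  obtain ⟨x, hx⟩ := hA
  have := splitDist_four_point hw (Sum.inl k) (Sum.inr i) (Sum.inl l) (Sum.inr j)
  simp only [hx]
  linarith

theorem HasSplitForm.isSymm {A : Matrix (Fin n) (Fin n) ℝ} {w : Set (Fin n ⊕ Fin n) → ℝ}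
    (hA : HasSplitForm A w) (hw : ∀ B, w Bᶜ = w B) (hw' : ∀ B, w (Sum.swap ⁻¹' B) = w B) :
    A.IsSymm := by
  obtain ⟨x, hx⟩ := hA
  ext i j
  have := splitDist_swap hw' (Sum.inl i) (Sum.inr j)
  simp only [Sum.swap_inl, Sum.swap_inr] at this
  rw [Matrix.transpose_apply, hx, hx, ← this, splitDist_comm hw]
  ring

variable {S : Set (Set (Fin n ⊕ Fin n))}

namespace IsSymbicSplitSystem

variable (hS : IsSymbicSplitSystem S)
include hS

theorem false_of_crossing {B C : Set (Fin n ⊕ Fin n)} (hB : B ∈ S) (hC : C ∈ S)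
    {x y z t : Fin n ⊕ Fin n} (hx : x ∈ B) (hy : y ∈ B) (hz : z ∉ B) (ht : t ∉ B)
    (hx' : x ∈ C) (hy' : y ∉ C) (hz' : z ∉ C) (ht' : t ∈ C) : False := by
  rcases hS.compatible B hB C hC with h | h | h | h
  · exact Set.disjoint_left.1 h hx hx'
  · exact hy' (h hy)
  · exact ht (h ht')
  · exact hz' (h hz)

/-- A common point excludes disjointness and a common outside point excludes covering, so
compatibility leaves only nesting. -/
theorem subset_or_subset {B C : Set (Fin n ⊕ Fin n)} (hB : B ∈ S) (hC : C ∈ S)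
    {x z : Fin n ⊕ Fin n} (hx : x ∈ B) (hx' : x ∈ C) (hz : z ∉ B) (hz' : z ∉ C) :
    B ⊆ C ∨ C ⊆ B := by
  rcases hS.compatible B hB C hC with h | h | h | h
  · exact absurd hx' (Set.disjoint_left.1 h hx)
  · exact Or.inl h
  · exact Or.inr h
  · exact absurd (h hz) hz'

/-- Take a maximal side `C` strictly inside `B`, a leaf of `B` outside `C`, and a leaf of the other
color in `C`. A side inside `B` with both leaves would be nested with `C`, and both directions fail.
If there is no `C`, any pair works. -/
theorem exists_pair_not_mem_ssubset {B : Set (Fin n ⊕ Fin n)} (hB : B ∈ S) :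
    ∃ k i, Sum.inl k ∈ B ∧ Sum.inr i ∈ B ∧
      ∀ C ∈ S, C ⊂ B → Sum.inl k ∈ C → Sum.inr i ∈ C → False := by
  by_cases h : ∃ C ∈ S, C ⊂ B
  swap
  · obtain ⟨k, hk⟩ := hS.exists_inl B hB
    obtain ⟨i, hi⟩ := hS.exists_inr B hB
    exact ⟨k, i, hk, hi, fun C hC hCB _ _ => h ⟨C, hC, hCB⟩⟩
  obtain ⟨C, ⟨hC, hCB⟩, hmax⟩ :=
    (Set.toFinite {C | C ∈ S ∧ C ⊂ B}).exists_maximal h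
  have key : ∀ x ∈ B, x ∉ C → ∀ y ∈ C, ∀ D ∈ S, D ⊂ B → x ∈ D → y ∈ D → False := by
    intro x hxB hxC y hyC D hD hDB hxD hyD
    obtain ⟨z, hz⟩ := hS.exists_inl _ (hS.compl_mem B hB)
    rcases hS.subset_or_subset hC hD hyC hyD (fun h => hz (hCB.1 h)) (fun h => hz (hDB.1 h))
      with h | h
    · exact hxC (hmax ⟨hD, hDB⟩ h hxD)
    · exact hxC (h hxD)
  obtain ⟨x, hxB, hxC⟩ := Set.exists_of_ssubset hCB
  rcases x with k | i
  · obtain ⟨i, hi⟩ := hS.exists_inr C hC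
    exact ⟨k, i, hxB, hCB.1 hi, fun D hD hDB => key _ hxB hxC _ hi D hD hDB⟩
  · obtain ⟨k, hk⟩ := hS.exists_inl C hC
    exact ⟨k, i, hCB.1 hk, hxB, fun D hD hDB hk' hi' => key _ hxB hxC _ hk D hD hDB hi' hk'⟩

/-- Each split is the only one that separates a suitable quadruple. -/
theorem exists_dual {B : Set (Fin n ⊕ Fin n)} (hB : B ∈ S) :
    ∃ k i l j, Sum.inl k ∈ B ∧ Sum.inr i ∈ B ∧ Sum.inl l ∉ B ∧ Sum.inr j ∉ B ∧
      ∀ C ∈ S, Sum.inl k ∈ C → Sum.inr i ∈ C → Sum.inl l ∉ C → Sum.inr j ∉ C → C = B := by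
  obtain ⟨k, i, hk, hi, h1⟩ := hS.exists_pair_not_mem_ssubset hB
  obtain ⟨l, j, hl, hj, h2⟩ := hS.exists_pair_not_mem_ssubset (hS.compl_mem B hB)
  refine ⟨k, i, l, j, hk, hi, hl, hj, fun C hC hk' hi' hl' hj' => ?_⟩
  by_contra hne
  -- A larger `C` has a smaller complement, against the choice of `l, j`; a smaller `C` is against
  -- the choice of `k, i`.
  rcases hS.subset_or_subset hB hC hk hk' hl hl' with h | h
  · exact h2 Cᶜ (hS.compl_mem C hC)
      (compl_lt_compl_iff_lt.2 (h.ssubset_of_ne (Ne.symm hne))) hl' hj'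
  · exact h1 C hC (h.ssubset_of_ne hne) hk' hi'

/-- The sides through `k₀` that avoid `l` and `j` form a chain. Its largest member absorbs the
primed leaves of `B`, and then, through `i₀`, the unprimed ones. -/
theorem exists_superset_of_forall_separated {B : Set (Fin n ⊕ Fin n)} {k₀ i₀ l j : Fin n}
    (hk₀ : Sum.inl k₀ ∈ B) (hi₀ : Sum.inr i₀ ∈ B)
    (h : ∀ k i, Sum.inl k ∈ B → Sum.inr i ∈ B →
      ∃ C ∈ S, Sum.inl k ∈ C ∧ Sum.inr i ∈ C ∧ Sum.inl l ∉ C ∧ Sum.inr j ∉ C) :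
    ∃ C ∈ S, B ⊆ C ∧ Sum.inl l ∉ C ∧ Sum.inr j ∉ C := by
  obtain ⟨C₀, h₀, h₀k, -, h₀l, h₀j⟩ := h k₀ i₀ hk₀ hi₀
  obtain ⟨C, ⟨hC, hCk, hCl, hCj⟩, hmax⟩ := (Set.toFinite {C | C ∈ S ∧ Sum.inl k₀ ∈ C ∧
    Sum.inl l ∉ C ∧ Sum.inr j ∉ C}).exists_maximal ⟨C₀, h₀, h₀k, h₀l, h₀j⟩
  have hr : ∀ i, Sum.inr i ∈ B → Sum.inr i ∈ C := by
    intro i hi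
    obtain ⟨D, hD, hDk, hDi, hDl, hDj⟩ := h k₀ i hk₀ hi
    rcases hS.subset_or_subset hC hD hCk hDk hCl hDl with h' | h'
    · exact hmax ⟨hD, hDk, hDl, hDj⟩ h' hDi
    · exact h' hDi
  refine ⟨C, hC, ?_, hCl, hCj⟩
  rintro (k | i) hx
  · obtain ⟨D, hD, hDk, hDi, hDl, hDj⟩ := h k i₀ hx hi₀
    rcases hS.subset_or_subset hC hD (hr i₀ hi₀) hDi hCl hDl with h' | h'
    · exact hmax ⟨hD, h' hCk, hDl, hDj⟩ h' hDk
    · exact h' hDk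
  · exact hr i hx

/-- A split all of whose quadruples are separated by splits in `S` is in `S`. -/
theorem mem_of_forall_separated {B : Set (Fin n ⊕ Fin n)} {k₀ i₀ l₀ j₀ : Fin n}
    (hk₀ : Sum.inl k₀ ∈ B) (hi₀ : Sum.inr i₀ ∈ B) (hl₀ : Sum.inl l₀ ∉ B) (hj₀ : Sum.inr j₀ ∉ B)
    (h : ∀ k i l j, Sum.inl k ∈ B → Sum.inr i ∈ B → Sum.inl l ∉ B → Sum.inr j ∉ B →
      ∃ C ∈ S, Sum.inl k ∈ C ∧ Sum.inr i ∈ C ∧ Sum.inl l ∉ C ∧ Sum.inr j ∉ C) : B ∈ S := by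
  have h' : ∀ l j, Sum.inl l ∉ B → Sum.inr j ∉ B →
      ∃ C ∈ S, B ⊆ C ∧ Sum.inl l ∉ C ∧ Sum.inr j ∉ C := fun l j hl hj =>
    hS.exists_superset_of_forall_separated hk₀ hi₀ fun k i hk hi => h k i l j hk hi hl hj
  obtain ⟨C₀, h₀, h₀B, h₀l, -⟩ := h' l₀ j₀ hl₀ hj₀
  -- The chain argument on the outer side: the smallest side that contains `B` and misses `l₀`
  -- misses the primed leaves outside `B`, and then the unprimed ones.
  obtain ⟨C, ⟨hC, hBC, hCl⟩, hmin⟩ := (Set.toFinite {C | C ∈ S ∧ B ⊆ C ∧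
    Sum.inl l₀ ∉ C}).exists_minimal ⟨C₀, h₀, h₀B, h₀l⟩
  have hr : ∀ j, Sum.inr j ∉ B → Sum.inr j ∉ C := by
    intro j hj hjC
    obtain ⟨D, hD, hBD, hDl, hDj⟩ := h' l₀ j hl₀ hj
    rcases hS.subset_or_subset hC hD (hBC hk₀) (hBD hk₀) hCl hDl with h | h
    · exact hDj (h hjC)
    · exact hDj (hmin ⟨hD, hBD, hDl⟩ h hjC)
  have hCB : C ⊆ B := by
    rintro (l | j) hx
    · by_contra hl
      obtain ⟨D, hD, hBD, hDl, hDj⟩ := h' l j₀ hl hj₀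
      rcases hS.subset_or_subset hC hD (hBC hk₀) (hBD hk₀) (hr _ hj₀) hDj with h | h
      · exact hDl (h hx)
      · exact hDl (hmin ⟨hD, hBD, fun h'' => hCl (h h'')⟩ h hx)
    · by_contra hj
      exact hr j hj hx
  rwa [hBC.antisymm hCB]

theorem sepWeight_eq_zero_of_mem {w : Set (Fin n ⊕ Fin n) → ℝ} (hw : IsWeight S w)
    {B : Set (Fin n ⊕ Fin n)} (hB : B ∈ S) {x y z t : Fin n ⊕ Fin n}
    (hx : x ∈ B) (hy : y ∈ B) (hz : z ∉ B) (ht : t ∉ B) : sepWeight w x t z y = 0 :=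
  sepWeight_eq_zero fun C hC hxC htC hzC hyC =>
    hS.false_of_crossing hB (hw.mem_of_ne_zero C hC) hx hy hz ht hxC hyC hzC htC

/-- The weights are determined by the matrix. -/
theorem weight_le_of_hasSplitForm {S' : Set (Set (Fin n ⊕ Fin n))}
    (hS' : IsSymbicSplitSystem S') {w w' : Set (Fin n ⊕ Fin n) → ℝ} (hw : IsWeight S w)
    (hw' : IsWeight S' w') {A : Matrix (Fin n) (Fin n) ℝ} (hA : HasSplitForm A w)
    (hA' : HasSplitForm A w') (B : Set (Fin n ⊕ Fin n)) : w B ≤ w' B := by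
  by_cases hB0 : w B = 0
  · rw [hB0]
    exact hw'.nonneg B
  have hB := hw.mem_of_ne_zero B hB0
  -- No split of `S` crosses `B`, so each minor across `B` is at least `w B`; computed with `w'`, it
  -- is the same minor.
  have hle : ∀ k i l j, Sum.inl k ∈ B → Sum.inr i ∈ B → Sum.inl l ∉ B → Sum.inr j ∉ B →
      w B ≤ sepWeight w' (Sum.inl k) (Sum.inr i) (Sum.inl l) (Sum.inr j) -
      sepWeight w' (Sum.inl k) (Sum.inr j) (Sum.inl l) (Sum.inr i) := by
    intro k i l j hk hi hl hj
    rw [← hA'.minor_eq hw'.compl, hA.minor_eq hw.compl,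
      hS.sepWeight_eq_zero_of_mem hw hB hk hi hl hj, sub_zero]
    exact le_sepWeight hw.nonneg hk hi hl hj
  have hpos : 0 < w B := lt_of_le_of_ne (hw.nonneg B) (Ne.symm hB0)
  have hB' : B ∈ S' := by
    obtain ⟨k, hk⟩ := hS.exists_inl B hB
    obtain ⟨i, hi⟩ := hS.exists_inr B hB
    obtain ⟨l, hl⟩ := hS.exists_inl _ (hS.compl_mem B hB)
    obtain ⟨j, hj⟩ := hS.exists_inr _ (hS.compl_mem B hB)
    refine hS'.mem_of_forall_separated hk hi hl hj fun k i l j hk hi hl hj => ?_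
    by_contra! hne
    have h1 := hle k i l j hk hi hl hj
    rw [sepWeight_eq_zero fun C hC hk hi hl hj => hj (hne C (hw'.mem_of_ne_zero C hC) hk hi hl)]
      at h1
    have h2 := sepWeight_nonneg hw'.nonneg (Sum.inl k) (Sum.inr j) (Sum.inl l) (Sum.inr i)
    linarith
  -- On a quadruple dual to `B` in `S'`, the minor equals `w' B`.
  obtain ⟨k, i, l, j, hk, hi, hl, hj, huniq⟩ := hS'.exists_dual hB'
  have h1 := hle k i l j hk hi hl hj
  rwa [hS'.sepWeight_eq_zero_of_mem hw' hB' hk hi hl hj, sub_zero,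
    sepWeight_eq_of_unique hk hi hl hj fun C hC => huniq C (hw'.mem_of_ne_zero C hC)] at h1

theorem weight_eq_of_hasSplitForm {S' : Set (Set (Fin n ⊕ Fin n))}
    (hS' : IsSymbicSplitSystem S') {w w' : Set (Fin n ⊕ Fin n) → ℝ} (hw : IsWeight S w)
    (hw' : IsWeight S' w') {A : Matrix (Fin n) (Fin n) ℝ} (hA : HasSplitForm A w)
    (hA' : HasSplitForm A w') : w = w' :=
  funext fun B => le_antisymm (hS.weight_le_of_hasSplitForm hS' hw hw' hA hA' B)
    (hS'.weight_le_of_hasSplitForm hS hw' hw hA' hA B)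

/-! ### Split matrices have symmetric tropical rank at most two -/

/-- An edge lies either inside the branch `P`, and then does not separate the points outside it, or
outside `P`, and then does not separate the points within it. -/
theorem mem_iff_or_of_disjoint {B P Q R : Set (Fin n ⊕ Fin n)} (hB : B ∈ S) (hP : P ∈ S)
    (hPQ : Disjoint P Q) (hPR : Disjoint P R) {a a' b b' c c' : Fin n ⊕ Fin n} (ha : a ∈ P)
    (ha' : a' ∈ P) (hb : b ∈ Q) (hb' : b' ∈ Q) (hc : c ∈ R) (hc' : c' ∈ R) :
    (a ∈ B ↔ a' ∈ B) ∨ ((b ∈ B ↔ b' ∈ B) ∧ (b ∈ B ↔ c ∈ B) ∧ (b ∈ B ↔ c' ∈ B)) := by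
  have hbP := Set.disjoint_right.1 hPQ hb
  have hbP' := Set.disjoint_right.1 hPQ hb'
  have hcP := Set.disjoint_right.1 hPR hc
  have hcP' := Set.disjoint_right.1 hPR hc'
  rcases hS.compatible P hP B hB with h | h | h | h
  · exact Or.inl (iff_of_false (Set.disjoint_left.1 h ha) (Set.disjoint_left.1 h ha'))
  · exact Or.inl (iff_of_true (h ha) (h ha'))
  · refine Or.inr ⟨iff_of_false ?_ ?_, iff_of_false ?_ ?_, iff_of_false ?_ ?_⟩ <;>
      exact fun h' => by have := h h'; contradiction
  · exact Or.inr ⟨iff_of_true (h hbP) (h hbP'), iff_of_true (h hbP) (h hcP),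
      iff_of_true (h hbP) (h hcP')⟩

/-- Paths between different branches run through a common center, so both sums are the total
distance of the six leaves from it. The proof compares the contributions of each split. -/
theorem splitDist_cyclic {w : Set (Fin n ⊕ Fin n) → ℝ} (hw : IsWeight S w)
    {P Q R : Set (Fin n ⊕ Fin n)} (hP : P ∈ S) (hQ : Q ∈ S) (hR : R ∈ S)
    (hPQ : Disjoint P Q) (hPR : Disjoint P R) (hQR : Disjoint Q R)
    {a a' b b' c c' : Fin n ⊕ Fin n} (ha : a ∈ P)
    (ha' : a' ∈ P) (hb : b ∈ Q) (hb' : b' ∈ Q) (hc : c ∈ R) (hc' : c' ∈ R) :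
    splitDist w a c' + splitDist w b a' + splitDist w c b' =
      splitDist w a b' + splitDist w b c' + splitDist w c a' := by
  unfold splitDist
  simp only [← Finset.sum_add_distrib]
  refine Finset.sum_congr rfl fun B _ => ?_
  by_cases h0 : w B = 0
  · simp [h0]
  have hB := hw.mem_of_ne_zero B h0
  have h1 := hS.mem_iff_or_of_disjoint hB hP hPQ hPR ha ha' hb hb' hc hc'
  have h2 := hS.mem_iff_or_of_disjoint hB hQ hPQ.symm hQR hb hb' ha ha' hc hc'
  have h3 := hS.mem_iff_or_of_disjoint hB hR hPR.symm hQR.symm hc hc' ha ha' hb hb'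
  by_cases m1 : a ∈ B <;> by_cases m2 : a' ∈ B <;> by_cases m3 : b ∈ B <;>
    by_cases m4 : b' ∈ B <;> by_cases m5 : c ∈ B <;> by_cases m6 : c' ∈ B <;>
    simp only [m1, m2, m3, m4, m5, m6] at h1 h2 h3 ⊢ <;> simp at h1 h2 h3 ⊢

/-- `P` and its swap both contain `i` and miss `j`, hence are nested; applying the swap again turns
inclusion into equality. -/
theorem swap_preimage_eq {P Q : Set (Fin n ⊕ Fin n)} (hP : P ∈ S) (hPQ : Disjoint P Q)
    {i j : Fin n} (hi : Sum.inl i ∈ P) (hi' : Sum.inr i ∈ P) (hj : Sum.inl j ∈ Q)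
    (hj' : Sum.inr j ∈ Q) : Sum.swap ⁻¹' P = P := by
  have h1 : Sum.inl i ∈ Sum.swap ⁻¹' P := hi'
  have h2 : Sum.inl j ∉ Sum.swap ⁻¹' P := Set.disjoint_right.1 hPQ hj'
  rcases hS.subset_or_subset (hS.swap_mem P hP) hP h1 hi h2 (Set.disjoint_right.1 hPQ hj)
    with h | h
  · refine h.antisymm ?_
    simpa [swap_preimage_swap_preimage] using Set.preimage_mono (f := Sum.swap) h
  · exact Set.Subset.antisymm
      (by simpa [swap_preimage_swap_preimage] using Set.preimage_mono (f := Sum.swap) h) h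

theorem false_of_three {P Q R : Set (Fin n ⊕ Fin n)} (hP : P ∈ S) (hQ : Q ∈ S) (hR : R ∈ S)
    (hPQ : Disjoint P Q) (hPR : Disjoint P R) (hQR : Disjoint Q R) {i j k : Fin n}
    (hi : Sum.inl i ∈ P) (hi' : Sum.inr i ∈ P) (hj : Sum.inl j ∈ Q) (hj' : Sum.inr j ∈ Q)
    (hk : Sum.inl k ∈ R) (hk' : Sum.inr k ∈ R) : False :=
  hS.not_three_fixed P hP Q hQ R hR hPQ hPR hQR (hS.swap_preimage_eq hP hPQ hi hi' hj hj')
    (hS.swap_preimage_eq hQ hPQ.symm hj hj' hi hi') (hS.swap_preimage_eq hR hPR.symm hk hk' hi hi')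

/-- If no transposition improves on the matching of `r a` with `c a`, then the leaves are arranged
around three disjoint sides of splits. -/
theorem exists_three_disjoint {C D E : Set (Fin n ⊕ Fin n)} (hC : C ∈ S) (hD : D ∈ S) (hE : E ∈ S)
    {r₀ r₁ r₂ c₀ c₁ c₂ : Fin n ⊕ Fin n} (h1 : r₀ ∈ C) (h2 : c₁ ∈ C) (h3 : r₁ ∉ C) (h4 : c₀ ∉ C)
    (h5 : r₀ ∈ D) (h6 : c₂ ∈ D) (h7 : r₂ ∉ D) (h8 : c₀ ∉ D)
    (h9 : r₁ ∈ E) (h10 : c₂ ∈ E) (h11 : r₂ ∉ E) (h12 : c₁ ∉ E) :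
    (Disjoint C E ∧ Disjoint C Dᶜ ∧ Disjoint E Dᶜ) ∨
      (Disjoint D Cᶜ ∧ Disjoint D Eᶜ ∧ Disjoint Cᶜ Eᶜ) := by
  have hC' := hS.compl_mem C hC
  have hCE := hS.subset_or_subset hC' hE h3 h9 (fun h => h h2) h12
  have hDE := hS.subset_or_subset hD hE h6 h10 h7 h11
  have key : ∀ {P Q : Set (Fin n ⊕ Fin n)}, P ⊆ Q → Disjoint P Qᶜ := fun h =>
    Set.disjoint_left.2 fun x hx hx' => hx' (h hx)
  rcases hS.subset_or_subset hC hD h1 h5 h4 h8 with h | h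
  · left
    have hED : E ⊆ D := by
      rcases hDE with h' | h'
      · exact absurd (h' (h h2)) h12
      · exact h'
    refine ⟨?_, key h, key hED⟩
    rcases hCE with h' | h'
    · exact absurd (hED (h' h4)) h8
    · exact Set.disjoint_right.2 fun x hx hx' => h' hx hx'
  · right
    have hCE' : Cᶜ ⊆ E := by
      rcases hCE with h' | h'
      · exact h'
      · exact absurd (h h6) (h' h10)
    have hDE' : D ⊆ E := by
      rcases hDE with h' | h'
      · exact h'
      · by_contra
        exact h8 (h' (hCE' h4))
    exact ⟨Set.disjoint_left.2 fun x hx hx' => hx' (h hx), key hDE', key hCE'⟩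

/-- A matching with the same value as the identity in a minor of a split matrix. -/
theorem exists_minorValue_le {w : Set (Fin n ⊕ Fin n) → ℝ} (hw : IsWeight S w)
    {A : Matrix (Fin n) (Fin n) ℝ} (hA : HasSplitForm A w) {r c : Fin 3 → Fin n}
    (hr : Function.Injective r) (hc : Function.Injective c) :
    ∃ τ, minorExponent r c 1 ≠ minorExponent r c τ ∧ minorValue A r c τ ≤ minorValue A r c 1 := by
  by_contra! hcon
  -- A transposition changes the sign, hence the monomial, so it strictly increases the value. By
  -- the minor formula some split then separates `r a, c b` from `r b, c a`.
  have swaps : ∀ a b : Fin 3, a ≠ b → ∃ C ∈ S, Sum.inl (r a) ∈ C ∧ Sum.inr (c b) ∈ C ∧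
      Sum.inl (r b) ∉ C ∧ Sum.inr (c a) ∉ C := by
    intro a b hab
    by_contra! hne
    have h1 := hcon (Equiv.swap a b) (fun h => by
      have := sign_eq_of_minorExponent_eq hr hc h
      rw [Equiv.Perm.sign_swap hab, Equiv.Perm.sign_one] at this
      exact absurd this (by decide))
    have h2 := hA.minor_eq hw.compl (r a) (c a) (r b) (c b)
    rw [sepWeight_eq_zero (x := Sum.inl (r a)) (y := Sum.inr (c b)) fun C hC h1 h2 h3 h4 =>
      h4 (hne C (hw.mem_of_ne_zero C hC) h1 h2 h3), sub_zero] at h2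
    have h3 := sepWeight_nonneg hw.nonneg (Sum.inl (r a)) (Sum.inr (c a)) (Sum.inl (r b))
      (Sum.inr (c b))
    have h4 : minorValue A r c (Equiv.swap a b) - minorValue A r c 1 =
        A (r b) (c a) + A (r a) (c b) - A (r a) (c a) - A (r b) (c b) := by
      simp only [minorValue, Fin.sum_univ_three]
      fin_cases a <;> fin_cases b <;> simp [Equiv.swap_apply_def] at hab ⊢ <;> ring
    linarith
  obtain ⟨C, hC, h1, h2, h3, h4⟩ := swaps 0 1 (by decide)
  obtain ⟨D, hD, h5, h6, h7, h8⟩ := swaps 0 2 (by decide)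
  obtain ⟨E, hE, h9, h10, h11, h12⟩ := swaps 1 2 (by decide)
  obtain ⟨x, hx⟩ := hA
  -- If a fixed-point-free `ρ` has the monomial of the identity, each variable must reappear
  -- transposed: row labels are also column labels.
  have cyc : ∀ ρ : Equiv.Perm (Fin 3), minorExponent r c 1 = minorExponent r c ρ →
      (∀ a, ρ a ≠ a) → ∀ a, ∃ b, b ≠ a ∧ ρ b ≠ a ∧ r a = c b ∧ c a = r (ρ b) := by
    intro ρ h hρ a
    have h' := DFunLike.congr_fun h (min (r a) (c a), max (r a) (c a))
    simp only [minorExponent, Finsupp.finsetSum_apply] at h'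
    have h0 : (0 : ℕ) < ∑ b, (Finsupp.single (min (r (ρ b)) (c b), max (r (ρ b)) (c b)) 1 :
        Fin n × Fin n →₀ ℕ) (min (r a) (c a), max (r a) (c a)) := by
      rw [← h']
      exact Finset.sum_pos' (fun _ _ => Nat.zero_le _) ⟨a, Finset.mem_univ _, by simp⟩
    obtain ⟨b, -, hb⟩ := Finset.exists_ne_zero_of_sum_ne_zero h0.ne'
    have hb' : (min (r (ρ b)) (c b), max (r (ρ b)) (c b)) = (min (r a) (c a), max (r a) (c a)) := by
      by_contra hne
      simp [hne] at hb
    rcases min_max_pair_eq hb' with ⟨h1, h2⟩ | ⟨h1, h2⟩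
    · exact absurd ((hr h1).trans (hc h2).symm) (hρ b)
    · refine ⟨b, ?_, ?_, h2.symm, h1.symm⟩
      · rintro rfl
        exact hρ b (hr (h1.trans h2))
      · intro h
        rw [h] at h1
        exact hρ b (h.trans (hc (h1.symm.trans h2.symm)))
  have hC' := hS.compl_mem C hC
  have hD' := hS.compl_mem D hD
  have hE' := hS.compl_mem E hE
  -- In both cases three disjoint branches each hold one row and one column leaf. A three-cycle has
  -- the same value, hence by `hcon` the same monomial, so each branch contains some `i` and `i'`,
  -- which is impossible.
  rcases hS.exists_three_disjoint hC hD hE h1 h2 h3 h4 h5 h6 h7 h8 h9 h10 h11 h12 with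
    ⟨d1, d2, d3⟩ | ⟨d1, d2, d3⟩
  · obtain ⟨ρ, e0, e1, e2⟩ : ∃ ρ : Equiv.Perm (Fin 3), ρ 0 = 1 ∧ ρ 1 = 2 ∧ ρ 2 = 0 := by decide
    have h := hS.splitDist_cyclic hw hC hE hD' d1 d2 d3 h1 h2 h9 h10 h7 h8
    have hv : minorValue A r c ρ ≤ minorValue A r c 1 := by
      simp only [minorValue, Fin.sum_univ_three, e0, e1, e2, Equiv.Perm.one_apply, hx]
      linarith
    have heq : minorExponent r c 1 = minorExponent r c ρ := by
      by_contra hne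
      exact absurd (hcon ρ hne) (not_lt.2 hv)
    have hρ : ∀ a, ρ a ≠ a := by
      intro a
      fin_cases a <;> simp [e0, e1, e2]
    have f0 : r 0 = c 1 ∧ c 0 = r 2 := by
      obtain ⟨b, hb, hb', hb1, hb2⟩ := cyc ρ heq hρ 0
      fin_cases b <;> simp [e1, e2] at hb hb' hb1 hb2 ⊢
      exact ⟨hb1, hb2⟩
    have f1 : r 1 = c 2 := by
      obtain ⟨b, hb, hb', hb1, -⟩ := cyc ρ heq hρ 1
      fin_cases b <;> simp [e0, e2] at hb hb' hb1 ⊢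
      exact hb1
    rw [← f0.1] at h2
    rw [f0.2] at h8
    rw [← f1] at h10
    exact hS.false_of_three hC hE hD' d1 d2 d3 h1 h2 h9 h10 h7 h8
  · obtain ⟨ρ, e0, e1, e2⟩ : ∃ ρ : Equiv.Perm (Fin 3), ρ 0 = 2 ∧ ρ 1 = 0 ∧ ρ 2 = 1 := by decide
    have h := hS.splitDist_cyclic hw hD hC' hE' d1 d2 d3 h5 h6 h3 h4 h11 h12
    have hv : minorValue A r c ρ ≤ minorValue A r c 1 := by
      simp only [minorValue, Fin.sum_univ_three, e0, e1, e2, Equiv.Perm.one_apply, hx]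
      linarith
    have heq : minorExponent r c 1 = minorExponent r c ρ := by
      by_contra hne
      exact absurd (hcon ρ hne) (not_lt.2 hv)
    have hρ : ∀ a, ρ a ≠ a := by
      intro a
      fin_cases a <;> simp [e0, e1, e2]
    have f0 : r 0 = c 2 ∧ c 0 = r 1 := by
      obtain ⟨b, hb, hb', hb1, hb2⟩ := cyc ρ heq hρ 0
      fin_cases b <;> simp [e1, e2] at hb hb' hb1 hb2 ⊢
      exact ⟨hb1, hb2⟩
    have f1 : c 1 = r 2 := by
      obtain ⟨b, hb, hb', -, hb2⟩ := cyc ρ heq hρ 1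
      fin_cases b <;> simp [e0, e2] at hb hb' hb2 ⊢
      exact hb2
    rw [← f0.1] at h6
    rw [f0.2] at h4
    rw [f1] at h12
    exact hS.false_of_three hD hC' hE' d1 d2 d3 h5 h6 h3 h4 h11 h12

/-- Composing the rows with a minimizing permutation makes the identity a minimizer, and
`exists_minorValue_le` supplies the second monomial. -/
theorem mem_symmTropRank {w : Set (Fin n ⊕ Fin n) → ℝ} (hw : IsWeight S w)
    {A : Matrix (Fin n) (Fin n) ℝ} (hA : HasSplitForm A w) : A ∈ symmTropRank n 2 := by
  refine mem_symmTropRank_two_iff.2 ⟨hA.isSymm hw.compl hw.swap, fun r c hr hc => ?_⟩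
  obtain ⟨σ, hσ⟩ := Finite.exists_min (minorValue A r c)
  obtain ⟨τ, hτ, hle⟩ := hS.exists_minorValue_le hw hA (hr.comp σ.injective) hc
  have hE : ∀ τ, minorExponent (r ∘ σ) c τ = minorExponent r c (σ * τ) := fun _ => rfl
  have hV : ∀ τ, minorValue A (r ∘ σ) c τ = minorValue A r c (σ * τ) := fun _ => rfl
  rw [hE, hE, mul_one] at hτ
  rw [hV, hV, mul_one] at hle
  exact ⟨σ, σ * τ, hτ, le_antisymm (hσ _) hle, hσ⟩

end IsSymbicSplitSystem

end SymbicSplits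

/-! ### The split system of a matrix of symmetric tropical rank two -/

section MatrixSplits

variable {n : ℕ}

/-- The tropical `2 × 2` minor with rows `k, l` and columns `i, j`. -/
def quadMinor (A : Matrix (Fin n) (Fin n) ℝ) (k i l j : Fin n) : ℝ :=
  A k i + A l j - A k j - A l i

/-- The isolation index of the split with side `B`. -/
noncomputable def isolationIndex (A : Matrix (Fin n) (Fin n) ℝ) (B : Set (Fin n ⊕ Fin n)) : ℝ :=
  max 0 (⨅ q : {q : Fin n × Fin n × Fin n × Fin n // Sum.inl q.1 ∈ B ∧ Sum.inr q.2.1 ∈ B ∧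
    Sum.inl q.2.2.1 ∉ B ∧ Sum.inr q.2.2.2 ∉ B}, quadMinor A q.1.1 q.1.2.1 q.1.2.2.1 q.1.2.2.2)

variable {A : Matrix (Fin n) (Fin n) ℝ} {B : Set (Fin n ⊕ Fin n)}

theorem isolationIndex_nonneg (A : Matrix (Fin n) (Fin n) ℝ) (B : Set (Fin n ⊕ Fin n)) :
    0 ≤ isolationIndex A B :=
  le_max_left _ _

theorem isolationIndex_le (hB : 0 < isolationIndex A B) {k i l j : Fin n} (hk : Sum.inl k ∈ B)
    (hi : Sum.inr i ∈ B) (hl : Sum.inl l ∉ B) (hj : Sum.inr j ∉ B) :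
    isolationIndex A B ≤ quadMinor A k i l j := by
  unfold isolationIndex at hB ⊢
  rw [lt_max_iff, or_iff_right (lt_irrefl _)] at hB
  rw [max_eq_right hB.le]
  exact ciInf_le (Set.finite_range _).bddBelow
    (⟨(k, i, l, j), hk, hi, hl, hj⟩ : {q : Fin n × Fin n × Fin n × Fin n // _})

theorem exists_of_isolationIndex_pos (hB : 0 < isolationIndex A B) :
    ∃ k i l j, Sum.inl k ∈ B ∧ Sum.inr i ∈ B ∧ Sum.inl l ∉ B ∧ Sum.inr j ∉ B := by
  by_contra! h
  unfold isolationIndex at hB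
  have : IsEmpty {q : Fin n × Fin n × Fin n × Fin n // Sum.inl q.1 ∈ B ∧ Sum.inr q.2.1 ∈ B ∧
      Sum.inl q.2.2.1 ∉ B ∧ Sum.inr q.2.2.2 ∉ B} :=
    ⟨fun q => q.2.2.2.2 (h _ _ _ _ q.2.1 q.2.2.1 q.2.2.2.1)⟩
  -- A real infimum over no quadruples is `0`, so splits without both colors on both sides have
  -- index `0`.
  rw [Real.iInf_of_isEmpty, max_self] at hB
  exact lt_irrefl _ hB

theorem le_isolationIndex {c : ℝ} {k i l j : Fin n} (hk : Sum.inl k ∈ B)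
    (hi : Sum.inr i ∈ B) (hl : Sum.inl l ∉ B) (hj : Sum.inr j ∉ B)
    (h : ∀ k i l j, Sum.inl k ∈ B → Sum.inr i ∈ B → Sum.inl l ∉ B → Sum.inr j ∉ B →
      c ≤ quadMinor A k i l j) : c ≤ isolationIndex A B := by
  have : Nonempty {q : Fin n × Fin n × Fin n × Fin n // Sum.inl q.1 ∈ B ∧ Sum.inr q.2.1 ∈ B ∧
      Sum.inl q.2.2.1 ∉ B ∧ Sum.inr q.2.2.2 ∉ B} := ⟨⟨(k, i, l, j), hk, hi, hl, hj⟩⟩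
  exact le_max_of_le_right (le_ciInf fun q => h _ _ _ _ q.2.1 q.2.2.1 q.2.2.2.1 q.2.2.2.2)

theorem quadMinor_swap (hA : A.IsSymm) (k i l j : Fin n) :
    quadMinor A i k j l = quadMinor A k i l j := by
  unfold quadMinor
  rw [hA.apply k i, hA.apply l j, hA.apply l i, hA.apply k j]
  ring

theorem isolationIndex_le_compl (A : Matrix (Fin n) (Fin n) ℝ) (B : Set (Fin n ⊕ Fin n)) :
    isolationIndex A B ≤ isolationIndex A Bᶜ := by
  rcases (isolationIndex_nonneg A B).eq_or_lt with h | h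
  · rw [← h]
    exact isolationIndex_nonneg _ _
  · obtain ⟨k, i, l, j, hk, hi, hl, hj⟩ := exists_of_isolationIndex_pos h
    refine le_isolationIndex (k := l) (i := j) (l := k) (j := i) hl hj (not_not.2 hk)
      (not_not.2 hi) fun k i l j hk hi hl hj => ?_
    have := isolationIndex_le h (not_not.1 hl) (not_not.1 hj) hk hi
    unfold quadMinor at this ⊢
    linarith

theorem isolationIndex_compl (A : Matrix (Fin n) (Fin n) ℝ) (B : Set (Fin n ⊕ Fin n)) :
    isolationIndex A Bᶜ = isolationIndex A B :=
  le_antisymm (by simpa using isolationIndex_le_compl A Bᶜ) (isolationIndex_le_compl A B)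

theorem isolationIndex_le_swap (hA : A.IsSymm) (B : Set (Fin n ⊕ Fin n)) :
    isolationIndex A B ≤ isolationIndex A (Sum.swap ⁻¹' B) := by
  rcases (isolationIndex_nonneg A B).eq_or_lt with h | h
  · rw [← h]
    exact isolationIndex_nonneg _ _
  · obtain ⟨k, i, l, j, hk, hi, hl, hj⟩ := exists_of_isolationIndex_pos h
    refine le_isolationIndex (k := i) (i := k) (l := j) (j := l) hi hk hj hl
      fun k i l j hk hi hl hj => ?_
    rw [← quadMinor_swap hA]
    exact isolationIndex_le h hi hk hj hl

theorem isolationIndex_swap (hA : A.IsSymm) (B : Set (Fin n ⊕ Fin n)) :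
    isolationIndex A (Sum.swap ⁻¹' B) = isolationIndex A B :=
  le_antisymm (by simpa [swap_preimage_swap_preimage] using
    isolationIndex_le_swap hA (Sum.swap ⁻¹' B)) (isolationIndex_le_swap hA B)

theorem quadMinor_pos (hB : 0 < isolationIndex A B) {k i l j : Fin n} (hk : Sum.inl k ∈ B)
    (hi : Sum.inr i ∈ B) (hl : Sum.inl l ∉ B) (hj : Sum.inr j ∉ B) : 0 < quadMinor A k i l j :=
  hB.trans_le (isolationIndex_le hB hk hi hl hj)

/-- The minors `k i | l j` and `k j | l i` are negatives of each other. -/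
theorem false_of_alternating {P Q : Set (Fin n ⊕ Fin n)} (hP : 0 < isolationIndex A P)
    (hQ : 0 < isolationIndex A Q) {k i l j : Fin n} (hkP : Sum.inl k ∈ P) (hkQ : Sum.inl k ∈ Q)
    (hiP : Sum.inr i ∈ P) (hiQ : Sum.inr i ∉ Q) (hjP : Sum.inr j ∉ P) (hjQ : Sum.inr j ∈ Q)
    (hlP : Sum.inl l ∉ P) (hlQ : Sum.inl l ∉ Q) : False := by
  have h1 := quadMinor_pos hP hkP hiP hlP hjP
  have h2 := quadMinor_pos hQ hkQ hjQ hlQ hiQ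
  unfold quadMinor at h1 h2
  linarith

/-- In the minor with rows `k, l, m` and columns `i, h, j`, the matching `k i, l h, m j` would be
the only minimizer. -/
theorem false_of_opposite (hA : A ∈ symmTropRank n 2) {P Q : Set (Fin n ⊕ Fin n)}
    (hP : 0 < isolationIndex A P) (hQ : 0 < isolationIndex A Q) {k i l j m h : Fin n}
    (hkP : Sum.inl k ∈ P) (hkQ : Sum.inl k ∈ Q) (hiP : Sum.inr i ∉ P) (hiQ : Sum.inr i ∉ Q)
    (hlP : Sum.inl l ∈ P) (hlQ : Sum.inl l ∉ Q) (hjP : Sum.inr j ∈ P) (hjQ : Sum.inr j ∉ Q)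
    (hmP : Sum.inl m ∉ P) (hmQ : Sum.inl m ∈ Q) (hhP : Sum.inr h ∉ P) (hhQ : Sum.inr h ∈ Q) :
    False := by
  have h1 := quadMinor_pos hP hlP hjP hmP hhP
  have h2 := quadMinor_pos hQ hkQ hhQ hlQ hiQ
  have h3 := quadMinor_pos hP hkP hjP hmP hhP
  have h4 := quadMinor_pos hP hlP hjP hmP hiP
  have h5 := quadMinor_pos hP hkP hjP hmP hiP
  unfold quadMinor at h1 h2 h3 h4 h5
  refine not_unique_min hA (k := k) (l := l) (m := m) (i := i) (j := h) (h := j) ?_ ?_ ?_ ?_ ?_ ?_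
    ⟨?_, ?_, ?_, ?_, ?_⟩
  any_goals linarith
  all_goals
    rintro rfl
    contradiction

/-- For sides `B`, `C`, the indices 1 to 4 stand for the corners `B ∩ C`, `B \ C`, `C \ B` and the
outside; `u` and `p` record an unprimed or primed leaf there. The `c` say that no corner is empty,
the `d` that all four sides have both colors. -/
theorem color_pattern {u₁ u₂ u₃ u₄ p₁ p₂ p₃ p₄ : Prop}
    (a1 : u₁ → p₂ → p₃ → u₄ → False) (a2 : p₁ → u₂ → u₃ → p₄ → False)
    (o1 : u₁ → p₄ → u₂ → p₂ → u₃ → p₃ → False) (o2 : p₁ → u₄ → u₂ → p₂ → u₃ → p₃ → False)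
    (o3 : u₂ → p₃ → u₁ → p₁ → u₄ → p₄ → False) (o4 : p₂ → u₃ → u₁ → p₁ → u₄ → p₄ → False)
    (c1 : u₁ ∨ p₁) (c2 : u₂ ∨ p₂) (c3 : u₃ ∨ p₃) (c4 : u₄ ∨ p₄)
    (d1 : u₁ ∨ u₂) (d2 : p₁ ∨ p₂) (d3 : u₃ ∨ u₄) (d4 : p₃ ∨ p₄)
    (d5 : u₁ ∨ u₃) (d6 : p₁ ∨ p₃) (d7 : u₂ ∨ u₄) (d8 : p₂ ∨ p₄) : False := by
  grind

/-- The splits with positive isolation index form a symbic split system. -/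
theorem isSymbicSplitSystem_isolationIndex (hA : A ∈ symmTropRank n 2) :
    IsSymbicSplitSystem {B | 0 < isolationIndex A B} where
  compl_mem B hB := by
    rw [Set.mem_ofPred_eq, isolationIndex_compl]
    exact hB
  exists_inl B hB := by
    obtain ⟨k, i, l, j, hk, -⟩ := exists_of_isolationIndex_pos hB
    exact ⟨k, hk⟩
  exists_inr B hB := by
    obtain ⟨k, i, l, j, -, hi, -⟩ := exists_of_isolationIndex_pos hB
    exact ⟨i, hi⟩
  swap_mem B hB := by
    rw [Set.mem_ofPred_eq, isolationIndex_swap hA.1]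
    exact hB
  not_three_fixed B hB C hC D hD hBC hBD hCD fB fC fD := by
    have mem : ∀ {B : Set (Fin n ⊕ Fin n)}, 0 < isolationIndex A B → Sum.swap ⁻¹' B = B →
        ∃ i, Sum.inl i ∈ B ∧ Sum.inr i ∈ B := by
      intro B hB fB
      obtain ⟨k, i, l, j, hk, -⟩ := exists_of_isolationIndex_pos hB
      refine ⟨k, hk, ?_⟩
      rw [← fB]
      exact hk
    obtain ⟨i, hi, hi'⟩ := mem hB fB
    obtain ⟨j, hj, hj'⟩ := mem hC fC
    obtain ⟨k, hk, hk'⟩ := mem hD fD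
    rw [Set.disjoint_left] at hBC hBD hCD
    have hs := hA.1
    have s1 := hs.apply i j
    have s2 := hs.apply i k
    have s3 := hs.apply j k
    have h1 := quadMinor_pos hB hi hi' (fun h => hBC h hj) (fun h => hBD h hk')
    have h2 := quadMinor_pos hC hj hj' (fun h => hBC hi h) (fun h => hCD h hk')
    have h3 := quadMinor_pos hD hk hk' (fun h => hBD hi h) (fun h => hCD hj' h)
    have h4 := quadMinor_pos hC hj hj' (fun h => hCD h hk) (fun h => hCD h hk')
    unfold quadMinor at h1 h2 h3 h4
    -- `h1`, `h2`, `h3` compare with the monomials of the transpositions; `h1` and `h4` together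
    -- deal with the diagonal.
    refine not_unique_min_principal hA (i := i) (j := j) (k := k) ?_ ?_ ?_ ⟨?_, ?_, ?_, ?_⟩
    any_goals linarith
    · rintro rfl
      exact hBC hi hj
    · rintro rfl
      exact hBD hi hk
    · rintro rfl
      exact hCD hj hk
  compatible B hB C hC := by
    have hB' : 0 < isolationIndex A Bᶜ := by rwa [isolationIndex_compl]
    have hC' : 0 < isolationIndex A Cᶜ := by rwa [isolationIndex_compl]
    obtain ⟨b1, b2, b3, b4, hb1, hb2, hb3, hb4⟩ := exists_of_isolationIndex_pos hB
    obtain ⟨c1', c2', c3', c4', hc1, hc2, hc3, hc4⟩ := exists_of_isolationIndex_pos hC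
    by_contra! hne
    obtain ⟨n1, n2, n3, n4⟩ := hne
    obtain ⟨x1, y1, z1⟩ := Set.not_disjoint_iff.1 n1
    obtain ⟨x2, y2, z2⟩ := Set.not_subset.1 n2
    obtain ⟨x3, y3, z3⟩ := Set.not_subset.1 n3
    obtain ⟨x4, y4, z4⟩ := Set.not_subset.1 n4
    have color : ∀ {p : Fin n ⊕ Fin n → Prop} (x), p x →
        (∃ i, p (Sum.inl i)) ∨ ∃ i, p (Sum.inr i) := by
      rintro p (i | i) h
      · exact Or.inl ⟨i, h⟩
      · exact Or.inr ⟨i, h⟩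
    have a1 : (∃ i, Sum.inl i ∈ B ∧ Sum.inl i ∈ C) → (∃ i, Sum.inr i ∈ B ∧ Sum.inr i ∉ C) →
        (∃ i, Sum.inr i ∉ B ∧ Sum.inr i ∈ C) → (∃ i, Sum.inl i ∉ B ∧ Sum.inl i ∉ C) → False :=
      fun ⟨_, p1, p2⟩ ⟨_, p3, p4⟩ ⟨_, p5, p6⟩ ⟨_, p7, p8⟩ =>
        false_of_alternating hB hC p1 p2 p3 p4 p5 p6 p7 p8
    have a2 : (∃ i, Sum.inr i ∈ B ∧ Sum.inr i ∈ C) → (∃ i, Sum.inl i ∈ B ∧ Sum.inl i ∉ C) →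
        (∃ i, Sum.inl i ∉ B ∧ Sum.inl i ∈ C) → (∃ i, Sum.inr i ∉ B ∧ Sum.inr i ∉ C) → False :=
      fun ⟨_, p1, p2⟩ ⟨_, p3, p4⟩ ⟨_, p5, p6⟩ ⟨_, p7, p8⟩ =>
        false_of_alternating hB hC' p3 p4 p1 (not_not.2 p2) p7 p8 p5 (not_not.2 p6)
    have o1 : (∃ i, Sum.inl i ∈ B ∧ Sum.inl i ∈ C) → (∃ i, Sum.inr i ∉ B ∧ Sum.inr i ∉ C) →
        (∃ i, Sum.inl i ∈ B ∧ Sum.inl i ∉ C) → (∃ i, Sum.inr i ∈ B ∧ Sum.inr i ∉ C) →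
        (∃ i, Sum.inl i ∉ B ∧ Sum.inl i ∈ C) → (∃ i, Sum.inr i ∉ B ∧ Sum.inr i ∈ C) → False :=
      fun ⟨_, p1, p2⟩ ⟨_, p3, p4⟩ ⟨_, p5, p6⟩ ⟨_, p7, p8⟩ ⟨_, p9, p10⟩ ⟨_, p11, p12⟩ =>
        false_of_opposite hA hB hC p1 p2 p3 p4 p5 p6 p7 p8 p9 p10 p11 p12
    have o2 : (∃ i, Sum.inr i ∈ B ∧ Sum.inr i ∈ C) → (∃ i, Sum.inl i ∉ B ∧ Sum.inl i ∉ C) →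
        (∃ i, Sum.inl i ∈ B ∧ Sum.inl i ∉ C) → (∃ i, Sum.inr i ∈ B ∧ Sum.inr i ∉ C) →
        (∃ i, Sum.inl i ∉ B ∧ Sum.inl i ∈ C) → (∃ i, Sum.inr i ∉ B ∧ Sum.inr i ∈ C) → False :=
      fun ⟨_, p1, p2⟩ ⟨_, p3, p4⟩ ⟨_, p5, p6⟩ ⟨_, p7, p8⟩ ⟨_, p9, p10⟩ ⟨_, p11, p12⟩ =>
        false_of_opposite hA hB' hC' p3 p4 (not_not.2 p1) (not_not.2 p2) p9 (not_not.2 p10) p11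
          (not_not.2 p12) (not_not.2 p5) p6 (not_not.2 p7) p8
    have o3 : (∃ i, Sum.inl i ∈ B ∧ Sum.inl i ∉ C) → (∃ i, Sum.inr i ∉ B ∧ Sum.inr i ∈ C) →
        (∃ i, Sum.inl i ∈ B ∧ Sum.inl i ∈ C) → (∃ i, Sum.inr i ∈ B ∧ Sum.inr i ∈ C) →
        (∃ i, Sum.inl i ∉ B ∧ Sum.inl i ∉ C) → (∃ i, Sum.inr i ∉ B ∧ Sum.inr i ∉ C) → False :=
      fun ⟨_, p1, p2⟩ ⟨_, p3, p4⟩ ⟨_, p5, p6⟩ ⟨_, p7, p8⟩ ⟨_, p9, p10⟩ ⟨_, p11, p12⟩ =>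
        false_of_opposite hA hB hC' p1 p2 p3 (not_not.2 p4) p5 (not_not.2 p6) p7 (not_not.2 p8) p9
          p10 p11 p12
    have o4 : (∃ i, Sum.inr i ∈ B ∧ Sum.inr i ∉ C) → (∃ i, Sum.inl i ∉ B ∧ Sum.inl i ∈ C) →
        (∃ i, Sum.inl i ∈ B ∧ Sum.inl i ∈ C) → (∃ i, Sum.inr i ∈ B ∧ Sum.inr i ∈ C) →
        (∃ i, Sum.inl i ∉ B ∧ Sum.inl i ∉ C) → (∃ i, Sum.inr i ∉ B ∧ Sum.inr i ∉ C) → False :=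
      fun ⟨_, p1, p2⟩ ⟨_, p3, p4⟩ ⟨_, p5, p6⟩ ⟨_, p7, p8⟩ ⟨_, p9, p10⟩ ⟨_, p11, p12⟩ =>
        false_of_opposite hA hB' hC p3 p4 (not_not.2 p1) p2 p9 p10 p11 p12 (not_not.2 p5) p6
          (not_not.2 p7) p8
    have c1 := color (p := fun x => x ∈ B ∧ x ∈ C) x1 ⟨y1, z1⟩
    have c2 := color (p := fun x => x ∈ B ∧ x ∉ C) x2 ⟨y2, z2⟩
    have c3 := color (p := fun x => x ∉ B ∧ x ∈ C) x3 ⟨z3, y3⟩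
    have c4 := color (p := fun x => x ∉ B ∧ x ∉ C) x4 ⟨y4, z4⟩
    have d1 : (∃ i, Sum.inl i ∈ B ∧ Sum.inl i ∈ C) ∨ (∃ i, Sum.inl i ∈ B ∧ Sum.inl i ∉ C) :=
      (em (Sum.inl b1 ∈ C)).imp (fun h => ⟨b1, hb1, h⟩) (fun h => ⟨b1, hb1, h⟩)
    have d2 : (∃ i, Sum.inr i ∈ B ∧ Sum.inr i ∈ C) ∨ (∃ i, Sum.inr i ∈ B ∧ Sum.inr i ∉ C) :=
      (em (Sum.inr b2 ∈ C)).imp (fun h => ⟨b2, hb2, h⟩) (fun h => ⟨b2, hb2, h⟩)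
    have d3 : (∃ i, Sum.inl i ∉ B ∧ Sum.inl i ∈ C) ∨ (∃ i, Sum.inl i ∉ B ∧ Sum.inl i ∉ C) :=
      (em (Sum.inl b3 ∈ C)).imp (fun h => ⟨b3, hb3, h⟩) (fun h => ⟨b3, hb3, h⟩)
    have d4 : (∃ i, Sum.inr i ∉ B ∧ Sum.inr i ∈ C) ∨ (∃ i, Sum.inr i ∉ B ∧ Sum.inr i ∉ C) :=
      (em (Sum.inr b4 ∈ C)).imp (fun h => ⟨b4, hb4, h⟩) (fun h => ⟨b4, hb4, h⟩)
    have d5 : (∃ i, Sum.inl i ∈ B ∧ Sum.inl i ∈ C) ∨ (∃ i, Sum.inl i ∉ B ∧ Sum.inl i ∈ C) :=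
      (em (Sum.inl c1' ∈ B)).imp (fun h => ⟨c1', h, hc1⟩) (fun h => ⟨c1', h, hc1⟩)
    have d6 : (∃ i, Sum.inr i ∈ B ∧ Sum.inr i ∈ C) ∨ (∃ i, Sum.inr i ∉ B ∧ Sum.inr i ∈ C) :=
      (em (Sum.inr c2' ∈ B)).imp (fun h => ⟨c2', h, hc2⟩) (fun h => ⟨c2', h, hc2⟩)
    have d7 : (∃ i, Sum.inl i ∈ B ∧ Sum.inl i ∉ C) ∨ (∃ i, Sum.inl i ∉ B ∧ Sum.inl i ∉ C) :=
      (em (Sum.inl c3' ∈ B)).imp (fun h => ⟨c3', h, hc3⟩) (fun h => ⟨c3', h, hc3⟩)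
    have d8 : (∃ i, Sum.inr i ∈ B ∧ Sum.inr i ∉ C) ∨ (∃ i, Sum.inr i ∉ B ∧ Sum.inr i ∉ C) :=
      (em (Sum.inr c4' ∈ B)).imp (fun h => ⟨c4', h, hc4⟩) (fun h => ⟨c4', h, hc4⟩)
    exact color_pattern a1 a2 o1 o2 o3 o4 c1 c2 c3 c4 d1 d2 d3 d4 d5 d6 d7 d8

/-! ### Recovering the minors from the isolation indices -/

variable {A : Matrix (Fin n) (Fin n) ℝ} {k i l j x h y g : Fin n} {c c₁ c₂ : ℝ}

/-- For fixed `l, j` the minors act as a two-colored Gromov product: being at least `c` passes along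
the chain `x, i, k, h`. Otherwise `x h, l i, k j` would be the only minimizing matching of its
minor. -/
theorem le_quadMinor_of_le (hA : A ∈ symmTropRank n 2) (hc : 0 < c) (h1 : c ≤ quadMinor A k i l j)
    (h2 : c ≤ quadMinor A x i l j) (h3 : c ≤ quadMinor A k h l j) : c ≤ quadMinor A x h l j := by
  by_contra! h4
  unfold quadMinor at *
  refine not_unique_min hA (k := x) (l := l) (m := k) (i := h) (j := i) (h := j) ?_ ?_ ?_ ?_ ?_ ?_
    ⟨?_, ?_, ?_, ?_, ?_⟩
  any_goals linarith
  all_goals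
    rintro rfl
    linarith

theorem quadMinor_le_of_le (hA : A ∈ symmTropRank n 2) (hc : 0 ≤ c) (h1 : c < quadMinor A k i l j)
    (h2 : quadMinor A y i l j ≤ c) (h3 : c < quadMinor A k h l j) : quadMinor A y h l j ≤ c := by
  by_contra! h4
  unfold quadMinor at *
  refine not_unique_min hA (k := y) (l := k) (m := l) (i := i) (j := j) (h := h) ?_ ?_ ?_ ?_ ?_ ?_
    ⟨?_, ?_, ?_, ?_, ?_⟩
  any_goals linarith
  all_goals
    rintro rfl
    linarith

/-- Only the term `A y g` is uncontrolled. If it were too small, `y g, x j, l h` would be the only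
minimizing matching of its minor. -/
theorem sub_le_quadMinor (hA : A ∈ symmTropRank n 2) (hc : 0 ≤ c₁) (hcc : c₁ < c₂)
    (h1 : c₂ ≤ quadMinor A x h l j) (h2 : quadMinor A y h l j ≤ c₁)
    (h3 : quadMinor A x g l j ≤ c₁) : c₂ - c₁ ≤ quadMinor A x h y g := by
  by_contra! h4
  unfold quadMinor at *
  refine not_unique_min hA (k := y) (l := x) (m := l) (i := g) (j := j) (h := h) ?_ ?_ ?_ ?_ ?_ ?_
    ⟨?_, ?_, ?_, ?_, ?_⟩
  any_goals linarith
  all_goals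
    rintro rfl
    linarith

/-- Take a counterexample with the least positive minor. Either a row or column cuts it into two
smaller positive minors, for which the claim holds, or there is no intermediate value, and then
exactly one split of positive index separates the quadruple. -/
theorem quadMinor_eq_sepWeight_of_pos (hA : A ∈ symmTropRank n 2) (hpos : 0 < quadMinor A k i l j) :
    quadMinor A k i l j =
      sepWeight (isolationIndex A) (Sum.inl k) (Sum.inr i) (Sum.inl l) (Sum.inr j) := by
  by_contra hne
  have hs := hA.1
  obtain ⟨⟨k, i, l, j⟩, ⟨hpos, hne⟩, hmin⟩ := Set.exists_min_image
    {q : Fin n × Fin n × Fin n × Fin n | 0 < quadMinor A q.1 q.2.1 q.2.2.1 q.2.2.2 ∧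
      quadMinor A q.1 q.2.1 q.2.2.1 q.2.2.2 ≠ sepWeight (isolationIndex A) (Sum.inl q.1)
        (Sum.inr q.2.1) (Sum.inl q.2.2.1) (Sum.inr q.2.2.2)}
    (fun q => quadMinor A q.1 q.2.1 q.2.2.1 q.2.2.2) (Set.toFinite _) ⟨(k, i, l, j), hpos, hne⟩
  simp only at hpos hne hmin
  have small : ∀ a b c d, 0 < quadMinor A a b c d → quadMinor A a b c d < quadMinor A k i l j →
      quadMinor A a b c d =
        sepWeight (isolationIndex A) (Sum.inl a) (Sum.inr b) (Sum.inl c) (Sum.inr d) := by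
    intro a b c d h1 h2
    by_contra h3
    exact absurd (hmin (a, b, c, d) ⟨h1, h3⟩) (not_le.2 h2)
  have pos : ∀ {C : Set (Fin n ⊕ Fin n)}, isolationIndex A C ≠ 0 → 0 < isolationIndex A C :=
    fun h => lt_of_le_of_ne (isolationIndex_nonneg _ _) (Ne.symm h)
  -- Both sides are additive: a split of positive index that separates `k i | l j` separates exactly
  -- one of `x i | l j` and `k i | x j`. `n1` and `n2` exclude the splits that would spoil the
  -- count.
  by_cases hx : ∃ x, 0 < quadMinor A x i l j ∧ quadMinor A x i l j < quadMinor A k i l j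
  · obtain ⟨x, hx0, hxw⟩ := hx
    have e : quadMinor A k i x j = quadMinor A k i l j - quadMinor A x i l j := by
      unfold quadMinor
      ring
    have h1 := small x i l j hx0 hxw
    have h2 := small k i x j (by linarith) (by linarith)
    refine hne ?_
    rw [sub_eq_iff_eq_add.1 e.symm, h1, h2]
    unfold sepWeight
    rw [← Finset.sum_add_distrib]
    refine Finset.sum_congr rfl fun C _ => ?_
    by_cases h0 : isolationIndex A C = 0
    · simp [h0]
    have n1 : Sum.inl l ∈ C → Sum.inr i ∈ C → Sum.inl x ∉ C → Sum.inr j ∉ C → False := by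
      intro q1 q2 q3 q4
      have := quadMinor_pos (pos h0) q1 q2 q3 q4
      unfold quadMinor at *
      linarith
    have n2 : Sum.inl x ∈ C → Sum.inr i ∈ C → Sum.inl k ∉ C → Sum.inr j ∉ C → False := by
      intro q1 q2 q3 q4
      have := quadMinor_pos (pos h0) q1 q2 q3 q4
      unfold quadMinor at *
      linarith
    by_cases m1 : Sum.inl k ∈ C <;> by_cases m2 : Sum.inr i ∈ C <;> by_cases m3 : Sum.inl l ∈ C <;>
      by_cases m4 : Sum.inr j ∈ C <;> by_cases m5 : Sum.inl x ∈ C <;>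
      simp [m1, m2, m3, m4, m5] at n1 n2 ⊢
  by_cases hh : ∃ h, 0 < quadMinor A k h l j ∧ quadMinor A k h l j < quadMinor A k i l j
  · obtain ⟨h, hx0, hxw⟩ := hh
    have e : quadMinor A k i l h = quadMinor A k i l j - quadMinor A k h l j := by
      unfold quadMinor
      ring
    have h1 := small k h l j hx0 hxw
    have h2 := small k i l h (by linarith) (by linarith)
    refine hne ?_
    rw [sub_eq_iff_eq_add.1 e.symm, h1, h2]
    unfold sepWeight
    rw [← Finset.sum_add_distrib]
    refine Finset.sum_congr rfl fun C _ => ?_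
    by_cases h0 : isolationIndex A C = 0
    · simp [h0]
    have n1 : Sum.inl k ∈ C → Sum.inr j ∈ C → Sum.inl l ∉ C → Sum.inr h ∉ C → False := by
      intro q1 q2 q3 q4
      have := quadMinor_pos (pos h0) q1 q2 q3 q4
      unfold quadMinor at *
      linarith
    have n2 : Sum.inl k ∈ C → Sum.inr h ∈ C → Sum.inl l ∉ C → Sum.inr i ∉ C → False := by
      intro q1 q2 q3 q4
      have := quadMinor_pos (pos h0) q1 q2 q3 q4
      unfold quadMinor at *
      linarith
    by_cases m1 : Sum.inl k ∈ C <;> by_cases m2 : Sum.inr i ∈ C <;> by_cases m3 : Sum.inl l ∈ C <;>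
      by_cases m4 : Sum.inr j ∈ C <;> by_cases m5 : Sum.inr h ∈ C <;>
      simp [m1, m2, m3, m4, m5] at n1 n2 ⊢
  -- Now `quadMinor A x i l j` and `quadMinor A k h l j` are always at most `0` or at least `w`, so
  -- their signs define a candidate side `B`.
  push Not at hx hh
  set w := quadMinor A k i l j with hw
  let B : Set (Fin n ⊕ Fin n) :=
    {x | Sum.elim (fun x => 0 < quadMinor A x i l j) (fun h => 0 < quadMinor A k h l j) x}
  have hkB : Sum.inl k ∈ B := hpos
  have hiB : Sum.inr i ∈ B := hpos
  have hlB : Sum.inl l ∉ B := fun h => by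
    have : 0 < quadMinor A l i l j := h
    unfold quadMinor at this
    linarith
  have hjB : Sum.inr j ∉ B := fun h => by
    have : 0 < quadMinor A k j l j := h
    unfold quadMinor at this
    linarith
  have hB : w ≤ isolationIndex A B := by
    refine le_isolationIndex hkB hiB hlB hjB fun x h y g hxB hhB hyB hgB => ?_
    have h1 : w ≤ quadMinor A x i l j := hx x hxB
    have h2 : w ≤ quadMinor A k h l j := hh h hhB
    have h3 : quadMinor A y i l j ≤ 0 := not_lt.1 hyB
    have h4 : quadMinor A k g l j ≤ 0 := not_lt.1 hgB
    have h5 := quadMinor_le_of_le hA le_rfl hpos h3 (hpos.trans_le h2)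
    have h6 : quadMinor A g x j l ≤ 0 := by
      refine quadMinor_le_of_le hA le_rfl (k := i) (i := k) ?_ ?_ ?_ <;> rw [quadMinor_swap hs]
      · exact hpos
      · exact h4
      · exact hpos.trans_le h1
    rw [quadMinor_swap hs] at h6
    simpa using sub_le_quadMinor hA le_rfl hpos (le_quadMinor_of_le hA hpos le_rfl h1 h2) h5 h6
  have hBpos := hpos.trans_le hB
  refine hne ?_
  rw [sepWeight_eq_of_unique hkB hiB hlB hjB]
  · exact le_antisymm hB (isolationIndex_le hBpos hkB hiB hlB hjB)
  -- A leaf in `B` but not in `C` would make a minor across `C` equal to `w` minus something at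
  -- least `w`.
  · intro C hC hkC hiC hlC hjC
    ext (x | h)
    · constructor
      · intro hxC
        exact quadMinor_pos (pos hC) hxC hiC hlC hjC
      · intro hxB
        by_contra hxC
        have h1 : w ≤ quadMinor A x i l j := hx x hxB
        have h2 := quadMinor_pos (pos hC) hkC hiC hxC hjC
        unfold quadMinor at *
        linarith
    · constructor
      · intro hxC
        exact quadMinor_pos (pos hC) hkC hxC hlC hjC
      · intro hxB
        by_contra hxC
        have h1 : w ≤ quadMinor A k h l j := hh h hxB
        have h2 := quadMinor_pos (pos hC) hkC hiC hlC hxC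
        unfold quadMinor at *
        linarith

theorem sepWeight_eq_zero_of_quadMinor_nonpos (h : quadMinor A k i l j ≤ 0) :
    sepWeight (isolationIndex A) (Sum.inl k) (Sum.inr i) (Sum.inl l) (Sum.inr j) = 0 :=
  sepWeight_eq_zero fun _ hC h1 h2 h3 h4 => absurd
    (quadMinor_pos (lt_of_le_of_ne (isolationIndex_nonneg _ _) (Ne.symm hC)) h1 h2 h3 h4)
    (not_lt.2 h)

theorem quadMinor_eq_sepWeight_sub (hA : A ∈ symmTropRank n 2) (k i l j : Fin n) :
    quadMinor A k i l j =
      sepWeight (isolationIndex A) (Sum.inl k) (Sum.inr i) (Sum.inl l) (Sum.inr j) -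
      sepWeight (isolationIndex A) (Sum.inl k) (Sum.inr j) (Sum.inl l) (Sum.inr i) := by
  have hneg : quadMinor A k j l i = - quadMinor A k i l j := by
    unfold quadMinor
    ring
  rcases lt_or_ge 0 (quadMinor A k i l j) with h | h
  · rw [sepWeight_eq_zero_of_quadMinor_nonpos (i := j) (by linarith), sub_zero,
      quadMinor_eq_sepWeight_of_pos hA h]
  · rw [sepWeight_eq_zero_of_quadMinor_nonpos h]
    rcases h.eq_or_lt with h | h
    · rw [sepWeight_eq_zero_of_quadMinor_nonpos (by linarith), h, sub_zero]
    · rw [← quadMinor_eq_sepWeight_of_pos hA (by linarith), hneg]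
      ring

theorem isWeight_isolationIndex (hA : A.IsSymm) :
    IsWeight {B | 0 < isolationIndex A B} (isolationIndex A) where
  nonneg := isolationIndex_nonneg A
  mem_of_ne_zero _ h := lt_of_le_of_ne (isolationIndex_nonneg _ _) (Ne.symm h)
  compl := isolationIndex_compl A
  swap := isolationIndex_swap hA

/-- Each matrix of symmetric tropical rank two comes from a weighted split system. -/
theorem hasSplitForm_isolationIndex (hA : A ∈ symmTropRank n 2) :
    HasSplitForm A (isolationIndex A) := by
  have hw := isWeight_isolationIndex hA.1
  -- The diagonal entry `A i i = 2 x i - d(i, i')/2` forces this scaling vector; the minor `i i | j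
  -- j` and symmetry then give the other entries.
  refine ⟨fun i => (A i i + splitDist (isolationIndex A) (Sum.inl i) (Sum.inr i) / 2) / 2,
    fun i j => ?_⟩
  have h1 := quadMinor_eq_sepWeight_sub hA i i j j
  have h2 := splitDist_four_point hw.compl (Sum.inl i) (Sum.inr i) (Sum.inl j) (Sum.inr j)
  have h3 := splitDist_swap hw.swap (Sum.inl i) (Sum.inr j)
  simp only [Sum.swap_inl, Sum.swap_inr] at h3
  have h4 := splitDist_comm hw.compl (Sum.inr i) (Sum.inl j)
  have h5 := hA.1.apply i j
  unfold quadMinor at h1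
  linarith

end MatrixSplits

/-! ### The metric tree of a split matrix -/

section HilbertDistance

variable {n : ℕ}

theorem hilbertDist_congr {p p' q q' : Fin n → ℝ} (hp : ∀ i j, p i - p j = p' i - p' j)
    (hq : ∀ i j, q i - q j = q' i - q' j) : hilbertDist p q = hilbertDist p' q' := by
  rcases isEmpty_or_nonempty (Fin n) with h | ⟨⟨i₀⟩⟩
  · rw [Subsingleton.elim p p', Subsingleton.elim q q']
  have : Nonempty (Fin n) := ⟨i₀⟩
  have h : ∀ i, p i - q i = (p' i - q' i) + ((p i₀ - q i₀) - (p' i₀ - q' i₀)) := fun i => by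
    linarith [hp i i₀, hq i i₀]
  unfold hilbertDist
  rw [iSup_congr h, iInf_congr h, ← ciSup_add (Set.finite_range _).bddAbove,
    ← ciInf_add (Set.finite_range _).bddBelow]
  ring

theorem IsRayFoot.sub_eq {A : Matrix (Fin n) (Fin n) ℝ} {j : Fin n} {p q : Fin n → ℝ}
    (hp : IsRayFoot A j p) (hq : IsRayFoot A j q) (i k : Fin n) : p i - p k = q i - q k := by
  have h : ∀ i, p i - p j = q i - q j := fun i =>
    le_antisymm (hp.2 q hq.1 i) (hq.2 p hp.1 i)
  linarith [h i, h k]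

/-- The distances in the metric tree are determined by the matrix. -/
theorem HasTree.dist_eq {A : Matrix (Fin n) (Fin n) ℝ} {T T' : SymbicTree n}
    {ℓ : T.EdgeOrbit → ℝ} {ℓ' : T'.EdgeOrbit → ℝ} (h : HasTree A T ℓ) (h' : HasTree A T' ℓ')
    (x y : Fin n ⊕ Fin n) : T.dist ℓ x y = T'.dist ℓ' x y := by
  obtain ⟨p, hp1, hp2, hp3⟩ := h
  obtain ⟨q, hq1, hq2, hq3⟩ := h'
  have key : ∀ z i j, p z i - p z j = q z i - q z j := by
    rintro (k | k) i j
    · simp only [hp1, hq1]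
    · exact (hp2 k).sub_eq (hq2 k) i j
  rw [← hp3, ← hq3]
  exact hilbertDist_congr (key x) (key y)

variable {S : Set (Set (Fin n ⊕ Fin n))} (hS : IsSymbicSplitSystem S)
  {w : Set (Fin n ⊕ Fin n) → ℝ} (hw : IsWeight S w)

include hS hw

theorem IsSymbicSplitSystem.splitDist_add_of_subset {x y z : Fin n ⊕ Fin n}
    (h : ∀ B ∈ S, y ∈ B → x ∉ B → z ∈ B) :
    splitDist w x z = splitDist w x y + splitDist w y z := by
  refine splitDist_add_of_forall fun B hB hxz => ?_
  have h1 := h B (hw.mem_of_ne_zero B hB)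
  have h2 := h Bᶜ (hS.compl_mem B (hw.mem_of_ne_zero B hB))
  simp only [Set.mem_compl_iff] at h2
  tauto

/-- The path from `x` to `y` extends to a primed leaf: a minimal side with `y` and without `x`
contains one, and all other such sides contain that minimal side. -/
theorem IsSymbicSplitSystem.exists_inr_splitDist_add (x y : Fin n ⊕ Fin n) :
    ∃ i, splitDist w x (Sum.inr i) = splitDist w x y + splitDist w y (Sum.inr i) := by
  by_cases h : ∃ B ∈ S, y ∈ B ∧ x ∉ B
  · obtain ⟨B₀, h₀⟩ := h
    obtain ⟨B, ⟨hB, hyB, hxB⟩, hmin⟩ :=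
      (Set.toFinite {B | B ∈ S ∧ y ∈ B ∧ x ∉ B}).exists_minimal ⟨B₀, h₀⟩
    obtain ⟨i, hi⟩ := hS.exists_inr B hB
    refine ⟨i, hS.splitDist_add_of_subset hw fun C hC hyC hxC => ?_⟩
    rcases hS.subset_or_subset hB hC hyB hyC hxB hxC with h | h
    · exact h hi
    · exact hmin ⟨hC, hyC, hxC⟩ h hi
  -- Nothing separates `x` from `y`, so any label serves; that of `x` is at hand.
  · exact ⟨Sum.elim id id x, hS.splitDist_add_of_subset hw fun B hB h1 h2 =>
      absurd ⟨B, hB, h1, h2⟩ h⟩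

theorem IsSymbicSplitSystem.exists_inl_splitDist_add (x y : Fin n ⊕ Fin n) :
    ∃ i, splitDist w x (Sum.inl i) = splitDist w x y + splitDist w y (Sum.inl i) := by
  obtain ⟨i, hi⟩ := hS.exists_inr_splitDist_add hw x.swap y.swap
  refine ⟨i, ?_⟩
  have h1 := splitDist_swap hw.swap x (Sum.inl i)
  have h2 := splitDist_swap hw.swap y (Sum.inl i)
  rw [splitDist_swap hw.swap] at hi
  rw [← h1, ← h2]
  exact hi

/-- The triangle inequality bounds all coordinate differences; the bounds are attained at primed
leaves beyond `x` and beyond `y`. -/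
theorem IsSymbicSplitSystem.hilbertDist_eq {a : Fin n → ℝ} {p q : Fin n → ℝ} {c d : ℝ}
    {x y : Fin n ⊕ Fin n} (hp : ∀ i, p i = a i + c - splitDist w x (Sum.inr i) / 2)
    (hq : ∀ i, q i = a i + d - splitDist w y (Sum.inr i) / 2) :
    hilbertDist p q = splitDist w x y := by
  obtain ⟨i, hi⟩ := hS.exists_inr_splitDist_add hw x y
  obtain ⟨j, hj⟩ := hS.exists_inr_splitDist_add hw y x
  have : Nonempty (Fin n) := ⟨i⟩
  have hcomm := splitDist_comm hw.compl x y
  have h1 : (⨆ i, (p i - q i)) = c - d + splitDist w x y / 2 := by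
    refine le_antisymm (ciSup_le fun k => ?_) ?_
    · have := splitDist_triangle hw.nonneg y x (Sum.inr k)
      rw [hp, hq]
      linarith
    · refine le_trans ?_ (le_ciSup (Set.finite_range _).bddAbove j)
      rw [hp, hq]
      linarith
  have h2 : (⨅ i, (p i - q i)) = c - d - splitDist w x y / 2 := by
    refine le_antisymm ?_ (le_ciInf fun k => ?_)
    · refine le_trans (ciInf_le (Set.finite_range _).bddBelow i) ?_
      rw [hp, hq]
      linarith
    · have := splitDist_triangle hw.nonneg x y (Sum.inr k)
      rw [hp, hq]
      linarith
  rw [hilbertDist, h1, h2]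
  ring

/-- The distances between the attaching points of the leaves. -/
theorem IsSymbicSplitSystem.exists_points {A : Matrix (Fin n) (Fin n) ℝ} (hA : HasSplitForm A w) :
    ∃ pt : Fin n ⊕ Fin n → (Fin n → ℝ),
      (∀ k i, pt (Sum.inl k) i = A i k) ∧ (∀ j, IsRayFoot A j (pt (Sum.inr j))) ∧
      ∀ x y, hilbertDist (pt x) (pt y) = splitDist w x y := by
  obtain ⟨a, ha⟩ := hA
  have hcol : ∀ i k, A i k = a i + a k - splitDist w (Sum.inl k) (Sum.inr i) / 2 := by
    intro i k
    have := splitDist_swap hw.swap (Sum.inl i) (Sum.inr k)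
    simp only [Sum.swap_inl, Sum.swap_inr] at this
    rw [ha, ← this, splitDist_comm hw.compl]
  -- The infimum is attained at a leaf `k` such that `j'` lies between `i'` and `k`. Feet thus have
  -- the same form as columns.
  have hfoot : ∀ i j, (⨅ k, (A i k - A j k)) =
      a i + -a j - splitDist w (Sum.inr j) (Sum.inr i) / 2 := by
    intro i j
    have : Nonempty (Fin n) := ⟨i⟩
    refine le_antisymm ?_ (le_ciInf fun k => ?_)
    · obtain ⟨k, hk⟩ := hS.exists_inl_splitDist_add hw (Sum.inr i) (Sum.inr j)
      refine le_trans (ciInf_le (Set.finite_range _).bddBelow k) ?_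
      rw [hcol, hcol, splitDist_comm hw.compl (Sum.inl k), splitDist_comm hw.compl (Sum.inl k), hk,
        splitDist_comm hw.compl (Sum.inr i) (Sum.inr j)]
      linarith
    · have := splitDist_triangle hw.nonneg (Sum.inl k) (Sum.inr j) (Sum.inr i)
      rw [hcol, hcol]
      linarith
  refine ⟨Sum.elim (fun k i => A i k) fun j i => ⨅ k, (A i k - A j k), fun _ _ => rfl,
    isRayFoot_iInf A, ?_⟩
  have key : ∀ x, ∃ c, ∀ i, Sum.elim (fun k i => A i k) (fun j i => ⨅ k, (A i k - A j k)) x i =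
      a i + c - splitDist w x (Sum.inr i) / 2 := by
    rintro (k | j)
    · exact ⟨a k, fun i => hcol i k⟩
    · exact ⟨-a j, fun i => hfoot i j⟩
  intro x y
  obtain ⟨c, hc⟩ := key x
  obtain ⟨d, hd⟩ := key y
  exact hS.hilbertDist_eq hw hc hd

end HilbertDistance

/-! ### Splits of a tree -/

namespace SimpleGraph

variable {V : Type*} {G : SimpleGraph V}

theorem Adj.reachable_deleteEdges {a b : V} (h : G.Adj a b) {e : Sym2 V} (he : s(a, b) ≠ e) :
    (G.deleteEdges {e}).Reachable a b :=
  Adj.reachable (by simpa [deleteEdges_adj, h] using he)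

theorem IsAcyclic.not_reachable_deleteEdges (hG : G.IsAcyclic) {u v : V} (h : G.Adj u v) :
    ¬ (G.deleteEdges {s(u, v)}).Reachable u v := by
  have := isAcyclic_iff_forall_adj_isBridge.1 hG h
  rw [isBridge_iff] at this
  exact this

theorem Connected.reachable_deleteEdges_or (hG : G.Connected) (u v w : V) :
    (G.deleteEdges {s(u, v)}).Reachable u w ∨ (G.deleteEdges {s(u, v)}).Reachable v w := by
  obtain ⟨u', hu'⟩ : ∃ u', u' = u := ⟨u, rfl⟩
  obtain ⟨p⟩ := hG.preconnected w u'
  induction p with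
  | nil => exact Or.inl (hu' ▸ Reachable.refl _)
  | @cons a b _ h p ih =>
    have ih := ih hu'
    by_cases he : s(b, a) = s(u, v)
    · rcases Sym2.eq_iff.1 he with ⟨-, rfl⟩ | ⟨-, rfl⟩
      · exact Or.inr (Reachable.refl _)
      · exact Or.inl (Reachable.refl _)
    · exact ih.imp (fun h' => h'.trans (h.symm.reachable_deleteEdges he))
        (fun h' => h'.trans (h.symm.reachable_deleteEdges he))

/-- A component of the graph without `e` that misses an endpoint of `f` survives without `f`. -/
theorem Reachable.deleteEdges_of_not_reachable {e f : Sym2 V} {a w z : V}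
    (h : (G.deleteEdges {e}).Reachable a w) (hz : z ∈ f)
    (hn : ¬ (G.deleteEdges {e}).Reachable a z) : (G.deleteEdges {f}).Reachable a w := by
  obtain ⟨p⟩ := h
  induction p with
  | nil => exact Reachable.refl _
  | @cons a b _ h p ih =>
    have hab : s(a, b) ≠ f := by
      rintro rfl
      rcases Sym2.mem_iff.1 hz with rfl | rfl
      · exact hn (Reachable.refl _)
      · exact hn h.reachable
    exact ((deleteEdges_adj.1 h).1.reachable_deleteEdges hab).trans
      (ih fun h' => hn (h.reachable.trans h'))

theorem Iso.reachable_deleteEdges_iff {V' : Type*} {G' : SimpleGraph V'} (φ : G ≃g G')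
    (e : Sym2 V) (a b : V) : (G'.deleteEdges {e.map φ}).Reachable (φ a) (φ b) ↔
      (G.deleteEdges {e}).Reachable a b := by
  let ψ : G.deleteEdges {e} ≃g G'.deleteEdges {e.map φ} :=
    { toEquiv := φ.toEquiv
      map_rel_iff' := by
        intro a b
        have h1 : s(φ a, φ b) = e.map φ ↔ s(a, b) = e := by
          rw [← Sym2.map_mk, (Sym2.map.injective φ.injective).eq_iff]
        have h2 : G'.Adj (φ a) (φ b) ↔ G.Adj a b := φ.map_adj_iff
        simpa [deleteEdges_adj, h2] using fun _ => not_congr h1 }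
  exact ψ.reachable_iff

/-- Two edges of a tree, with endpoints named so that `v` and `b` face each other. -/
theorem IsTree.exists_facing (hG : G.IsTree) {e f : Sym2 V} (he : e ∈ G.edgeSet)
    (hf : f ∈ G.edgeSet) (hne : e ≠ f) :
    ∃ u v a b, e = s(u, v) ∧ f = s(a, b) ∧ (G.deleteEdges {e}).Reachable v a ∧
      (G.deleteEdges {e}).Reachable v b ∧ (G.deleteEdges {f}).Reachable b u ∧
      (G.deleteEdges {f}).Reachable b v := by
  induction e using Sym2.ind with | _ u v
  induction f using Sym2.ind with | _ a b
  rw [mem_edgeSet] at he hf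
  have key : ∀ {u v a b : V}, G.Adj a b → s(u, v) ≠ s(a, b) → ∃ u' v', s(u, v) = s(u', v') ∧
      (G.deleteEdges {s(u, v)}).Reachable v' a ∧ (G.deleteEdges {s(u, v)}).Reachable v' b := by
    intro u v a b hab hne
    have hab := hab.reachable_deleteEdges hne.symm
    rcases hG.connected.reachable_deleteEdges_or u v a with h | h
    · exact ⟨v, u, Sym2.eq_swap, h, h.trans hab⟩
    · exact ⟨u, v, rfl, h, h.trans hab⟩
  obtain ⟨u', v', h1, h2, h3⟩ := key hf hne
  obtain ⟨a', b', h4, h5, h6⟩ := key he hne.symm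
  refine ⟨u', v', a', b', h1, h4, ?_⟩
  rcases Sym2.eq_iff.1 h1 with ⟨rfl, rfl⟩ | ⟨rfl, rfl⟩ <;>
    rcases Sym2.eq_iff.1 h4 with ⟨rfl, rfl⟩ | ⟨rfl, rfl⟩ <;>
    refine ⟨?_, ?_, ?_, ?_⟩ <;> assumption

theorem Walk.exists_edge_of_not_reachable {u w : V} (p : G.Walk u w) {e : Sym2 V} {i j : ℕ}
    (hij : i ≤ j) (hj : j ≤ p.length)
    (hn : ¬ (G.deleteEdges {e}).Reachable (p.getVert i) (p.getVert j)) :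
    ∃ m, i ≤ m ∧ m < j ∧ s(p.getVert m, p.getVert (m + 1)) = e := by
  induction j, hij using Nat.le_induction with
  | base => exact absurd (Reachable.refl _) hn
  | succ j hij ih =>
    by_cases he : s(p.getVert j, p.getVert (j + 1)) = e
    · exact ⟨j, hij, j.lt_succ_self, he⟩
    · obtain ⟨m, h1, h2, h3⟩ := ih (by omega) fun h =>
        hn (h.trans ((p.adj_getVert_succ (by omega)).reachable_deleteEdges he))
      exact ⟨m, h1, by omega, h3⟩

/-- A path crosses an edge at most once, so the edge cannot cut a vertex off from both an earlier
and a later one. -/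
theorem Walk.IsPath.false_of_between {u w : V} {p : G.Walk u w} (hp : p.IsPath) {e : Sym2 V}
    {i j k : ℕ} (hij : i ≤ j) (hjk : j ≤ k) (hk : k ≤ p.length)
    (h1 : ¬ (G.deleteEdges {e}).Reachable (p.getVert j) (p.getVert i))
    (h2 : ¬ (G.deleteEdges {e}).Reachable (p.getVert j) (p.getVert k)) : False := by
  obtain ⟨m, hm1, hm2, hm⟩ := p.exists_edge_of_not_reachable hij (by omega) fun h => h1 h.symm
  obtain ⟨m', hm1', hm2', hm'⟩ := p.exists_edge_of_not_reachable hjk hk h2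
  have inj : ∀ a b, a ≤ p.length → b ≤ p.length → p.getVert a = p.getVert b → a = b :=
    fun a b ha hb h => hp.getVert_injOn ha hb h
  rcases Sym2.eq_iff.1 (hm.trans hm'.symm) with ⟨h, -⟩ | ⟨h, -⟩
  · have := inj _ _ (by omega) (by omega) h
    omega
  · have := inj _ _ (by omega) (by omega) h
    omega

end SimpleGraph

namespace SymbicTree

variable {n : ℕ} (T : SymbicTree n)

/-- The labels of the leaves on the side of `v` of the edge `e`. -/
def leafSide (e : Sym2 T.V) (v : T.V) : Set (Fin n ⊕ Fin n) :=
  {x | (T.G.deleteEdges {e}).Reachable v (T.leaf x)}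

/-- The sides of the splits induced by the internal edges. -/
def sides : Set (Set (Fin n ⊕ Fin n)) :=
  {B | ∃ e ∈ T.G.edgeSet, (∀ v ∈ e, v ∉ Set.range T.leaf) ∧ ∃ u ∈ e, B = T.leafSide e u}

variable {T}

theorem mem_leafSide {e : Sym2 T.V} {v : T.V} {x : Fin n ⊕ Fin n} :
    x ∈ T.leafSide e v ↔ (T.G.deleteEdges {e}).Reachable v (T.leaf x) := Iff.rfl

theorem leafSide_compl {u v : T.V} (h : T.G.Adj u v) :
    (T.leafSide s(u, v) u)ᶜ = T.leafSide s(u, v) v := by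
  ext x
  rw [Set.mem_compl_iff, mem_leafSide, mem_leafSide]
  constructor
  · exact (T.isTree.connected.reachable_deleteEdges_or u v _).resolve_left
  · exact fun h1 h2 => T.isTree.isAcyclic.not_reachable_deleteEdges h (h2.trans h1.symm)

/-- If `v` is not a leaf, it has a further neighbor, and stepping to it strictly shrinks the
component. -/
theorem exists_mem_leafSide {u v : T.V} (h : T.G.Adj u v) : ∃ x, x ∈ T.leafSide s(u, v) v := by
  have := T.finite_V
  induction hk : {w | (T.G.deleteEdges {s(u, v)}).Reachable v w}.ncard using Nat.strong_induction_on
    generalizing u v with | _ k ih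
  by_cases hv : v ∈ Set.range T.leaf
  · obtain ⟨x, rfl⟩ := hv
    exact ⟨x, SimpleGraph.Reachable.refl _⟩
  obtain ⟨z, hz, hzu⟩ : ∃ z, T.G.Adj v z ∧ z ≠ u := by
    by_contra! hz
    refine hv ((T.range_leaf v).2 (Set.ncard_eq_one.2 ⟨u, ?_⟩))
    ext z
    exact ⟨hz z, by rintro rfl; exact h.symm⟩
  have hne : s(u, v) ≠ s(v, z) := by
    intro h'
    rcases Sym2.eq_iff.1 h' with ⟨rfl, rfl⟩ | ⟨rfl, -⟩
    · exact hzu rfl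
    · exact hzu rfl
  have hzv := T.isTree.isAcyclic.not_reachable_deleteEdges hz
  have hzu' : ¬ (T.G.deleteEdges {s(v, z)}).Reachable z u := fun h' =>
    hzv (h'.trans (h.reachable_deleteEdges hne)).symm
  have hsub : ∀ w, (T.G.deleteEdges {s(v, z)}).Reachable z w →
      (T.G.deleteEdges {s(u, v)}).Reachable v w := fun w hw =>
    (hz.reachable_deleteEdges hne.symm).trans
      (hw.deleteEdges_of_not_reachable (Sym2.mem_mk_left u v) hzu')
  obtain ⟨x, hx⟩ := ih _ (by
    rw [← hk]
    refine Set.ncard_lt_ncard (Set.ssubset_iff_exists.2 ⟨hsub, v, SimpleGraph.Reachable.refl _, ?_⟩)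
      (Set.toFinite _)
    exact fun h' => hzv h'.symm) hz rfl
  exact ⟨x, hsub _ hx⟩

theorem exists_mem_leafSide_of_mem {e : Sym2 T.V} (he : e ∈ T.G.edgeSet) {v : T.V} (hv : v ∈ e) :
    ∃ x, x ∈ T.leafSide e v := by
  obtain ⟨u, rfl⟩ := Sym2.mem_iff_exists.1 hv
  rw [Sym2.eq_swap] at he ⊢
  exact exists_mem_leafSide he

/-- There is a leaf between any two edges. -/
theorem exists_leaf_between {u v a b : T.V} (hne : s(u, v) ≠ s(a, b)) (huv : T.G.Adj u v)
    (hab : T.G.Adj a b)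
    (hbu : (T.G.deleteEdges {s(a, b)}).Reachable b u)
    (hbv : (T.G.deleteEdges {s(a, b)}).Reachable b v) :
    ∃ x, x ∈ T.leafSide s(u, v) v ∧ x ∈ T.leafSide s(a, b) b := by
  have := T.finite_V
  have hT := T.isTree.isAcyclic
  by_cases hv : v ∈ Set.range T.leaf
  · obtain ⟨x, rfl⟩ := hv
    exact ⟨x, SimpleGraph.Reachable.refl _, hbv⟩
  obtain ⟨z₁, z₂, h1, h1u, h2, h2u, h12⟩ :
      ∃ z₁ z₂, T.G.Adj v z₁ ∧ z₁ ≠ u ∧ T.G.Adj v z₂ ∧ z₂ ≠ u ∧ z₁ ≠ z₂ := by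
    obtain ⟨z₁, h1, h1u⟩ : ∃ z, T.G.Adj v z ∧ z ≠ u := by
      by_contra! hz
      refine hv ((T.range_leaf v).2 (Set.ncard_eq_one.2 ⟨u, ?_⟩))
      ext z
      exact ⟨hz z, by rintro rfl; exact huv.symm⟩
    by_contra! hz
    refine T.ncard_ne_two v (Set.ncard_eq_two.2 ⟨u, z₁, h1u.symm, ?_⟩)
    ext z
    constructor
    · intro h
      by_cases hzu : z = u
      · exact Or.inl hzu
      · exact Or.inr (hz z₁ z h1 h1u h hzu).symm
    · rintro (rfl | rfl)
      · exact huv.symm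
      · exact h1
  -- Only one of the two further neighbors can lead towards `a`; a leaf beyond the other one lies
  -- between the edges.
  obtain ⟨z, hz, hzu, hza⟩ : ∃ z, T.G.Adj v z ∧ z ≠ u ∧
      ¬ (T.G.deleteEdges {s(v, z)}).Reachable z a := by
    by_contra! hcon
    have r1 := hcon z₁ h1 h1u
    have r2 := hcon z₂ h2 h2u
    have r3 := r1.deleteEdges_of_not_reachable (f := s(v, z₂)) (Sym2.mem_mk_left v z₂)
      fun h => hT.not_reachable_deleteEdges h1 h.symm
    have r4 := h1.reachable_deleteEdges (e := s(v, z₂)) fun h =>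
      h12 (Sym2.congr_right.1 h)
    exact hT.not_reachable_deleteEdges h2 (r4.trans (r3.trans r2.symm))
  have hne' : s(u, v) ≠ s(v, z) := by
    intro h'
    rcases Sym2.eq_iff.1 h' with ⟨rfl, rfl⟩ | ⟨rfl, -⟩
    · exact hzu rfl
    · exact hzu rfl
  have hzv := hT.not_reachable_deleteEdges hz
  have hzu' : ¬ (T.G.deleteEdges {s(v, z)}).Reachable z u := fun h' =>
    hzv (h'.trans (huv.reachable_deleteEdges hne')).symm
  obtain ⟨x, hx⟩ := exists_mem_leafSide hz
  refine ⟨x, (hz.reachable_deleteEdges hne'.symm).trans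
      (hx.deleteEdges_of_not_reachable (Sym2.mem_mk_left u v) hzu'), ?_⟩
  have hne'' : s(v, z) ≠ s(a, b) := by
    intro h'
    rcases Sym2.eq_iff.1 h' with ⟨rfl, rfl⟩ | ⟨rfl, rfl⟩
    · exact hzv hbv.symm
    · exact hza (SimpleGraph.Reachable.refl _)
  exact (hbv.trans (hz.reachable_deleteEdges hne'')).trans
    (hx.deleteEdges_of_not_reachable (Sym2.mem_mk_left a b) hza)

/-- The relative position of the splits of two different edges. -/
theorem exists_facing {e f : Sym2 T.V} (he : e ∈ T.G.edgeSet) (hf : f ∈ T.G.edgeSet)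
    (hne : e ≠ f) : ∃ u v a b, e = s(u, v) ∧ f = s(a, b) ∧
      ¬ (T.G.deleteEdges {f}).Reachable a u ∧ ¬ (T.G.deleteEdges {e}).Reachable u a ∧
      Disjoint (T.leafSide e u) (T.leafSide f a) ∧ (T.leafSide e u)ᶜ = T.leafSide e v ∧
      (T.leafSide f a)ᶜ = T.leafSide f b ∧ ∃ x, x ∈ T.leafSide e v ∧ x ∈ T.leafSide f b := by
  obtain ⟨u, v, a, b, rfl, rfl, h1, h2, h3, h4⟩ := T.isTree.exists_facing he hf hne
  rw [SimpleGraph.mem_edgeSet] at he hf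
  have hT := T.isTree.isAcyclic
  have hau : ¬ (T.G.deleteEdges {s(a, b)}).Reachable a u := fun h =>
    hT.not_reachable_deleteEdges hf (h.trans h3.symm)
  have hua : ¬ (T.G.deleteEdges {s(u, v)}).Reachable u a := fun h =>
    hT.not_reachable_deleteEdges he (h.trans h1.symm)
  refine ⟨u, v, a, b, rfl, rfl, hau, hua, ?_, leafSide_compl he, leafSide_compl hf,
    exists_leaf_between hne he hf h3 h4⟩
  rw [Set.disjoint_left]
  intro x hx hx'
  exact hau (hx'.trans (hx.deleteEdges_of_not_reachable (Sym2.mem_mk_left a b) hua).symm)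

/-- Different edges have a leaf between them, because no vertex has degree two; that leaf and a leaf
beyond an edge tell the splits apart. -/
theorem edge_eq_of_leafSide_eq {e f : Sym2 T.V} (he : e ∈ T.G.edgeSet) (hf : f ∈ T.G.edgeSet)
    {u a : T.V} (hu : u ∈ e) (ha : a ∈ f) (h : T.leafSide e u = T.leafSide f a) : e = f := by
  by_contra hne
  obtain ⟨u', v', a', b', rfl, rfl, -, -, hd, hu', ha', x, hx, hx'⟩ := exists_facing he hf hne
  obtain ⟨y, hy⟩ := exists_mem_leafSide_of_mem he (Sym2.mem_mk_left u' v')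
  have hxu : x ∉ T.leafSide s(u', v') u' := by rwa [← hu'] at hx
  have hxa : x ∉ T.leafSide s(a', b') a' := by rwa [← ha'] at hx'
  rcases Sym2.mem_iff.1 hu with rfl | rfl <;> rcases Sym2.mem_iff.1 ha with rfl | rfl
  · exact Set.disjoint_left.1 hd hy (h ▸ hy)
  · exact hxu (h ▸ hx')
  · exact hxa (h ▸ hx)
  · rw [← hu', ← ha', compl_inj_iff] at h
    exact Set.disjoint_left.1 hd hy (h ▸ hy)

theorem leafSide_compl_of_mem {e : Sym2 T.V} (he : e ∈ T.G.edgeSet) {u v : T.V} (hu : u ∈ e)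
    (hv : v ∈ e) (huv : u ≠ v) : (T.leafSide e u)ᶜ = T.leafSide e v := by
  obtain rfl := (Sym2.mem_and_mem_iff huv).1 ⟨hu, hv⟩
  exact leafSide_compl he

theorem vertex_eq_of_leafSide_eq {e : Sym2 T.V} (he : e ∈ T.G.edgeSet) {u v : T.V} (hu : u ∈ e)
    (hv : v ∈ e) (h : T.leafSide e u = T.leafSide e v) : u = v := by
  by_contra huv
  obtain ⟨x, hx⟩ := exists_mem_leafSide_of_mem he hu
  have h' := leafSide_compl_of_mem he hu hv huv
  rw [← h] at h'
  rw [← h'] at hx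
  exact hx (h' ▸ hx)

theorem leafSide_compatible {e f : Sym2 T.V} (he : e ∈ T.G.edgeSet) (hf : f ∈ T.G.edgeSet)
    {u a : T.V} (hu : u ∈ e) (ha : a ∈ f) :
    Disjoint (T.leafSide e u) (T.leafSide f a) ∨ T.leafSide e u ⊆ T.leafSide f a ∨
      T.leafSide f a ⊆ T.leafSide e u ∨ (T.leafSide e u)ᶜ ⊆ T.leafSide f a := by
  by_cases hne : e = f
  · subst hne
    by_cases hua : u = a
    · subst hua
      exact Or.inr (Or.inl subset_rfl)
    · exact Or.inr (Or.inr (Or.inr (leafSide_compl_of_mem he hu ha hua).subset))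
  obtain ⟨u', v', a', b', rfl, rfl, -, -, hd, hu', ha', -⟩ := exists_facing he hf hne
  rcases Sym2.mem_iff.1 hu with rfl | rfl <;> rcases Sym2.mem_iff.1 ha with rfl | rfl
  · exact Or.inl hd
  · refine Or.inr (Or.inl ?_)
    rw [← ha']
    exact Set.subset_compl_iff_disjoint_right.2 hd
  · refine Or.inr (Or.inr (Or.inl ?_))
    rw [← hu']
    exact Set.subset_compl_iff_disjoint_left.2 hd
  · refine Or.inr (Or.inr (Or.inr ?_))
    rw [← ha', ← hu', compl_compl]
    exact Set.subset_compl_iff_disjoint_right.2 hd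

theorem not_reachable_of_disjoint {e f : Sym2 T.V} (he : e ∈ T.G.edgeSet) (hf : f ∈ T.G.edgeSet)
    {u a : T.V} (hu : u ∈ e) (ha : a ∈ f) (hne : e ≠ f)
    (hd : Disjoint (T.leafSide e u) (T.leafSide f a)) :
    ¬ (T.G.deleteEdges {f}).Reachable a u ∧ ¬ (T.G.deleteEdges {e}).Reachable u a := by
  obtain ⟨x₁, hx₁⟩ := exists_mem_leafSide_of_mem he hu
  obtain ⟨x₂, hx₂⟩ := exists_mem_leafSide_of_mem hf ha
  obtain ⟨u', v', a', b', rfl, rfl, h1, h2, hd', hu', ha', x, hx, hx'⟩ := exists_facing he hf hne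
  rw [Set.disjoint_left] at hd hd'
  rcases Sym2.mem_iff.1 hu with rfl | rfl <;> rcases Sym2.mem_iff.1 ha with rfl | rfl
  · exact ⟨h1, h2⟩
  · rw [← ha'] at hd
    exact absurd (fun h => hd' hx₁ h) (hd hx₁)
  · rw [← hu'] at hd
    exact absurd hx₂ (hd fun h => hd' h hx₂)
  · exact absurd hx' (hd hx)

/-- Sides of different edges with disjoint leaf sets are disjoint. -/
theorem not_reachable_of_disjoint' {e f : Sym2 T.V} (he : e ∈ T.G.edgeSet) (hf : f ∈ T.G.edgeSet)
    {u a w : T.V} (hu : u ∈ e) (ha : a ∈ f) (hne : e ≠ f)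
    (hd : Disjoint (T.leafSide e u) (T.leafSide f a))
    (h1 : (T.G.deleteEdges {e}).Reachable u w) (h2 : (T.G.deleteEdges {f}).Reachable a w) :
    False := by
  obtain ⟨h3, h4⟩ := not_reachable_of_disjoint he hf hu ha hne hd
  exact h3 (h2.trans (h1.deleteEdges_of_not_reachable ha h4).symm)

theorem leafSide_map_swap (e : Sym2 T.V) (u : T.V) :
    T.leafSide (e.map T.swap) (T.swap u) = Sum.swap ⁻¹' T.leafSide e u := by
  ext x
  rw [Set.mem_preimage, mem_leafSide, mem_leafSide,
    ← T.swap.reachable_deleteEdges_iff e u (T.leaf x.swap), T.swap_leaf, Sum.swap_swap]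

theorem map_swap_mem_edgeSet {e : Sym2 T.V} (he : e ∈ T.G.edgeSet) :
    e.map T.swap ∈ T.G.edgeSet := by
  induction e using Sym2.ind with | _ u v
  exact T.swap.map_adj_iff.2 he

theorem not_mem_range_leaf_of_mem_map_swap {e : Sym2 T.V} (he : ∀ v ∈ e, v ∉ Set.range T.leaf) :
    ∀ v ∈ e.map T.swap, v ∉ Set.range T.leaf := by
  rintro v hv ⟨x, rfl⟩
  obtain ⟨u, hu, h⟩ := Sym2.mem_map.1 hv
  refine he u hu ⟨x.swap, ?_⟩
  rw [← T.swap_leaf, ← h, T.swap_swap]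

/-- A side determines its edge and its endpoint, so an invariant side has a fixed endpoint. -/
theorem swap_eq_of_leafSide_fixed {e : Sym2 T.V} (he : e ∈ T.G.edgeSet) {u : T.V} (hu : u ∈ e)
    (h : Sum.swap ⁻¹' T.leafSide e u = T.leafSide e u) : T.swap u = u := by
  rw [← leafSide_map_swap] at h
  have hmem : T.swap u ∈ e.map T.swap := Sym2.mem_map.2 ⟨u, hu, rfl⟩
  have := edge_eq_of_leafSide_eq (map_swap_mem_edgeSet he) he hmem hu h
  rw [this] at h hmem
  exact vertex_eq_of_leafSide_eq he hmem hu h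

/-- The internal edges of a symbic tree induce a symbic split system. -/
theorem isSymbicSplitSystem_sides (T : SymbicTree n) : IsSymbicSplitSystem T.sides where
  compl_mem := by
    rintro _ ⟨e, he, hl, u, hu, rfl⟩
    obtain ⟨v, rfl⟩ := Sym2.mem_iff_exists.1 hu
    exact ⟨s(u, v), he, hl, v, Sym2.mem_mk_right u v, leafSide_compl he⟩
  exists_inl := by
    rintro _ ⟨e, he, hl, u, hu, rfl⟩
    exact (T.bicolored e he hl u hu).1
  exists_inr := by
    rintro _ ⟨e, he, hl, u, hu, rfl⟩
    exact (T.bicolored e he hl u hu).2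
  compatible := by
    rintro _ ⟨e, he, -, u, hu, rfl⟩ _ ⟨f, hf, -, a, ha, rfl⟩
    exact leafSide_compatible he hf hu ha
  swap_mem := by
    rintro _ ⟨e, he, hl, u, hu, rfl⟩
    exact ⟨e.map T.swap, map_swap_mem_edgeSet he, not_mem_range_leaf_of_mem_map_swap hl, T.swap u,
      Sym2.mem_map.2 ⟨u, hu, rfl⟩, (leafSide_map_swap e u).symm⟩
  not_three_fixed := by
    rintro _ ⟨e₁, he₁, -, v₁, hv₁, rfl⟩ _ ⟨e₂, he₂, -, v₂, hv₂, rfl⟩ _ ⟨e₃, he₃, -, v₃, hv₃, rfl⟩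
      h12 h13 h23 f1 f2 f3
    have f1 := swap_eq_of_leafSide_fixed he₁ hv₁ f1
    have f2 := swap_eq_of_leafSide_fixed he₂ hv₂ f2
    have f3 := swap_eq_of_leafSide_fixed he₃ hv₃ f3
    -- Disjoint sides of one edge are complementary and leave no room for a third.
    have edge_ne : ∀ {e f g : Sym2 T.V}, e ∈ T.G.edgeSet → g ∈ T.G.edgeSet → ∀ {u a b : T.V},
        u ∈ e → a ∈ f → b ∈ g → Disjoint (T.leafSide e u) (T.leafSide f a) →
        Disjoint (T.leafSide e u) (T.leafSide g b) → Disjoint (T.leafSide f a) (T.leafSide g b) →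
        e ≠ f := by
      rintro e _ g he hg u a b hu ha hb hd1 hd2 hd3 rfl
      obtain ⟨x, hx⟩ := exists_mem_leafSide_of_mem hg hb
      obtain ⟨y, hy⟩ := exists_mem_leafSide_of_mem he hu
      have hua : u ≠ a := by
        rintro rfl
        exact Set.disjoint_left.1 hd1 hy hy
      have hc := leafSide_compl_of_mem he hu ha hua
      have h1 : x ∈ T.leafSide e a := hc ▸ (Set.disjoint_right.1 hd2 hx)
      exact Set.disjoint_left.1 hd3 h1 hx
    have n12 := edge_ne he₁ he₃ hv₁ hv₂ hv₃ h12 h13 h23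
    have n13 := edge_ne he₁ he₂ hv₁ hv₃ hv₂ h13 h12 h23.symm
    have n23 := edge_ne he₂ he₁ hv₂ hv₃ hv₁ h23 h12.symm h13.symm
    obtain ⟨r21, r12⟩ := not_reachable_of_disjoint he₁ he₂ hv₁ hv₂ n12 h12
    obtain ⟨r31, r13⟩ := not_reachable_of_disjoint he₁ he₃ hv₁ hv₃ n13 h13
    obtain ⟨r32, r23⟩ := not_reachable_of_disjoint he₂ he₃ hv₂ hv₃ n23 h23
    rcases T.fixed_path with h | ⟨u, w, p, hp, hfix⟩
    · exact h v₁ f1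
    obtain ⟨i₁, rfl, l1⟩ := SimpleGraph.Walk.mem_support_iff_exists_getVert.1 ((hfix v₁).1 f1)
    obtain ⟨i₂, rfl, l2⟩ := SimpleGraph.Walk.mem_support_iff_exists_getVert.1 ((hfix v₂).1 f2)
    obtain ⟨i₃, rfl, l3⟩ := SimpleGraph.Walk.mem_support_iff_exists_getVert.1 ((hfix v₃).1 f3)
    -- The three fixed endpoints lie on the path, and the edge of the middle one separates it from
    -- both others.
    rcases le_total i₁ i₂ with a | a <;> rcases le_total i₁ i₃ with b | b <;>
      rcases le_total i₂ i₃ with c | c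
    · exact hp.false_of_between a c l3 r21 r23
    · exact hp.false_of_between b c l2 r31 r32
    · exact hp.false_of_between a c l3 r21 r23
    · exact hp.false_of_between b a l2 r13 r12
    · exact hp.false_of_between a b l3 r12 r13
    · exact hp.false_of_between a b l3 r12 r13
    · exact hp.false_of_between c b l1 r32 r31
    · exact hp.false_of_between c a l1 r23 r21

end SymbicTree

/-! ### Edge lengths and weights of splits -/

namespace SymbicTree

variable {n : ℕ} {T : SymbicTree n}

theorem orbit_eq {e f : T.InternalEdge} (h : f.1 = e.1.map T.swap) :
    (Quot.mk _ e : T.EdgeOrbit) = Quot.mk _ f :=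
  Quot.sound h

open Classical in
/-- The weights of the splits for given edge lengths. -/
noncomputable def weight (T : SymbicTree n) (ℓ : T.EdgeOrbit → ℝ) (B : Set (Fin n ⊕ Fin n)) : ℝ :=
  ∑ e : T.InternalEdge, if ∃ u ∈ e.1, T.leafSide e.1 u = B then ℓ (Quot.mk _ e) else 0

theorem weight_leafSide (ℓ : T.EdgeOrbit → ℝ) (e : T.InternalEdge) {u : T.V} (hu : u ∈ e.1) :
    T.weight ℓ (T.leafSide e.1 u) = ℓ (Quot.mk _ e) := by
  unfold weight
  rw [Finset.sum_eq_single e]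
  · exact if_pos ⟨u, hu, rfl⟩
  · rintro f - hf
    refine if_neg ?_
    rintro ⟨v, hv, h⟩
    exact hf (Subtype.ext (edge_eq_of_leafSide_eq f.2.1 e.2.1 hv hu h))
  · simp

theorem weight_eq_zero (ℓ : T.EdgeOrbit → ℝ) {B : Set (Fin n ⊕ Fin n)} (hB : B ∉ T.sides) :
    T.weight ℓ B = 0 := by
  refine Finset.sum_eq_zero fun e _ => if_neg ?_
  rintro ⟨u, hu, rfl⟩
  exact hB ⟨e.1, e.2.1, e.2.2, u, hu, rfl⟩

theorem exists_internalEdge {B : Set (Fin n ⊕ Fin n)} (hB : B ∈ T.sides) :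
    ∃ e : T.InternalEdge, ∃ u ∈ e.1, B = T.leafSide e.1 u := by
  obtain ⟨e, he, hl, u, hu, rfl⟩ := hB
  exact ⟨⟨e, he, hl⟩, u, hu, rfl⟩

theorem leafSide_mem_sides (e : T.InternalEdge) {u : T.V} (hu : u ∈ e.1) :
    T.leafSide e.1 u ∈ T.sides :=
  ⟨e.1, e.2.1, e.2.2, u, hu, rfl⟩

theorem weight_compl (ℓ : T.EdgeOrbit → ℝ) (B : Set (Fin n ⊕ Fin n)) :
    T.weight ℓ Bᶜ = T.weight ℓ B := by
  have hS := T.isSymbicSplitSystem_sides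
  by_cases hB : B ∈ T.sides
  · obtain ⟨e, u, hu, rfl⟩ := exists_internalEdge hB
    obtain ⟨v, hv⟩ := Sym2.mem_iff_exists.1 hu
    have hmem : v ∈ e.1 := hv ▸ Sym2.mem_mk_right u v
    have huv : u ≠ v := SimpleGraph.Adj.ne (G := T.G) (by
      rw [← SimpleGraph.mem_edgeSet, ← hv]
      exact e.2.1)
    rw [leafSide_compl_of_mem e.2.1 hu hmem huv, weight_leafSide ℓ e hu, weight_leafSide ℓ e hmem]
  · rw [weight_eq_zero ℓ hB, weight_eq_zero]
    intro h
    exact hB (compl_compl B ▸ hS.compl_mem _ h)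

theorem weight_swap (ℓ : T.EdgeOrbit → ℝ) (B : Set (Fin n ⊕ Fin n)) :
    T.weight ℓ (Sum.swap ⁻¹' B) = T.weight ℓ B := by
  have hS := T.isSymbicSplitSystem_sides
  by_cases hB : B ∈ T.sides
  · obtain ⟨e, u, hu, rfl⟩ := exists_internalEdge hB
    let f : T.InternalEdge :=
      ⟨e.1.map T.swap, map_swap_mem_edgeSet e.2.1, not_mem_range_leaf_of_mem_map_swap e.2.2⟩
    have hf : T.leafSide f.1 (T.swap u) = Sum.swap ⁻¹' T.leafSide e.1 u := leafSide_map_swap e.1 u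
    rw [← hf, weight_leafSide ℓ e hu, weight_leafSide ℓ f (Sym2.mem_map.2 ⟨u, hu, rfl⟩)]
    exact congrArg ℓ (orbit_eq rfl).symm
  · rw [weight_eq_zero ℓ hB, weight_eq_zero]
    intro h
    exact hB (swap_preimage_swap_preimage B ▸ hS.swap_mem _ h)

theorem isWeight_weight {ℓ : T.EdgeOrbit → ℝ} (hℓ : ∀ o, 0 ≤ ℓ o) :
    IsWeight T.sides (T.weight ℓ) where
  nonneg B := Finset.sum_nonneg fun e _ => by
    split_ifs
    · exact hℓ _
    · exact le_rfl
  mem_of_ne_zero B h := by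
    by_contra hB
    exact h (weight_eq_zero ℓ hB)
  compl := weight_compl ℓ
  swap := weight_swap ℓ

/-- Of the two sides of a separating edge, exactly one contains `x` and not `y`, so each such edge
is counted once. -/
theorem dist_eq_splitDist (ℓ : T.EdgeOrbit → ℝ) (x y : Fin n ⊕ Fin n) :
    T.dist ℓ x y = splitDist (T.weight ℓ) x y := by
  classical
  have h : ∀ B : Set (Fin n ⊕ Fin n), (if x ∈ B ∧ y ∉ B then T.weight ℓ B else 0) =
      ∑ e : T.InternalEdge, if (x ∈ B ∧ y ∉ B) ∧ ∃ u ∈ e.1, T.leafSide e.1 u = B then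
        ℓ (Quot.mk _ e) else 0 := by
    intro B
    unfold weight
    split_ifs with hB
    · simp [hB]
    · simp [hB]
  unfold splitDist dist
  rw [Finset.sum_congr rfl fun B _ => h B, Finset.sum_comm]
  refine Finset.sum_congr rfl fun e _ => ?_
  by_cases hs : T.Separates e x y
  · rw [if_pos hs]
    obtain ⟨e, he, hl⟩ := e
    induction e using Sym2.ind with | _ u v
    obtain ⟨z, hz, hx⟩ : ∃ z ∈ s(u, v), x ∈ T.leafSide s(u, v) z := by
      rcases T.isTree.connected.reachable_deleteEdges_or u v (T.leaf x) with h | h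
      · exact ⟨u, Sym2.mem_mk_left u v, h⟩
      · exact ⟨v, Sym2.mem_mk_right u v, h⟩
    have hy : y ∉ T.leafSide s(u, v) z := fun hy => hs (hx.symm.trans hy)
    rw [Finset.sum_eq_single (T.leafSide s(u, v) z), if_pos ⟨⟨hx, hy⟩, z, hz, rfl⟩]
    · rintro B - hB
      refine if_neg ?_
      rintro ⟨⟨hxB, -⟩, z', hz', rfl⟩
      refine hB ?_
      by_contra hne
      have hzz : z ≠ z' := by
        rintro rfl
        exact hne rfl
      have := leafSide_compl_of_mem he hz hz' hzz
      rw [← this] at hxB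
      exact hxB hx
    · simp
  · rw [if_neg hs]
    symm
    refine Finset.sum_eq_zero fun B _ => if_neg ?_
    rintro ⟨⟨hx, hy⟩, u, hu, rfl⟩
    exact hy (hx.trans (not_not.1 hs))

/-- Invariance under complements makes the weight independent of the endpoint, and invariance under
the swap lets it descend to orbits. -/
theorem exists_weight_eq {w : Set (Fin n ⊕ Fin n) → ℝ} (hw : IsWeight T.sides w) :
    ∃ ℓ : T.EdgeOrbit → ℝ, (∀ o, 0 ≤ ℓ o) ∧ T.weight ℓ = w := by
  have key : ∀ (e : T.InternalEdge) {u v : T.V}, u ∈ e.1 → v ∈ e.1 →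
      w (T.leafSide e.1 u) = w (T.leafSide e.1 v) := by
    intro e u v hu hv
    by_cases huv : u = v
    · rw [huv]
    · rw [← leafSide_compl_of_mem e.2.1 hu hv huv, hw.compl]
  obtain ⟨ℓ, hℓ⟩ : ∃ ℓ : T.EdgeOrbit → ℝ,
      ∀ e, ℓ (Quot.mk _ e) = w (T.leafSide e.1 e.1.out.1) := by
    refine ⟨Quot.lift (fun e => w (T.leafSide e.1 e.1.out.1)) ?_, fun _ => rfl⟩
    intro e f hef
    have hmem : T.swap e.1.out.1 ∈ f.1 := hef ▸ Sym2.mem_map.2 ⟨_, e.1.out_fst_mem, rfl⟩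
    rw [key f f.1.out_fst_mem hmem, ← hw.swap, ← leafSide_map_swap, hef]
  refine ⟨ℓ, ?_, ?_⟩
  · rintro ⟨e⟩
    rw [hℓ]
    exact hw.nonneg _
  · funext B
    by_cases hB : B ∈ T.sides
    · obtain ⟨e, u, hu, rfl⟩ := exists_internalEdge hB
      rw [weight_leafSide _ e hu, hℓ]
      exact key e e.1.out_fst_mem hu
    · rw [weight_eq_zero _ hB]
      by_contra h
      exact hB (hw.mem_of_ne_zero B (Ne.symm h))

/-! ### The cone of a tree -/

theorem hasTree_of_hasSplitForm {A : Matrix (Fin n) (Fin n) ℝ} {ℓ : T.EdgeOrbit → ℝ}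
    (hℓ : ∀ o, 0 ≤ ℓ o) (hA : HasSplitForm A (T.weight ℓ)) : HasTree A T ℓ := by
  obtain ⟨pt, h1, h2, h3⟩ :=
    T.isSymbicSplitSystem_sides.exists_points (isWeight_weight hℓ) hA
  exact ⟨pt, h1, h2, fun x y => by rw [h3, dist_eq_splitDist]⟩

/-- The functional dual to the edge orbit of the split with side `B`. -/
theorem exists_dual_weight (T : SymbicTree n) (o : T.EdgeOrbit) :
    ∃ k i l j, ∀ (ℓ : T.EdgeOrbit → ℝ) (A : Matrix (Fin n) (Fin n) ℝ),
      HasSplitForm A (T.weight ℓ) → quadMinor A k i l j = ℓ o := by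
  have hS := T.isSymbicSplitSystem_sides
  induction o using Quot.ind with | _ e
  have hB := leafSide_mem_sides e e.1.out_fst_mem
  obtain ⟨k, i, l, j, hk, hi, hl, hj, h⟩ := hS.exists_dual hB
  -- Only the support of the weights is used, so lengths of any sign are allowed, as linear
  -- independence requires.
  have hsupp : ∀ (ℓ : T.EdgeOrbit → ℝ) C, T.weight ℓ C ≠ 0 → C ∈ T.sides := fun ℓ C hC => by
    by_contra hC'
    exact hC (weight_eq_zero ℓ hC')
  refine ⟨k, i, l, j, fun ℓ A hA => ?_⟩
  rw [quadMinor, hA.minor_eq (weight_compl ℓ),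
    sepWeight_eq_of_unique hk hi hl hj fun C hC => h C (hsupp ℓ C hC),
    sepWeight_eq_zero fun C hC h1 h2 h3 h4 =>
      hS.false_of_crossing hB (hsupp ℓ C hC) hk hi hl hj h1 h4 h3 h2, sub_zero,
    weight_leafSide ℓ e e.1.out_fst_mem]

theorem sum_mul_single {ι : Type*} [Fintype ι] [DecidableEq ι] (ℓ : ι → ℝ) (o : ι) :
    ∑ o', ℓ o' * (Pi.single o' 1 : ι → ℝ) o = ℓ o := by
  rw [Finset.sum_eq_single o]
  · simp
  · intro o' _ ho
    rw [Pi.single_eq_of_ne ho.symm, mul_zero]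
  · simp

open Classical in
/-- The generator of the cone of `T` for the edge orbit `o`. -/
noncomputable def generator (T : SymbicTree n) (o : T.EdgeOrbit) : Matrix (Fin n) (Fin n) ℝ :=
  Matrix.of fun i j => - T.dist (Pi.single o 1) (Sum.inl i) (Sum.inr j) / 2

open Classical in
theorem dist_eq_sum (ℓ : T.EdgeOrbit → ℝ) (x y : Fin n ⊕ Fin n) :
    T.dist ℓ x y = ∑ o, ℓ o * T.dist (Pi.single o 1) x y := by
  unfold dist
  simp only [Finset.mul_sum]
  rw [Finset.sum_comm]
  refine Finset.sum_congr rfl fun e _ => ?_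
  split_ifs with h
  · exact (sum_mul_single ℓ _).symm
  · simp

theorem sum_smul_generator_apply (ℓ : T.EdgeOrbit → ℝ) (i j : Fin n) :
    (∑ o, ℓ o • T.generator o) i j = - T.dist ℓ (Sum.inl i) (Sum.inr j) / 2 := by
  rw [Matrix.sum_apply, dist_eq_sum, ← Finset.sum_neg_distrib, Finset.sum_div]
  refine Finset.sum_congr rfl fun o _ => ?_
  simp only [Matrix.smul_apply, generator, Matrix.of_apply, smul_eq_mul]
  ring

theorem sub_mem_scalingSpace_iff {A : Matrix (Fin n) (Fin n) ℝ} {ℓ : T.EdgeOrbit → ℝ} :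
    A - ∑ o, ℓ o • T.generator o ∈ scalingSpace n ↔ HasSplitForm A (T.weight ℓ) := by
  change (∃ x : Fin n → ℝ, ∀ i j, (A - ∑ o, ℓ o • T.generator o) i j = x i + x j) ↔
    ∃ x : Fin n → ℝ, ∀ i j, A i j = x i + x j - splitDist (T.weight ℓ) (Sum.inl i) (Sum.inr j) / 2
  simp only [Matrix.sub_apply, sum_smul_generator_apply, dist_eq_splitDist]
  constructor <;> rintro ⟨x, hx⟩ <;> refine ⟨x, fun i j => ?_⟩ <;> linarith [hx i j]

theorem linearIndependent_generator (T : SymbicTree n) :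
    LinearIndependent ℝ fun o => (scalingSpace n).mkQ (T.generator o) := by
  rw [Fintype.linearIndependent_iff]
  intro ℓ hℓ o
  obtain ⟨k, i, l, j, h⟩ := T.exists_dual_weight o
  have h0 : (0 : Matrix (Fin n) (Fin n) ℝ) - ∑ o, ℓ o • T.generator o ∈ scalingSpace n := by
    rw [zero_sub, neg_mem_iff, ← Submodule.Quotient.mk_eq_zero, ← Submodule.mkQ_apply, map_sum]
    simpa using hℓ
  rw [← h ℓ 0 (sub_mem_scalingSpace_iff.1 h0)]
  simp [quadMinor]

end SymbicTree

/-- The matrices of nonnegative weights on the splits in `S`. -/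
def splitCone {n : ℕ} (S : Set (Set (Fin n ⊕ Fin n))) : Set (Matrix (Fin n) (Fin n) ℝ) :=
  {A | ∃ w, IsWeight S w ∧ HasSplitForm A w}

/-! ### The tree of a split system -/

namespace SimpleGraph

/-- Take a longest path inside `W`. If it missed a vertex of `W`, a walk leaving it would prolong it
at an end or give an inner vertex a third neighbor. -/
theorem exists_isPath_support_eq {V : Type*} [Finite V] {G : SimpleGraph V} {W : Set V}
    (hne : W.Nonempty)
    (hconn : ∀ u ∈ W, ∀ v ∈ W, ∃ p : G.Walk u v, ∀ z ∈ p.support, z ∈ W)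
    (hdeg : ∀ v ∈ W, ∀ a ∈ W, ∀ b ∈ W, ∀ c ∈ W, G.Adj v a → G.Adj v b → G.Adj v c →
      a ≠ b → a ≠ c → b ≠ c → False) :
    ∃ (u w : V) (p : G.Walk u w), p.IsPath ∧ ∀ v, v ∈ W ↔ v ∈ p.support := by
  classical
  have := Fintype.ofFinite V
  let L : Set ℕ := {k | ∃ (u w : V) (p : G.Walk u w), p.IsPath ∧ (∀ v ∈ p.support, v ∈ W) ∧
    p.length = k}
  have hbdd : BddAbove L := ⟨Fintype.card V, by
    rintro _ ⟨u, w, p, hp, -, rfl⟩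
    exact hp.length_lt.le⟩
  have hL : L.Nonempty := by
    obtain ⟨u, hu⟩ := hne
    exact ⟨0, u, u, Walk.nil, Walk.IsPath.nil, by simpa using hu, rfl⟩
  obtain ⟨u, w, p, hp, hpW, hlen⟩ := Nat.sSup_mem hL hbdd
  have hmax : ∀ {u' w' : V} (q : G.Walk u' w'), q.IsPath → (∀ v ∈ q.support, v ∈ W) →
      q.length ≤ p.length := fun q hq hqW => hlen ▸ le_csSup hbdd ⟨_, _, q, hq, hqW, rfl⟩
  refine ⟨u, w, p, hp, fun z => ⟨fun hz => ?_, hpW z⟩⟩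
  by_contra hzp
  obtain ⟨q, hq⟩ := hconn u (hpW u p.start_mem_support) z hz
  obtain ⟨d, hd, h1, h2⟩ := q.exists_boundary_dart {v | v ∈ p.support} p.start_mem_support hzp
  have hyW : d.snd ∈ W := hq _ (q.dart_snd_mem_support_of_mem_darts hd)
  have hadj : G.Adj d.fst d.snd := d.adj
  obtain ⟨i, hi, hil⟩ := Walk.mem_support_iff_exists_getVert.1 h1
  change d.snd ∉ p.support at h2
  rw [← hi] at hadj
  rcases Nat.eq_zero_or_pos i with rfl | hi0
  · rw [Walk.getVert_zero] at hadj
    have := hmax (Walk.cons hadj.symm p) (hp.cons h2) (by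
      intro v hv
      rw [Walk.support_cons, List.mem_cons] at hv
      rcases hv with rfl | hv
      · exact hyW
      · exact hpW v hv)
    simp at this
  rcases hil.eq_or_lt with rfl | hil
  · rw [Walk.getVert_length] at hadj
    have := hmax (p.concat hadj) (hp.concat h2 hadj) (by
      intro v hv
      rw [Walk.support_concat, List.mem_append, List.mem_singleton] at hv
      rcases hv with hv | rfl
      · exact hpW v hv
      · exact hyW)
    simp at this
  obtain ⟨i, rfl⟩ := Nat.exists_eq_succ_of_ne_zero hi0.ne'
  have m1 := p.getVert_mem_support i
  have m2 := p.getVert_mem_support (i + 1 + 1)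
  refine hdeg _ (hpW _ (p.getVert_mem_support (i + 1))) _ (hpW _ m1) _ (hpW _ m2) _ hyW
    (p.adj_getVert_succ (by omega)).symm (p.adj_getVert_succ hil) hadj ?_ ?_ ?_
  · intro h
    have := hp.getVert_injOn (show i ≤ p.length by omega) (show i + 1 + 1 ≤ p.length by omega) h
    omega
  · rintro h
    exact h2 (h ▸ m1)
  · rintro h
    exact h2 (h ▸ m2)

/-- The unique path between two fixed vertices is mapped to itself with its parametrization. -/
theorem IsTree.exists_walk_fixed {V : Type*} {G : SimpleGraph V} (hG : G.IsTree) (φ : G ≃g G)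
    {u v : V} (hu : φ u = u) (hv : φ v = v) :
    ∃ p : G.Walk u v, ∀ z ∈ p.support, φ z = z := by
  obtain ⟨p, hp, huniq⟩ := hG.existsUnique_path u v
  refine ⟨p, fun z hz => ?_⟩
  have h := huniq ((p.map φ.toHom).copy hu hv) (by
    refine (Walk.isPath_copy _ hu hv).2 ?_
    exact Walk.IsPath.map φ.injective hp)
  obtain ⟨i, rfl, -⟩ := Walk.mem_support_iff_exists_getVert.1 hz
  have h' := congrArg (fun q => q.getVert i) h
  simpa using h'

end SimpleGraph

/-! ### Vertices as orientations of the splits, edges as flips -/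

/-- Pairwise compatible splits, each represented by both of its sides. -/
structure IsSplitSystem {X : Type*} (S : Set (Set X)) : Prop where
  nonempty : ∀ B ∈ S, B.Nonempty
  compl_mem : ∀ B ∈ S, Bᶜ ∈ S
  compatible : ∀ B ∈ S, ∀ C ∈ S, Disjoint B C ∨ B ⊆ C ∨ C ⊆ B ∨ Bᶜ ⊆ C

/-- A choice of one side of each split so that any two chosen sides meet: a vertex of the tree of
the split system. -/
def SplitOrientation {X : Type*} (S : Set (Set X)) : Type _ :=
  {F : Set (Set X) // F ⊆ S ∧ (∀ B ∈ S, B ∈ F ∨ Bᶜ ∈ F) ∧ ∀ B ∈ F, ∀ C ∈ F, (B ∩ C).Nonempty}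

namespace SplitOrientation

variable {X : Type*} {S : Set (Set X)}

instance [Finite X] : Finite (SplitOrientation S) :=
  inferInstanceAs (Finite {_F : Set (Set X) // _})

theorem mem_of_mem (F : SplitOrientation S) {B : Set X} (hB : B ∈ F.1) : B ∈ S :=
  F.2.1 hB

theorem compl_not_mem (F : SplitOrientation S) {B : Set X} (hB : B ∈ F.1) : Bᶜ ∉ F.1 := fun h => by
  have := F.2.2.2 B hB Bᶜ h
  simp at this

theorem compl_mem_iff (F : SplitOrientation S) {B : Set X} (hB : B ∈ S) : Bᶜ ∈ F.1 ↔ B ∉ F.1 :=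
  ⟨fun h h' => F.compl_not_mem h' h, (F.2.2.1 B hB).resolve_left⟩

theorem mem_of_subset (F : SplitOrientation S) {B C : Set X} (hB : B ∈ F.1) (hC : C ∈ S)
    (h : B ⊆ C) : C ∈ F.1 := by
  by_contra hCF
  obtain ⟨x, hx, hx'⟩ := F.2.2.2 B hB Cᶜ ((F.compl_mem_iff hC).2 hCF)
  exact hx' (h hx)

theorem eq_of_subset {F K : SplitOrientation S} (h : F.1 ⊆ K.1) : F = K := by
  refine Subtype.ext (h.antisymm fun B hB => ?_)
  by_contra hBF
  exact K.compl_not_mem hB (h ((F.compl_mem_iff (K.mem_of_mem hB)).2 hBF))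

/-- `K` is obtained from `F` by choosing the other side of the split with side `B`. -/
def IsFlip (F K : SplitOrientation S) (B : Set X) : Prop :=
  B ∈ F.1 ∧ Bᶜ ∈ K.1 ∧ ∀ C, C ≠ B → C ≠ Bᶜ → (C ∈ F.1 ↔ C ∈ K.1)

theorem IsFlip.symm {F K : SplitOrientation S} {B : Set X} (h : IsFlip F K B) : IsFlip K F Bᶜ :=
  ⟨h.2.1, by rw [compl_compl]; exact h.1, fun C h1 h2 =>
    (h.2.2 C (by rwa [compl_compl] at h2) h1).symm⟩

/-- The tree of a split system. -/
def graph (S : Set (Set X)) : SimpleGraph (SplitOrientation S) where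
  Adj F K := ∃ B, IsFlip F K B
  symm := ⟨fun _ _ ⟨B, h⟩ => ⟨Bᶜ, h.symm⟩⟩
  loopless := ⟨fun F ⟨_, h⟩ => F.compl_not_mem h.1 h.2.1⟩

theorem IsFlip.split_eq {F K : SplitOrientation S} {B C : Set X} (h : IsFlip F K B)
    (hC : IsFlip F K C) : C = B := by
  by_contra hne
  have h1 := (h.2.2 C hne fun h' => F.compl_not_mem h.1 (h' ▸ hC.1)).1 hC.1
  exact K.compl_not_mem h1 hC.2.1

theorem IsFlip.eq_or_eq_compl {F K : SplitOrientation S} {B C : Set X} (h : IsFlip F K B)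
    (hC : ¬ (C ∈ F.1 ↔ C ∈ K.1)) : C = B ∨ C = Bᶜ := by
  by_contra! hne
  exact hC (h.2.2 C hne.1 hne.2)

/-- A split belongs to only one edge: if two of its flips oriented another split `C` differently,
all four corners of `B` and `C` would be nonempty. -/
theorem IsFlip.left_eq (hS : IsSplitSystem S) {F K F' K' : SplitOrientation S} {B : Set X}
    (h : IsFlip F K B) (h' : IsFlip F' K' B) : F = F' := by
  refine eq_of_subset fun C hC => ?_
  by_contra hCF'
  have hCS := F.mem_of_mem hC
  have h1 : C ≠ B := by
    rintro rfl
    exact hCF' h'.1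
  have h2 : C ≠ Bᶜ := by
    rintro rfl
    exact F.compl_not_mem h.1 hC
  have hCK := (h.2.2 C h1 h2).1 hC
  have hCF'' := (F'.compl_mem_iff hCS).2 hCF'
  have hCK' :=
    (h'.2.2 Cᶜ (fun h => h2 (by rw [← h, compl_compl])) fun h => h1 (compl_injective h)).1
    hCF''
  obtain ⟨x₁, a₁, b₁⟩ := F.2.2.2 B h.1 C hC
  obtain ⟨x₂, a₂, b₂⟩ := K.2.2.2 Bᶜ h.2.1 C hCK
  obtain ⟨x₃, a₃, b₃⟩ := F'.2.2.2 B h'.1 Cᶜ hCF''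
  obtain ⟨x₄, a₄, b₄⟩ := K'.2.2.2 Bᶜ h'.2.1 Cᶜ hCK'
  rcases hS.compatible B (F.mem_of_mem h.1) C hCS with h | h | h | h
  · exact Set.disjoint_left.1 h a₁ b₁
  · exact b₃ (h a₃)
  · exact a₂ (h b₂)
  · exact b₄ (h a₄)

theorem IsFlip.right_eq (hS : IsSplitSystem S) {F K F' K' : SplitOrientation S} {B : Set X}
    (h : IsFlip F K B) (h' : IsFlip F' K' B) : K = K' :=
  h.symm.left_eq hS h'.symm

theorem IsFlip.minimal {F K : SplitOrientation S} {B C : Set X} (h : IsFlip F K B) (hC : C ∈ F.1)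
    (hCB : C ⊆ B) : C = B := by
  by_contra hne
  have h1 := (h.2.2 C hne fun h' => F.compl_not_mem h.1 (h' ▸ hC)).1 hC
  obtain ⟨x, hx, hx'⟩ := K.2.2.2 C h1 Bᶜ h.2.1
  exact hx' (hCB hx)

/-- By minimality no other chosen side lies inside `B`, so all of them meet `Bᶜ`. -/
theorem exists_isFlip (hS : IsSplitSystem S) {F : SplitOrientation S} {B : Set X} (hB : B ∈ F.1)
    (hmin : ∀ C ∈ F.1, C ⊆ B → C = B) : ∃ K, IsFlip F K B := by
  have hBS := F.mem_of_mem hB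
  have key : ∀ C ∈ F.1, C ≠ B → (C ∩ Bᶜ).Nonempty := by
    intro C hC hne
    by_contra hCB
    rw [Set.not_nonempty_iff_eq_empty, ← Set.disjoint_iff_inter_eq_empty,
      Set.disjoint_compl_right_iff_subset] at hCB
    exact hne (hmin C hC hCB)
  refine ⟨⟨{C | (C ∈ F.1 ∧ C ≠ B) ∨ C = Bᶜ}, ?_, ?_, ?_⟩, hB, Or.inr rfl, ?_⟩
  · rintro C (⟨hC, -⟩ | rfl)
    · exact F.mem_of_mem hC
    · exact hS.compl_mem B hBS
  · intro C hC
    by_cases hCB : C = B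
    · exact Or.inr (Or.inr (by rw [hCB]))
    by_cases hCF : C ∈ F.1
    · exact Or.inl (Or.inl ⟨hCF, hCB⟩)
    by_cases hCB' : C = Bᶜ
    · exact Or.inl (Or.inr hCB')
    · exact Or.inr (Or.inl ⟨(F.compl_mem_iff hC).2 hCF, fun h => hCB' (by rw [← h, compl_compl])⟩)
  · rintro C (⟨hC, hCB⟩ | rfl) D (⟨hD, hDB⟩ | rfl)
    · exact F.2.2.2 C hC D hD
    · exact key C hC hCB
    · rw [Set.inter_comm]
      exact key D hD hDB
    · rw [Set.inter_self]
      exact hS.nonempty _ (hS.compl_mem B hBS)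
  · intro C h1 h2
    exact ⟨fun h => Or.inl ⟨h, h1⟩, fun h => (h.resolve_right h2).1⟩

/-- A minimal side chosen by `H` but not by `K` is minimal in `H`: a smaller one chosen by `K` would
put `B` in `K`. -/
theorem exists_isFlip_of_ne [Finite X] (hS : IsSplitSystem S) {H K : SplitOrientation S}
    (hne : H ≠ K) :
    ∃ B H', IsFlip H H' B ∧ B ∉ K.1 := by
  have hne' : (H.1 \ K.1).Nonempty := by
    by_contra h
    rw [Set.not_nonempty_iff_eq_empty, Set.sdiff_eq_empty] at h
    exact hne (eq_of_subset h)
  obtain ⟨B, ⟨hBH, hBK⟩, hmin⟩ := (Set.toFinite (H.1 \ K.1)).exists_minimal hne'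
  obtain ⟨H', h⟩ := exists_isFlip hS hBH fun C hC hCB => by
    by_cases hCK : C ∈ K.1
    · exact absurd (K.mem_of_subset hCK (H.mem_of_mem hBH) hCB) hBK
    · exact hCB.antisymm (hmin ⟨hC, hCK⟩ hCB)
  exact ⟨B, H', h, hBK⟩

/-- Each step flips a split on which the current vertex and `K` still differ, so `H \ K` shrinks.
Only such flips need be edges of `G`, so the lemma also applies after an edge is deleted. -/
theorem reachable_of_forall_isFlip [Finite X] (hS : IsSplitSystem S)
    {G : SimpleGraph (SplitOrientation S)}
    {H K : SplitOrientation S}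
    (hG : ∀ H' H'' B, IsFlip H' H'' B → B ∈ H.1 → B ∉ K.1 → G.Adj H' H'') : G.Reachable H K := by
  induction hk : (H.1 \ K.1).ncard using Nat.strong_induction_on generalizing H with | _ k ih
  by_cases hne : H = K
  · exact hne ▸ SimpleGraph.Reachable.refl _
  obtain ⟨B, H', h, hBK⟩ := exists_isFlip_of_ne hS hne
  have hBK' : Bᶜ ∈ K.1 := (K.compl_mem_iff (H.mem_of_mem h.1)).2 hBK
  have hsub : ∀ C ∈ H'.1, C ∉ K.1 → C ∈ H.1 := by
    intro C hC hCK
    have h1 : C ≠ Bᶜ := by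
      rintro rfl
      exact hCK hBK'
    have h2 : C ≠ B := by
      rintro rfl
      exact H'.compl_not_mem hC h.2.1
    exact (h.2.2 C h2 h1).2 hC
  refine (hG H H' B h h.1 hBK).reachable.trans (ih _ ?_ (fun H₁ H₂ C hC h1 h2 =>
    hG H₁ H₂ C hC (hsub C h1 h2) h2) rfl)
  rw [← hk]
  refine Set.ncard_lt_ncard (Set.ssubset_iff_exists.2 ⟨fun C hC => ⟨hsub C hC.1 hC.2, hC.2⟩, B,
    ⟨h.1, hBK⟩, fun hB => H'.compl_not_mem hB.1 h.2.1⟩) (Set.toFinite _)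

/-- The edge of `B` is the only one that changes the choice for `B`. This shows acyclicity and
computes the leaf sides. -/
theorem reachable_deleteEdges_iff [Finite X] (hS : IsSplitSystem S) {F F' : SplitOrientation S}
    {B : Set X}
    (h : IsFlip F F' B) (H K : SplitOrientation S) :
    ((graph S).deleteEdges {s(F, F')}).Reachable H K ↔ (B ∈ H.1 ↔ B ∈ K.1) := by
  constructor
  · rintro ⟨p⟩
    induction p with
    | nil => rfl
    | @cons H K L hHK p ih =>
      rw [← ih]
      rw [SimpleGraph.deleteEdges_adj] at hHK
      obtain ⟨⟨C, hC⟩, hne⟩ := hHK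
      by_contra hB
      rw [Set.mem_singleton_iff] at hne
      rcases hC.eq_or_eq_compl hB with rfl | rfl
      · exact hne (by rw [hC.left_eq hS h, hC.right_eq hS h])
      · have hC' := hC.symm
        exact hne (by rw [hC'.left_eq hS h, hC'.right_eq hS h, Sym2.eq_swap])
  · intro hB
    refine reachable_of_forall_isFlip hS fun H₁ H₂ C hC h1 h2 => ?_
    rw [SimpleGraph.deleteEdges_adj]
    refine ⟨⟨C, hC⟩, fun heq => ?_⟩
    have hCS := H.mem_of_mem h1
    rcases Sym2.eq_iff.1 (Set.mem_singleton_iff.1 heq) with ⟨rfl, rfl⟩ | ⟨rfl, rfl⟩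
    · obtain rfl := h.split_eq hC
      exact h2 (hB.1 h1)
    · obtain rfl := h.symm.split_eq hC
      have hBS := SplitOrientation.mem_of_mem _ h.1
      exact (K.compl_mem_iff hBS).not.1 h2 |> not_not.1 |> hB.2 |> H.compl_not_mem |> (· h1)

theorem exists_of_mem_of_not_mem {G : SimpleGraph (SplitOrientation S)}
    {H K : SplitOrientation S} {B : Set X} (hHK : G.Reachable H K) (hH : B ∈ H.1) (hK : B ∉ K.1) :
    ∃ H' K', G.Adj H' K' ∧ B ∈ H'.1 ∧ B ∉ K'.1 := by
  obtain ⟨p⟩ := hHK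
  obtain ⟨d, -, h1, h2⟩ := p.exists_boundary_dart {F | B ∈ F.1} hH hK
  exact ⟨_, _, d.adj, h1, h2⟩

/-- The vertex at which the leaf `x` is attached. -/
def leaf (hS : IsSplitSystem S) (x : X) : SplitOrientation S :=
  ⟨{B | B ∈ S ∧ x ∈ B}, fun _ h => h.1,
    fun B hB => (em (x ∈ B)).imp (fun h => ⟨hB, h⟩) fun h => ⟨hS.compl_mem B hB, h⟩,
    fun _ hB _ hC => ⟨x, hB.2, hC.2⟩⟩

theorem mem_leaf (hS : IsSplitSystem S) {x : X} {B : Set X} :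
    B ∈ (leaf hS x).1 ↔ B ∈ S ∧ x ∈ B :=
  Iff.rfl

theorem eq_leaf_of_singleton_mem (hS : IsSplitSystem S) {F : SplitOrientation S} {x : X}
    (h : {x} ∈ F.1) : F = leaf hS x := by
  refine eq_of_subset fun B hB => ⟨F.mem_of_mem hB, ?_⟩
  obtain ⟨y, rfl, hy⟩ := F.2.2.2 _ h B hB
  exact hy

theorem leaf_injective (hS : IsSplitSystem S) (hsing : ∀ x, {x} ∈ S) :
    Function.Injective (leaf hS) := by
  intro x y h
  have : {x} ∈ (leaf hS y).1 := h ▸ (⟨hsing x, rfl⟩ : {x} ∈ (leaf hS x).1)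
  exact this.2.symm

theorem graph_isTree [Finite X] (hS : IsSplitSystem S) : (graph S).IsTree := by
  have : Nonempty (SplitOrientation S) := by
    rcases isEmpty_or_nonempty X with hX | ⟨⟨x⟩⟩
    · have hemp : ∀ B ∈ S, False := fun B hB => by
        obtain ⟨x, -⟩ := hS.nonempty B hB
        exact hX.elim x
      exact ⟨∅, Set.empty_subset _, fun B hB => (hemp B hB).elim, fun B hB => hB.elim⟩
    · exact ⟨leaf hS x⟩
  constructor
  · exact ⟨fun H K => reachable_of_forall_isFlip hS fun _ _ B h _ _ => ⟨B, h⟩⟩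
  · rw [SimpleGraph.isAcyclic_iff_forall_adj_isBridge]
    rintro F K ⟨B, h⟩
    rw [SimpleGraph.isBridge_iff]
    rw [reachable_deleteEdges_iff hS h]
    exact fun hB => K.compl_not_mem (hB.1 h.1) h.2.1

theorem eq_leaf_or_exists_isFlip [Finite X] (hS : IsSplitSystem S) (F : SplitOrientation S)
    (x : X) : F = leaf hS x ∨ ∃ B K, IsFlip F K B ∧ x ∉ B := by
  by_contra! hcon
  refine hcon.1 (eq_of_subset fun C hC => ⟨F.mem_of_mem hC, ?_⟩)
  obtain ⟨B, ⟨hB, hBC⟩, hmin⟩ :=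
    (Set.toFinite {B | B ∈ F.1 ∧ B ⊆ C}).exists_minimal ⟨C, hC, subset_rfl⟩
  obtain ⟨K, hK⟩ := exists_isFlip hS hB fun D hD hDB => hDB.antisymm (hmin ⟨hD, hDB.trans hBC⟩ hDB)
  exact hBC (hcon.2 B K hK)

theorem ncard_neighborSet_leaf (hS : IsSplitSystem S) (hsing : ∀ x, {x} ∈ S) (x : X) :
    ((graph S).neighborSet (leaf hS x)).ncard = 1 := by
  have hx : {x} ∈ (leaf hS x).1 := ⟨hsing x, rfl⟩
  obtain ⟨K, hK⟩ := exists_isFlip hS hx fun C hC hCx =>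
    hCx.antisymm (Set.singleton_subset_iff.2 hC.2)
  rw [Set.ncard_eq_one]
  refine ⟨K, ?_⟩
  ext K'
  constructor
  · rintro ⟨B, hB⟩
    obtain rfl := hB.minimal hx (Set.singleton_subset_iff.2 hB.1.2)
    exact hB.right_eq hS hK
  · rintro rfl
    exact ⟨_, hK⟩

/-- At a vertex that is no leaf, no label lies in all flippable sides. One side is nonempty and two
chosen sides meet, so neither one nor two neighbors are possible. -/
theorem ncard_neighborSet_of_ne_leaf [Finite X] (hS : IsSplitSystem S) {F : SplitOrientation S}
    (hF : ∀ x, F ≠ leaf hS x) :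
    ((graph S).neighborSet F).ncard ≠ 1 ∧ ((graph S).neighborSet F).ncard ≠ 2 := by
  have key : ∀ x, ∃ B K, IsFlip F K B ∧ x ∉ B := fun x =>
    (eq_leaf_or_exists_isFlip hS F x).resolve_left (hF x)
  constructor
  · intro h
    obtain ⟨K, hK⟩ := Set.ncard_eq_one.1 h
    obtain ⟨B, hB⟩ : K ∈ (graph S).neighborSet F := by rw [hK]; rfl
    obtain ⟨x, hx⟩ := hS.nonempty B (F.mem_of_mem hB.1)
    obtain ⟨C, K', hC, hxC⟩ := key x
    have hK' : K' ∈ (graph S).neighborSet F := ⟨C, hC⟩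
    rw [hK] at hK'
    obtain rfl := hK'
    obtain rfl := hB.split_eq hC
    exact hxC hx
  · intro h
    obtain ⟨K₁, K₂, -, hK⟩ := Set.ncard_eq_two.1 h
    obtain ⟨B₁, hB₁⟩ : K₁ ∈ (graph S).neighborSet F := by rw [hK]; exact Or.inl rfl
    obtain ⟨B₂, hB₂⟩ : K₂ ∈ (graph S).neighborSet F := by rw [hK]; exact Or.inr rfl
    obtain ⟨x, hx₁, hx₂⟩ := F.2.2.2 B₁ hB₁.1 B₂ hB₂.1
    obtain ⟨C, K', hC, hxC⟩ := key x
    have hK' : K' ∈ (graph S).neighborSet F := ⟨C, hC⟩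
    rw [hK] at hK'
    rcases hK' with rfl | rfl
    · obtain rfl := hB₁.split_eq hC
      exact hxC hx₁
    · obtain rfl := hB₂.split_eq hC
      exact hxC hx₂

theorem preimage_involution {σ : X → X} (hσ : Function.Involutive σ) (B : Set X) :
    σ ⁻¹' (σ ⁻¹' B) = B := by
  ext x
  simp [hσ x]

/-- The action of an involution of the leaves that preserves the split system. -/
def mapInvolution (σ : X → X) (hσ : Function.Involutive σ) (hσS : ∀ B ∈ S, σ ⁻¹' B ∈ S)
    (F : SplitOrientation S) : SplitOrientation S :=
  ⟨{B | σ ⁻¹' B ∈ F.1}, by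
    refine ⟨fun B hB => preimage_involution hσ B ▸ hσS _ (F.mem_of_mem hB),
      fun B hB => F.2.2.1 _ (hσS B hB),
      fun B hB C hC => ?_⟩
    obtain ⟨x, h1, h2⟩ := F.2.2.2 _ hB _ hC
    exact ⟨σ x, h1, h2⟩⟩

theorem mem_mapInvolution {σ : X → X} {hσ : Function.Involutive σ}
    {hσS : ∀ B ∈ S, σ ⁻¹' B ∈ S} {F : SplitOrientation S} {B : Set X} :
    B ∈ (mapInvolution σ hσ hσS F).1 ↔ σ ⁻¹' B ∈ F.1 :=
  Iff.rfl

theorem mapInvolution_mapInvolution {σ : X → X} (hσ : Function.Involutive σ)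
    (hσS : ∀ B ∈ S, σ ⁻¹' B ∈ S) (F : SplitOrientation S) :
    mapInvolution σ hσ hσS (mapInvolution σ hσ hσS F) = F := by
  refine Subtype.ext (Set.ext fun B => ?_)
  rw [mem_mapInvolution, mem_mapInvolution, preimage_involution hσ]

theorem IsFlip.mapInvolution {σ : X → X} (hσ : Function.Involutive σ)
    (hσS : ∀ B ∈ S, σ ⁻¹' B ∈ S) {F K : SplitOrientation S} {B : Set X} (h : IsFlip F K B) :
    IsFlip (mapInvolution σ hσ hσS F) (mapInvolution σ hσ hσS K) (σ ⁻¹' B) := by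
  refine ⟨?_, ?_, fun C h1 h2 => ?_⟩
  · rw [mem_mapInvolution, preimage_involution hσ]
    exact h.1
  · rw [mem_mapInvolution, Set.preimage_compl, preimage_involution hσ]
    exact h.2.1
  · refine h.2.2 _ ?_ ?_
    · rintro rfl
      exact h1 (preimage_involution hσ C).symm
    · intro h'
      refine h2 ?_
      rw [← Set.preimage_compl, ← h', preimage_involution hσ]

/-- The automorphism of the tree induced by an involution of the leaves. -/
def graphInvolution (σ : X → X) (hσ : Function.Involutive σ) (hσS : ∀ B ∈ S, σ ⁻¹' B ∈ S) :
    graph S ≃g graph S where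
  toEquiv := Function.Involutive.toPerm _ (mapInvolution_mapInvolution hσ hσS)
  map_rel_iff' := by
    intro F K
    constructor
    · rintro ⟨B, h⟩
      have h' := IsFlip.mapInvolution hσ hσS
        (F := SplitOrientation.mapInvolution σ hσ hσS F)
        (K := SplitOrientation.mapInvolution σ hσ hσS K) h
      rw [mapInvolution_mapInvolution, mapInvolution_mapInvolution] at h'
      exact ⟨_, h'⟩
    · rintro ⟨B, h⟩
      exact ⟨_, h.mapInvolution hσ hσS⟩

theorem preimage_eq_of_fixed {σ : X → X} (hσ : Function.Involutive σ)
    (hσS : ∀ B ∈ S, σ ⁻¹' B ∈ S) {F K : SplitOrientation S} {B : Set X} (h : IsFlip F K B)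
    (hF : SplitOrientation.mapInvolution σ hσ hσS F = F)
    (hK : SplitOrientation.mapInvolution σ hσ hσS K = K) : σ ⁻¹' B = B := by
  have h' := h.mapInvolution hσ hσS
  rw [hF, hK] at h'
  exact h.split_eq h'

end SplitOrientation

/-! ### The symbic tree of a symbic split system -/

/-- The splits in `S` and the trivial splits. -/
def fullSplits {X : Type*} (S : Set (Set X)) : Set (Set X) :=
  S ∪ {B | ∃ x, B = {x} ∨ B = {x}ᶜ}

namespace IsSymbicSplitSystem

variable {n : ℕ} {S : Set (Set (Fin n ⊕ Fin n))} (hS : IsSymbicSplitSystem S)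

include hS

theorem isSplitSystem_fullSplits : IsSplitSystem (fullSplits S) where
  nonempty := by
    rintro B (hB | ⟨x, rfl | rfl⟩)
    · obtain ⟨i, hi⟩ := hS.exists_inl B hB
      exact ⟨_, hi⟩
    · exact Set.singleton_nonempty x
    -- The swapped label differs from `x`, so the complement of `{x}` is nonempty.
    · refine ⟨x.swap, ?_⟩
      rcases x with i | i <;> simp
  compl_mem := by
    rintro B (hB | ⟨x, rfl | rfl⟩)
    · exact Or.inl (hS.compl_mem B hB)
    · exact Or.inr ⟨x, Or.inr rfl⟩
    · exact Or.inr ⟨x, Or.inl (compl_compl _)⟩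
  compatible := by
    have triv : ∀ (x : Fin n ⊕ Fin n) (C : Set (Fin n ⊕ Fin n)),
        (Disjoint {x} C ∨ {x} ⊆ C) ∧ (C ⊆ {x}ᶜ ∨ {x}ᶜᶜ ⊆ C) := by
      intro x C
      by_cases hx : x ∈ C
      · rw [compl_compl]
        exact ⟨Or.inr (Set.singleton_subset_iff.2 hx), Or.inr (Set.singleton_subset_iff.2 hx)⟩
      · exact ⟨Or.inl (Set.disjoint_singleton_left.2 hx),
          Or.inl (Set.subset_compl_singleton_iff.2 hx)⟩
    rintro B (hB | ⟨x, rfl | rfl⟩) C hC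
    · rcases hC with hC | ⟨x, rfl | rfl⟩
      · exact hS.compatible B hB C hC
      · rcases (triv x B).1 with h | h
        · exact Or.inl h.symm
        · exact Or.inr (Or.inr (Or.inl h))
      · rcases (triv x B).2 with h | h
        · exact Or.inr (Or.inl h)
        · exact Or.inr (Or.inr (Or.inr (Set.compl_subset_comm.1 h)))
    · rcases (triv x C).1 with h | h
      · exact Or.inl h
      · exact Or.inr (Or.inl h)
    · rcases (triv x C).2 with h | h
      · exact Or.inr (Or.inr (Or.inl h))
      · exact Or.inr (Or.inr (Or.inr h))

theorem swap_mem_fullSplits : ∀ B ∈ fullSplits S, Sum.swap ⁻¹' B ∈ fullSplits S := by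
  have h : ∀ x : Fin n ⊕ Fin n, Sum.swap ⁻¹' {x} = {x.swap} := by
    intro x
    ext y
    rcases x with i | i <;> rcases y with j | j <;> simp
  rintro B (hB | ⟨x, rfl | rfl⟩)
  · exact Or.inl (hS.swap_mem B hB)
  · exact Or.inr ⟨x.swap, Or.inl (h x)⟩
  · exact Or.inr ⟨x.swap, Or.inr (by rw [Set.preimage_compl, h])⟩

omit hS in
theorem singleton_mem_fullSplits (S : Set (Set (Fin n ⊕ Fin n))) (x : Fin n ⊕ Fin n) :
    {x} ∈ fullSplits S :=
  Or.inr ⟨x, Or.inl rfl⟩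

omit hS in
-- The swap fixes no label, so trivial splits are never invariant.
theorem mem_of_swap_preimage_eq {B : Set (Fin n ⊕ Fin n)} (hB : B ∈ fullSplits S)
    (h : Sum.swap ⁻¹' B = B) : B ∈ S := by
  have key : ∀ x : Fin n ⊕ Fin n, Sum.swap ⁻¹' {x} ≠ ({x} : Set (Fin n ⊕ Fin n)) := by
    intro x h
    have hx : x ∈ Sum.swap ⁻¹' {x} := by
      rw [h]
      rfl
    rcases x with i | i <;> simp at hx
  rcases hB with hB | ⟨x, rfl | rfl⟩
  · exact hB
  · exact absurd h (key x)
  · rw [Set.preimage_compl, compl_inj_iff] at h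
    exact absurd h (key x)

open SplitOrientation in
/-- A flip between vertices that are not leaves is a flip of a split in `S`. -/
theorem mem_of_isFlip {F K : SplitOrientation (fullSplits S)} {B : Set (Fin n ⊕ Fin n)}
    (h : IsFlip F K B) (hF : F ∉ Set.range (leaf hS.isSplitSystem_fullSplits))
    (hK : K ∉ Set.range (leaf hS.isSplitSystem_fullSplits)) : B ∈ S := by
  rcases F.mem_of_mem h.1 with hB | ⟨x, rfl | rfl⟩
  · exact hB
  · exact absurd ⟨x, (eq_leaf_of_singleton_mem hS.isSplitSystem_fullSplits h.1).symm⟩ hF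
  · have := h.2.1
    rw [compl_compl] at this
    exact absurd ⟨x, (eq_leaf_of_singleton_mem hS.isSplitSystem_fullSplits this).symm⟩ hK

end IsSymbicSplitSystem

namespace SymbicTree

variable {n : ℕ}

open SplitOrientation

theorem swap_involutive : Function.Involutive (Sum.swap : Fin n ⊕ Fin n → Fin n ⊕ Fin n) :=
  Sum.swap_swap

/-- The symbic tree with a given split system. -/
def ofSplits {S : Set (Set (Fin n ⊕ Fin n))} (hS : IsSymbicSplitSystem S) : SymbicTree n where
  V := SplitOrientation (fullSplits S)
  G := graph (fullSplits S)
  isTree := graph_isTree hS.isSplitSystem_fullSplits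
  leaf := SplitOrientation.leaf hS.isSplitSystem_fullSplits
  leaf_injective :=
    SplitOrientation.leaf_injective _ (IsSymbicSplitSystem.singleton_mem_fullSplits S)
  range_leaf F := by
    constructor
    · rintro ⟨x, rfl⟩
      exact ncard_neighborSet_leaf _ (IsSymbicSplitSystem.singleton_mem_fullSplits S) x
    · intro h
      by_contra hF
      exact (ncard_neighborSet_of_ne_leaf hS.isSplitSystem_fullSplits fun x hx =>
        hF ⟨x, hx.symm⟩).1 h
  ncard_ne_two F h := by
    by_cases hF : F ∈ Set.range (SplitOrientation.leaf hS.isSplitSystem_fullSplits)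
    · obtain ⟨x, rfl⟩ := hF
      rw [ncard_neighborSet_leaf _ (IsSymbicSplitSystem.singleton_mem_fullSplits S)] at h
      omega
    · exact (ncard_neighborSet_of_ne_leaf hS.isSplitSystem_fullSplits fun x hx =>
        hF ⟨x, hx.symm⟩).2 h
  bicolored := by
    intro e he hl F hF
    obtain ⟨K, rfl⟩ := Sym2.mem_iff_exists.1 hF
    obtain ⟨B, h⟩ : (graph (fullSplits S)).Adj F K := he
    have hB := hS.mem_of_isFlip h (hl F (Sym2.mem_mk_left F K)) (hl K (Sym2.mem_mk_right F K))
    obtain ⟨i, hi⟩ := hS.exists_inl B hB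
    obtain ⟨j, hj⟩ := hS.exists_inr B hB
    have key : ∀ x ∈ B, ((graph (fullSplits S)).deleteEdges {s(F, K)}).Reachable F
        (SplitOrientation.leaf hS.isSplitSystem_fullSplits x) := fun x hx =>
      (reachable_deleteEdges_iff hS.isSplitSystem_fullSplits h _ _).2
        (iff_of_true h.1 ⟨Or.inl hB, hx⟩)
    exact ⟨⟨i, key _ hi⟩, ⟨j, key _ hj⟩⟩
  swap := graphInvolution Sum.swap swap_involutive hS.swap_mem_fullSplits
  swap_swap := mapInvolution_mapInvolution swap_involutive hS.swap_mem_fullSplits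
  swap_leaf x := by
    refine eq_of_subset ?_
    rintro B hB
    exact ⟨SplitOrientation.mem_of_mem _ hB, hB.2⟩
  fixed_path := by
    have hsp := hS.isSplitSystem_fullSplits
    let φ := graphInvolution Sum.swap swap_involutive hS.swap_mem_fullSplits
    by_cases hne : ∃ v, φ v = v
    swap
    · exact Or.inl fun v hv => hne ⟨v, hv⟩
    right
    refine SimpleGraph.exists_isPath_support_eq (W := {v | φ v = v}) hne
      (fun u hu v hv => (graph_isTree hsp).exists_walk_fixed φ hu hv) ?_
    -- Three fixed neighbors of a fixed vertex would give three disjoint invariant sides, namely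
    -- those pointing away from it.
    rintro F hF K₁ hK₁ K₂ hK₂ K₃ hK₃ ⟨B₁, h₁⟩ ⟨B₂, h₂⟩ ⟨B₃, h₃⟩ h12 h13 h23
    have hfix : ∀ {K B}, φ K = K → IsFlip F K B → Sum.swap ⁻¹' B = B := fun hK h =>
      preimage_eq_of_fixed swap_involutive hS.swap_mem_fullSplits h hF hK
    have hmem : ∀ {K B}, φ K = K → IsFlip F K B → B ∈ S := fun hK h =>
      IsSymbicSplitSystem.mem_of_swap_preimage_eq (F.mem_of_mem h.1) (hfix hK h)
    have hdisj : ∀ {K K' B B'}, IsFlip F K B → IsFlip F K' B' → K ≠ K' → Disjoint Bᶜ B'ᶜ := by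
      intro K K' B B' h h' hne
      have hBB : B ≠ B' := by
        rintro rfl
        exact hne (h.right_eq hsp h')
      rcases hsp.compatible B (F.mem_of_mem h.1) B' (F.mem_of_mem h'.1) with hd | hd | hd | hd
      · obtain ⟨x, hx, hx'⟩ := F.2.2.2 B h.1 B' h'.1
        exact absurd hx' (Set.disjoint_left.1 hd hx)
      · exact absurd (h'.minimal h.1 hd) hBB
      · exact absurd (h.minimal h'.1 hd).symm hBB
      · exact Set.disjoint_left.2 fun x hx hx' => hx' (hd hx)
    have hfix' : ∀ {B : Set (Fin n ⊕ Fin n)}, Sum.swap ⁻¹' B = B → Sum.swap ⁻¹' Bᶜ = Bᶜ :=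
      fun h => by rw [Set.preimage_compl, h]
    exact hS.not_three_fixed _ (hS.compl_mem _ (hmem hK₁ h₁)) _ (hS.compl_mem _ (hmem hK₂ h₂)) _
      (hS.compl_mem _ (hmem hK₃ h₃)) (hdisj h₁ h₂ h12) (hdisj h₁ h₃ h13) (hdisj h₂ h₃ h23)
      (hfix' (hfix hK₁ h₁)) (hfix' (hfix hK₂ h₂)) (hfix' (hfix hK₃ h₃))

theorem leafSide_ofSplits {S : Set (Set (Fin n ⊕ Fin n))} (hS : IsSymbicSplitSystem S)
    {F K : (ofSplits hS).V} {B : Set (Fin n ⊕ Fin n)} (h : IsFlip (S := fullSplits S) F K B) :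
    (ofSplits hS).leafSide s(F, K) F = B := by
  ext x
  refine (reachable_deleteEdges_iff hS.isSplitSystem_fullSplits h F
    (SplitOrientation.leaf hS.isSplitSystem_fullSplits x)).trans ?_
  rw [mem_leaf]
  exact ⟨fun hB => (hB.1 h.1).2, fun hx => iff_of_true h.1 ⟨F.mem_of_mem h.1, hx⟩⟩

theorem sides_ofSplits {S : Set (Set (Fin n ⊕ Fin n))} (hS : IsSymbicSplitSystem S) :
    (ofSplits hS).sides = S := by
  have hsp := hS.isSplitSystem_fullSplits
  ext B
  constructor
  · rintro ⟨e, he, hl, F, hF, rfl⟩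
    obtain ⟨K, rfl⟩ := Sym2.mem_iff_exists.1 hF
    obtain ⟨B, h⟩ : (graph (fullSplits S)).Adj F K := he
    rw [leafSide_ofSplits hS h]
    exact hS.mem_of_isFlip h (hl F (Sym2.mem_mk_left F K)) (hl K (Sym2.mem_mk_right F K))
  · intro hB
    obtain ⟨i, hi⟩ := hS.exists_inl B hB
    obtain ⟨j, hj⟩ := hS.exists_inr B hB
    obtain ⟨k, hk⟩ := hS.exists_inl _ (hS.compl_mem B hB)
    obtain ⟨l, hl⟩ := hS.exists_inr _ (hS.compl_mem B hB)
    have hBf : B ∈ fullSplits S := Or.inl hB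
    -- A walk from a leaf in `B` to one outside must cross the edge that flips `B`.
    obtain ⟨F, K, ⟨C, h⟩, hF, hK⟩ := exists_of_mem_of_not_mem
      ((graph_isTree hsp).connected.preconnected (SplitOrientation.leaf hsp (Sum.inl i))
        (SplitOrientation.leaf hsp (Sum.inl k)))
      ⟨hBf, hi⟩ fun h => hk h.2
    have hBC : B = C := by
      rcases h.eq_or_eq_compl (C := B) fun h => hK (h.1 hF) with rfl | rfl
      · rfl
      · exact absurd hF (F.compl_not_mem h.1)
    subst hBC
    refine ⟨s(F, K), ⟨B, h⟩, ?_, F, Sym2.mem_mk_left F K, (leafSide_ofSplits hS h).symm⟩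
    -- The only flip at a leaf `x` is that of `{x}`, which has one color.
    have hnot : ∀ {F K : SplitOrientation (fullSplits S)} {B : Set (Fin n ⊕ Fin n)} {i j : Fin n},
        IsFlip F K B → Sum.inl i ∈ B → Sum.inr j ∈ B → ∀ x, SplitOrientation.leaf hsp x ≠ F := by
      rintro F K B i j h hi hj x rfl
      have := h.minimal (C := {x}) ⟨Or.inr ⟨x, Or.inl rfl⟩, rfl⟩ (Set.singleton_subset_iff.2 h.1.2)
      rw [← this] at hi hj
      exact absurd (Set.mem_singleton_iff.1 hi |>.trans (Set.mem_singleton_iff.1 hj).symm)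
        Sum.inl_ne_inr
    rintro v hv ⟨x, hx⟩
    rcases Sym2.mem_iff.1 hv with rfl | rfl
    · exact hnot h hi hj x hx
    · exact hnot h.symm hk hl x hx

theorem exists_sides_eq {S : Set (Set (Fin n ⊕ Fin n))} (hS : IsSymbicSplitSystem S) :
    ∃ T : SymbicTree n, T.sides = S :=
  ⟨ofSplits hS, sides_ofSplits hS⟩

/-! ### A symbic tree is determined by its splits -/

theorem sides_subset_of_iso {T T' : SymbicTree n} (h : T.Iso T') : T.sides ⊆ T'.sides := by
  obtain ⟨φ, hφ⟩ := h
  rintro _ ⟨e, he, hl, u, hu, rfl⟩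
  refine ⟨e.map φ, ?_, ?_, φ u, Sym2.mem_map.2 ⟨u, hu, rfl⟩, ?_⟩
  · induction e using Sym2.ind with | _ a b
    exact φ.map_adj_iff.2 he
  · rintro v hv ⟨x, rfl⟩
    obtain ⟨a, ha, h⟩ := Sym2.mem_map.1 hv
    rw [← hφ, φ.injective.eq_iff] at h
    exact hl a ha ⟨x, h.symm⟩
  · ext x
    rw [mem_leafSide, mem_leafSide, ← hφ, φ.reachable_deleteEdges_iff]

theorem Iso.symm {T T' : SymbicTree n} (h : T.Iso T') : T'.Iso T := by
  obtain ⟨φ, hφ⟩ := h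
  exact ⟨φ.symm, fun x => by rw [← hφ, RelIso.symm_apply_apply]⟩

variable {T : SymbicTree n}

theorem leafSide_leaf {x : Fin n ⊕ Fin n} {z : T.V} (h : T.G.Adj (T.leaf x) z) :
    T.leafSide s(T.leaf x, z) (T.leaf x) = {x} := by
  obtain ⟨z', hz'⟩ := Set.ncard_eq_one.1 ((T.range_leaf (T.leaf x)).1 ⟨x, rfl⟩)
  have hadj : ∀ w, T.G.Adj (T.leaf x) w → w = z := by
    have h1 : z ∈ T.G.neighborSet (T.leaf x) := h
    intro w hw
    have h2 : w ∈ T.G.neighborSet (T.leaf x) := hw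
    rw [hz'] at h1 h2
    exact Set.mem_singleton_iff.1 h2 |>.trans (Set.mem_singleton_iff.1 h1).symm
  have key : ∀ w, (T.G.deleteEdges {s(T.leaf x, z)}).Reachable (T.leaf x) w → w = T.leaf x := by
    rintro w ⟨p⟩
    cases p with
    | nil => rfl
    | cons h' _ =>
      rw [SimpleGraph.deleteEdges_adj] at h'
      obtain rfl := hadj _ h'.1
      exact absurd rfl h'.2
  ext y
  constructor
  · intro hy
    exact T.leaf_injective (key _ hy)
  · rintro rfl
    exact SimpleGraph.Reachable.refl _

theorem mem_fullSplits_sides_iff {B : Set (Fin n ⊕ Fin n)} :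
    B ∈ fullSplits T.sides ↔ ∃ e ∈ T.G.edgeSet, ∃ u ∈ e, B = T.leafSide e u := by
  constructor
  · rintro (⟨e, he, -, u, hu, rfl⟩ | ⟨x, hx⟩)
    · exact ⟨e, he, u, hu, rfl⟩
    · obtain ⟨z, hz⟩ := Set.ncard_eq_one.1 ((T.range_leaf (T.leaf x)).1 ⟨x, rfl⟩)
      have hadj : T.G.Adj (T.leaf x) z := by
        rw [← SimpleGraph.mem_neighborSet, hz]
        rfl
      refine ⟨s(T.leaf x, z), hadj, ?_⟩
      rcases hx with rfl | rfl
      · exact ⟨T.leaf x, Sym2.mem_mk_left _ _, (leafSide_leaf hadj).symm⟩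
      · exact ⟨z, Sym2.mem_mk_right _ _, by rw [← leafSide_compl hadj, leafSide_leaf hadj]⟩
  · rintro ⟨e, he, u, hu, rfl⟩
    by_cases hl : ∀ v ∈ e, v ∉ Set.range T.leaf
    · exact Or.inl ⟨e, he, hl, u, hu, rfl⟩
    · push Not at hl
      obtain ⟨_, hv, x, rfl⟩ := hl
      obtain ⟨z, rfl⟩ := Sym2.mem_iff_exists.1 hv
      rcases Sym2.mem_iff.1 hu with rfl | rfl
      · exact Or.inr ⟨x, Or.inl (leafSide_leaf he)⟩
      · exact Or.inr ⟨x, Or.inr (by rw [← leafSide_compl he, leafSide_leaf he])⟩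

/-- Sides with disjoint leaf sets share no vertex. Hence the sides pointing to a given vertex meet
pairwise. -/
theorem leafSide_inter_nonempty {e f : Sym2 T.V} (he : e ∈ T.G.edgeSet) (hf : f ∈ T.G.edgeSet)
    {u a v : T.V} (hu : u ∈ e) (ha : a ∈ f) (h1 : (T.G.deleteEdges {e}).Reachable u v)
    (h2 : (T.G.deleteEdges {f}).Reachable a v) : (T.leafSide e u ∩ T.leafSide f a).Nonempty := by
  by_contra hd
  rw [Set.not_nonempty_iff_eq_empty, ← Set.disjoint_iff_inter_eq_empty] at hd
  by_cases hef : e = f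
  · subst hef
    obtain ⟨x, hx⟩ := exists_mem_leafSide_of_mem he hu
    exact Set.disjoint_left.1 hd hx ((h2.trans h1.symm).trans hx)
  · exact not_reachable_of_disjoint' he hf hu ha hef hd h1 h2

/-- The orientation of the splits towards the vertex `v`. -/
def orientation (T : SymbicTree n) (v : T.V) : SplitOrientation (fullSplits T.sides) :=
  ⟨{B | ∃ e ∈ T.G.edgeSet, ∃ u ∈ e, (T.G.deleteEdges {e}).Reachable u v ∧ B = T.leafSide e u}, by
    refine ⟨?_, ?_, ?_⟩
    · rintro _ ⟨e, he, u, hu, -, rfl⟩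
      exact mem_fullSplits_sides_iff.2 ⟨e, he, u, hu, rfl⟩
    · intro B hB
      obtain ⟨e, he, u, hu, rfl⟩ := mem_fullSplits_sides_iff.1 hB
      obtain ⟨w, rfl⟩ := Sym2.mem_iff_exists.1 hu
      rcases T.isTree.connected.reachable_deleteEdges_or u w v with h | h
      · exact Or.inl ⟨_, he, u, hu, h, rfl⟩
      · exact Or.inr ⟨_, he, w, Sym2.mem_mk_right u w, h, leafSide_compl he⟩
    · rintro _ ⟨e, he, u, hu, h1, rfl⟩ _ ⟨f, hf, a, ha, h2, rfl⟩
      exact leafSide_inter_nonempty he hf hu ha h1 h2⟩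

theorem leafSide_mem_orientation_iff {e : Sym2 T.V} (he : e ∈ T.G.edgeSet) {u v : T.V}
    (hu : u ∈ e) :
    T.leafSide e u ∈ (T.orientation v).1 ↔ (T.G.deleteEdges {e}).Reachable u v := by
  constructor
  · rintro ⟨f, hf, a, ha, h, heq⟩
    obtain rfl := edge_eq_of_leafSide_eq he hf hu ha heq
    obtain rfl := vertex_eq_of_leafSide_eq he hu ha heq
    exact h
  · exact fun h => ⟨e, he, u, hu, h, rfl⟩

theorem orientation_leaf (x : Fin n ⊕ Fin n) {B : Set (Fin n ⊕ Fin n)} :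
    B ∈ (T.orientation (T.leaf x)).1 ↔ B ∈ fullSplits T.sides ∧ x ∈ B := by
  rw [mem_fullSplits_sides_iff]
  constructor
  · rintro ⟨e, he, u, hu, h, rfl⟩
    exact ⟨⟨e, he, u, hu, rfl⟩, h⟩
  · rintro ⟨⟨e, he, u, hu, rfl⟩, h⟩
    exact ⟨e, he, u, hu, h, rfl⟩

theorem isFlip_orientation {u v : T.V} (h : T.G.Adj u v) :
    IsFlip (T.orientation u) (T.orientation v) (T.leafSide s(u, v) u) := by
  have hu : T.leafSide s(u, v) u ∈ (T.orientation u).1 :=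
    (leafSide_mem_orientation_iff h (Sym2.mem_mk_left u v)).2 (SimpleGraph.Reachable.refl _)
  have hv : T.leafSide s(u, v) v ∈ (T.orientation v).1 :=
    (leafSide_mem_orientation_iff h (Sym2.mem_mk_right u v)).2 (SimpleGraph.Reachable.refl _)
  rw [← leafSide_compl h] at hv
  refine ⟨hu, hv, fun C h1 h2 => ?_⟩
  by_cases hC : C ∈ fullSplits T.sides
  · obtain ⟨f, hf, a, ha, rfl⟩ := mem_fullSplits_sides_iff.1 hC
    rw [leafSide_mem_orientation_iff hf ha, leafSide_mem_orientation_iff hf ha]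
    have hne : s(u, v) ≠ f := by
      rintro rfl
      rcases Sym2.mem_iff.1 ha with rfl | rfl
      · exact h1 rfl
      · exact h2 (leafSide_compl hf).symm
    have := h.reachable_deleteEdges hne
    exact ⟨fun h => h.trans this, fun h => h.trans this.symm⟩
  · exact iff_of_false (fun h => hC (SplitOrientation.mem_of_mem _ h))
      fun h => hC (SplitOrientation.mem_of_mem _ h)

/-- The first edge on the path from `u` to `v` is oriented differently by the two. -/
theorem orientation_injective (T : SymbicTree n) : Function.Injective T.orientation := by
  intro u v huv
  by_contra hne
  obtain ⟨p, hp⟩ := (T.isTree.connected.preconnected u v).exists_isPath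
  cases p with
  | nil => exact hne rfl
  | @cons _ z _ h q =>
    rw [SimpleGraph.Walk.cons_isPath_iff] at hp
    have hzv : (T.G.deleteEdges {s(u, z)}).Reachable z v :=
      ⟨q.toDeleteEdge s(u, z) fun he => hp.2 (q.fst_mem_support_of_mem_edges he)⟩
    have h1 : T.leafSide s(u, z) u ∈ (T.orientation u).1 :=
      (leafSide_mem_orientation_iff h (Sym2.mem_mk_left u z)).2 (SimpleGraph.Reachable.refl _)
    rw [huv, leafSide_mem_orientation_iff h (Sym2.mem_mk_left u z)] at h1
    exact T.isTree.isAcyclic.not_reachable_deleteEdges h (h1.trans hzv.symm)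

theorem isSplitSystem_fullSplits_sides (T : SymbicTree n) : IsSplitSystem (fullSplits T.sides) :=
  T.isSymbicSplitSystem_sides.isSplitSystem_fullSplits

theorem exists_eq_orientation_of_isFlip {F K : SplitOrientation (fullSplits T.sides)}
    {B : Set (Fin n ⊕ Fin n)} (h : IsFlip F K B) :
    ∃ u v, T.G.Adj u v ∧ F = T.orientation u ∧ K = T.orientation v := by
  obtain ⟨e, he, u, hu, rfl⟩ := mem_fullSplits_sides_iff.1 (F.mem_of_mem h.1)
  obtain ⟨v, rfl⟩ := Sym2.mem_iff_exists.1 hu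
  have h' := isFlip_orientation (T := T) he
  exact ⟨u, v, he, h.left_eq T.isSplitSystem_fullSplits_sides h',
    h.right_eq T.isSplitSystem_fullSplits_sides h'⟩

/-- Any other orientation admits a flip. Its split is that of an edge of `T`, and flips of a given
split are unique, so the orientation points to an endpoint of that edge. -/
theorem orientation_surjective (T : SymbicTree n) : Function.Surjective T.orientation := by
  intro F
  obtain ⟨v⟩ := T.isTree.connected.nonempty
  by_cases hne : F = T.orientation v
  · exact ⟨v, hne.symm⟩
  · obtain ⟨B, K, h, -⟩ := exists_isFlip_of_ne T.isSplitSystem_fullSplits_sides hne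
    obtain ⟨u, w, -, rfl, -⟩ := exists_eq_orientation_of_isFlip h
    exact ⟨u, rfl⟩

/-- A symbic tree is the tree of its split system. -/
noncomputable def isoGraph (T : SymbicTree n) : T.G ≃g graph (fullSplits T.sides) where
  toEquiv := Equiv.ofBijective _ ⟨T.orientation_injective, T.orientation_surjective⟩
  map_rel_iff' := by
    intro a b
    constructor
    · rintro ⟨B, h⟩
      obtain ⟨u, v, huv, h1, h2⟩ := exists_eq_orientation_of_isFlip h
      obtain rfl := T.orientation_injective h1
      obtain rfl := T.orientation_injective h2
      exact huv
    · exact fun h => ⟨_, isFlip_orientation h⟩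

/-- With `S` a variable, two trees with equal splits map to literally the same graph. -/
theorem exists_iso_graph (T : SymbicTree n) {S : Set (Set (Fin n ⊕ Fin n))}
    (hS : T.sides = S) : ∃ φ : T.G ≃g graph (fullSplits S),
      ∀ x, (φ (T.leaf x)).1 = {B | B ∈ fullSplits S ∧ x ∈ B} := by
  subst hS
  exact ⟨T.isoGraph, fun x => Set.ext fun B => orientation_leaf x⟩

theorem sides_eq_iff_iso (T T' : SymbicTree n) : T.sides = T'.sides ↔ T.Iso T' := by
  constructor
  · intro h
    obtain ⟨φ, hφ⟩ := T.exists_iso_graph h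
    obtain ⟨ψ, hψ⟩ := T'.exists_iso_graph rfl
    refine ⟨φ.trans ψ.symm, fun x => ?_⟩
    rw [RelIso.trans_apply, RelIso.symm_apply_eq]
    exact Subtype.ext ((hφ x).trans (hψ x).symm)
  · exact fun h => (sides_subset_of_iso h).antisymm (sides_subset_of_iso h.symm)

end SymbicTree

/-! ### The fan of symbic trees -/

namespace SymbicTree

variable {n : ℕ} {T : SymbicTree n}

/-- The isolation indices of `A` give a tree `T'` for `A`. The matrix determines the distances
between attaching points, so the metrics of `T` and `T'` agree, and the split form passes to `T`. -/
theorem hasSplitForm_of_hasTree {A : Matrix (Fin n) (Fin n) ℝ} {ℓ : T.EdgeOrbit → ℝ}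
    (hA : A ∈ symmTropRank n 2) (h : HasTree A T ℓ) : HasSplitForm A (T.weight ℓ) := by
  obtain ⟨T', hT'⟩ := exists_sides_eq (isSymbicSplitSystem_isolationIndex hA)
  have hw := isWeight_isolationIndex hA.1
  rw [← hT'] at hw
  obtain ⟨ℓ', hℓ', hw'⟩ := exists_weight_eq hw
  obtain ⟨x, hx⟩ := hasSplitForm_isolationIndex hA
  have h' : HasTree A T' ℓ' := hasTree_of_hasSplitForm hℓ' (hw' ▸ ⟨x, hx⟩)
  refine ⟨x, fun i j => ?_⟩
  rw [hx, ← dist_eq_splitDist, h.dist_eq h', dist_eq_splitDist, hw']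

theorem mem_symmTropRank_and_hasTree_iff {ℓ : T.EdgeOrbit → ℝ} (hℓ : ∀ o, 0 ≤ ℓ o)
    (A : Matrix (Fin n) (Fin n) ℝ) :
    (A ∈ symmTropRank n 2 ∧ HasTree A T ℓ) ↔ A - ∑ o, ℓ o • T.generator o ∈ scalingSpace n := by
  rw [sub_mem_scalingSpace_iff]
  exact ⟨fun h => hasSplitForm_of_hasTree h.1 h.2, fun h =>
    ⟨T.isSymbicSplitSystem_sides.mem_symmTropRank (isWeight_weight hℓ) h,
      hasTree_of_hasSplitForm hℓ h⟩⟩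

theorem mem_cone_iff {A : Matrix (Fin n) (Fin n) ℝ} : A ∈ T.cone ↔
    ∃ ℓ : T.EdgeOrbit → ℝ, (∀ o, 0 ≤ ℓ o) ∧ HasSplitForm A (T.weight ℓ) := by
  constructor
  · rintro ⟨hA, ℓ, hℓ, h⟩
    exact ⟨ℓ, hℓ, hasSplitForm_of_hasTree hA h⟩
  · rintro ⟨ℓ, hℓ, h⟩
    exact ⟨T.isSymbicSplitSystem_sides.mem_symmTropRank (isWeight_weight hℓ) h, ℓ, hℓ,
      hasTree_of_hasSplitForm hℓ h⟩

theorem cone_eq_coneOver (T : SymbicTree n) : T.cone = coneOver (scalingSpace n) T.generator := by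
  ext A
  rw [mem_cone_iff]
  simp only [← sub_mem_scalingSpace_iff]
  rfl

theorem cone_eq_splitCone (T : SymbicTree n) : T.cone = splitCone T.sides := by
  ext A
  rw [mem_cone_iff]
  constructor
  · rintro ⟨ℓ, hℓ, h⟩
    exact ⟨_, isWeight_weight hℓ, h⟩
  · rintro ⟨w, hw, h⟩
    obtain ⟨ℓ, hℓ, rfl⟩ := exists_weight_eq hw
    exact ⟨ℓ, hℓ, h⟩

/-! ### Faces and intersections of the cones -/

/-- The split at `e` for an edge orbit in `Z`. -/
def sidesOf (T : SymbicTree n) (Z : Set T.EdgeOrbit) : Set (Set (Fin n ⊕ Fin n)) :=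
  {B | ∃ e : T.InternalEdge, Quot.mk _ e ∈ Z ∧ ∃ u ∈ e.1, B = T.leafSide e.1 u}

theorem sidesOf_subset (Z : Set T.EdgeOrbit) : T.sidesOf Z ⊆ T.sides := by
  rintro _ ⟨e, -, u, hu, rfl⟩
  exact leafSide_mem_sides e hu

theorem leafSide_mem_sidesOf_iff {Z : Set T.EdgeOrbit} {e : T.InternalEdge} {u : T.V}
    (hu : u ∈ e.1) : T.leafSide e.1 u ∈ T.sidesOf Z ↔ Quot.mk _ e ∈ Z := by
  constructor
  · rintro ⟨f, hf, v, hv, h⟩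
    obtain rfl : e = f := Subtype.ext (edge_eq_of_leafSide_eq e.2.1 f.2.1 hu hv h)
    exact hf
  · exact fun h => ⟨e, h, u, hu, rfl⟩

theorem isSymbicSplitSystem_sidesOf (Z : Set T.EdgeOrbit) :
    IsSymbicSplitSystem (T.sidesOf Z) := by
  have hS := T.isSymbicSplitSystem_sides
  refine ⟨?_, fun B hB => hS.exists_inl B (sidesOf_subset Z hB),
    fun B hB => hS.exists_inr B (sidesOf_subset Z hB),
    fun B hB C hC => hS.compatible B (sidesOf_subset Z hB) C (sidesOf_subset Z hC), ?_,
    fun B hB C hC D hD => hS.not_three_fixed B (sidesOf_subset Z hB) C (sidesOf_subset Z hC) D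
      (sidesOf_subset Z hD)⟩
  · rintro _ ⟨e, he, u, hu, rfl⟩
    obtain ⟨v, hv⟩ := Sym2.mem_iff_exists.1 hu
    have hmem : v ∈ e.1 := hv ▸ Sym2.mem_mk_right u v
    have huv : u ≠ v := SimpleGraph.Adj.ne (G := T.G) (by
      rw [← SimpleGraph.mem_edgeSet, ← hv]
      exact e.2.1)
    exact ⟨e, he, v, hmem, leafSide_compl_of_mem e.2.1 hu hmem huv⟩
  · rintro _ ⟨e, he, u, hu, rfl⟩
    let f : T.InternalEdge :=
      ⟨e.1.map T.swap, map_swap_mem_edgeSet e.2.1, not_mem_range_leaf_of_mem_map_swap e.2.2⟩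
    have hef : (Quot.mk _ e : T.EdgeOrbit) = Quot.mk _ f := orbit_eq rfl
    exact ⟨f, hef ▸ he, T.swap u, Sym2.mem_map.2 ⟨u, hu, rfl⟩, (leafSide_map_swap e.1 u).symm⟩

/-- `S` is general so that this applies both to subsystems, which give faces, and to the splits of
another tree, for intersections. -/
theorem isWeight_sidesOf_iff {Z : Set T.EdgeOrbit} {ℓ : T.EdgeOrbit → ℝ} (hℓ : ∀ o, 0 ≤ ℓ o)
    {S : Set (Set (Fin n ⊕ Fin n))}
    (hZ : ∀ (e : T.InternalEdge) (u : T.V), u ∈ e.1 → (T.leafSide e.1 u ∈ S ↔ Quot.mk _ e ∈ Z)) :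
    IsWeight S (T.weight ℓ) ↔ ∀ o, o ∉ Z → ℓ o = 0 := by
  have hw := isWeight_weight hℓ
  constructor
  · rintro h ⟨e⟩ ho
    by_contra h0
    change ℓ (Quot.mk _ e) ≠ 0 at h0
    rw [← weight_leafSide ℓ e e.1.out_fst_mem] at h0
    exact ho ((hZ e _ e.1.out_fst_mem).1 (h.mem_of_ne_zero _ h0))
  · refine fun h => ⟨hw.nonneg, fun B hB => ?_, hw.compl, hw.swap⟩
    obtain ⟨e, u, hu, rfl⟩ := exists_internalEdge (hw.mem_of_ne_zero B hB)
    rw [weight_leafSide ℓ e hu] at hB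
    refine (hZ e u hu).2 ?_
    by_contra ho
    exact hB (h _ ho)

theorem mem_splitCone_sidesOf_iff {Z : Set T.EdgeOrbit} {A : Matrix (Fin n) (Fin n) ℝ} :
    A ∈ splitCone (T.sidesOf Z) ↔ ∃ ℓ : T.EdgeOrbit → ℝ, (∀ o, 0 ≤ ℓ o) ∧
      (∀ o, o ∉ Z → ℓ o = 0) ∧ HasSplitForm A (T.weight ℓ) := by
  have hZ : ∀ (e : T.InternalEdge) (u : T.V), u ∈ e.1 →
      (T.leafSide e.1 u ∈ T.sidesOf Z ↔ Quot.mk _ e ∈ Z) := fun e u hu =>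
    leafSide_mem_sidesOf_iff hu
  constructor
  · rintro ⟨w, hw, h⟩
    obtain ⟨ℓ, hℓ, rfl⟩ := exists_weight_eq (T := T)
      ⟨hw.nonneg, fun B hB => sidesOf_subset Z (hw.mem_of_ne_zero B hB), hw.compl, hw.swap⟩
    exact ⟨ℓ, hℓ, (isWeight_sidesOf_iff hℓ hZ).1 hw, h⟩
  · rintro ⟨ℓ, hℓ, h0, h⟩
    exact ⟨_, (isWeight_sidesOf_iff hℓ hZ).2 h0, h⟩

theorem _root_.IsSimplicialCone.of_linearIndependent {E ι : Type*} [AddCommGroup E] [Module ℝ E]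
    [Fintype ι] {L : Submodule ℝ E} {v : ι → E} (hv : LinearIndependent ℝ fun i => L.mkQ (v i)) :
    IsSimplicialCone L (coneOver L v) := by
  let φ := (Fintype.equivFin ι).symm
  refine ⟨Fintype.card ι, v ∘ φ, hv.comp φ φ.injective, ?_⟩
  ext x
  constructor
  · rintro ⟨c, hc, hx⟩
    refine ⟨c ∘ φ, fun i => hc _, ?_⟩
    rwa [← Equiv.sum_comp φ] at hx
  · rintro ⟨c, hc, hx⟩
    refine ⟨c ∘ φ.symm, fun i => hc _, ?_⟩
    rw [← Equiv.sum_comp φ]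
    simpa using hx

theorem apply_eq_of_hasSplitForm {f : Matrix (Fin n) (Fin n) ℝ →ₗ[ℝ] ℝ}
    (hf : ∀ M ∈ scalingSpace n, f M = 0) {A : Matrix (Fin n) (Fin n) ℝ} {ℓ : T.EdgeOrbit → ℝ}
    (h : HasSplitForm A (T.weight ℓ)) : f A = ∑ o, ℓ o * f (T.generator o) := by
  have := hf _ (sub_mem_scalingSpace_iff.2 h)
  rw [map_sub, map_sum, sub_eq_zero] at this
  simpa using this

/-- The form vanishes on the lineality space and is nonnegative on generators, so its zeros have
length `0` on the orbits where it is positive. Contracting these edges gives the tree of the face.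
-/
theorem cone_face_mem {F : Set (Matrix (Fin n) (Fin n) ℝ)} (hF : IsConeFace F T.cone) :
    ∃ T' : SymbicTree n, T'.cone = F := by
  classical
  obtain ⟨f, hf, rfl⟩ := hF
  have hgen : ∀ o, HasSplitForm (T.generator o) (T.weight (Pi.single o 1)) := by
    intro o
    rw [← sub_mem_scalingSpace_iff]
    simp [Pi.single_apply]
  have hscal : ∀ M ∈ scalingSpace n, M ∈ T.cone := by
    intro M hM
    refine mem_cone_iff.2 ⟨0, fun _ => le_rfl, sub_mem_scalingSpace_iff.1 ?_⟩
    simpa using hM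
  have hL : ∀ M ∈ scalingSpace n, f M = 0 := by
    intro M hM
    have h1 := hf M (hscal M hM)
    have h2 := hf (-M) (hscal _ (neg_mem hM))
    rw [map_neg] at h2
    linarith
  have hpos : ∀ o, 0 ≤ f (T.generator o) := fun o =>
    hf _ (mem_cone_iff.2 ⟨_, fun o' => by
      by_cases h : o' = o
      · subst h
        simp
      · simp [Pi.single_eq_of_ne h], hgen o⟩)
  obtain ⟨T', hT'⟩ := exists_sides_eq
    (T.isSymbicSplitSystem_sidesOf {o | f (T.generator o) = 0})
  refine ⟨T', ?_⟩
  ext A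
  rw [cone_eq_splitCone, hT', mem_splitCone_sidesOf_iff]
  have hiff : ∀ ℓ : T.EdgeOrbit → ℝ, (∀ o, 0 ≤ ℓ o) → HasSplitForm A (T.weight ℓ) →
      (f A = 0 ↔ ∀ o, o ∉ {o | f (T.generator o) = 0} → ℓ o = 0) := by
    intro ℓ hℓ h
    rw [apply_eq_of_hasSplitForm hL h,
      Finset.sum_eq_zero_iff_of_nonneg fun o _ => mul_nonneg (hℓ o) (hpos o)]
    simp only [Finset.mem_univ, true_imp_iff, mul_eq_zero]
    exact forall_congr' fun o => ⟨fun h h' => h.resolve_right h', fun h => by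
      by_contra! hne
      exact hne.1 (h hne.2)⟩
  constructor
  · rintro ⟨ℓ, hℓ, h0, h⟩
    exact ⟨mem_cone_iff.2 ⟨ℓ, hℓ, h⟩, (hiff ℓ hℓ h).2 h0⟩
  · rintro ⟨hA, h0⟩
    obtain ⟨ℓ, hℓ, h⟩ := mem_cone_iff.1 hA
    exact ⟨ℓ, hℓ, (hiff ℓ hℓ h).1 h0, h⟩

/-- A minor as a linear form. -/
def quadMinorForm (k i l j : Fin n) : Matrix (Fin n) (Fin n) ℝ →ₗ[ℝ] ℝ where
  toFun A := quadMinor A k i l j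
  map_add' A B := by simp only [quadMinor, Matrix.add_apply]; ring
  map_smul' c A := by
    simp only [quadMinor, Matrix.smul_apply, smul_eq_mul, RingHom.id_apply]; ring

/-- The weights of `A` are unique, so `A` lies in both cones iff they live on common splits. The
face is cut out by the sum of the dual minors over the orbits of the other splits. -/
theorem isConeFace_inter (T T' : SymbicTree n) : IsConeFace (T.cone ∩ T'.cone) T.cone := by
  classical
  choose k i l j hdual using T.exists_dual_weight
  have hS := T.isSymbicSplitSystem_sides
  have hS' := T'.isSymbicSplitSystem_sides
  -- The invariant weight `1` on common sides serves only to show that being a side of `T'` depends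
  -- on the orbit alone.
  obtain ⟨ℓ₀, -, hℓ₀⟩ := exists_weight_eq (T := T)
    (w := fun B => if B ∈ T.sides ∧ B ∈ T'.sides then 1 else 0)
    { nonneg := fun B => by split_ifs <;> simp
      mem_of_ne_zero := fun B h => by
        by_contra hB
        exact h (if_neg fun h' => hB h'.1)
      compl := fun B => by
        have h : ∀ {S : Set (Set (Fin n ⊕ Fin n))}, IsSymbicSplitSystem S → (Bᶜ ∈ S ↔ B ∈ S) :=
          fun hS => ⟨fun h => compl_compl B ▸ hS.compl_mem _ h, hS.compl_mem B⟩
        simp only [h hS, h hS']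
      swap := fun B => by
        have h : ∀ {S : Set (Set (Fin n ⊕ Fin n))}, IsSymbicSplitSystem S →
            (Sum.swap ⁻¹' B ∈ S ↔ B ∈ S) := fun hS =>
          ⟨fun h => swap_preimage_swap_preimage B ▸ hS.swap_mem _ h, hS.swap_mem B⟩
        simp only [h hS, h hS'] }
  let Z : Set T.EdgeOrbit := {o | ℓ₀ o ≠ 0}
  have hZ : ∀ (e : T.InternalEdge) (u : T.V), u ∈ e.1 →
      (T.leafSide e.1 u ∈ T'.sides ↔ Quot.mk _ e ∈ Z) := by
    intro e u hu
    change _ ↔ ℓ₀ (Quot.mk _ e) ≠ 0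
    rw [← weight_leafSide ℓ₀ e hu, hℓ₀]
    simp [leafSide_mem_sides e hu]
  refine ⟨∑ o ∈ Finset.univ.filter (· ∉ Z), quadMinorForm (k o) (i o) (l o) (j o), ?_, ?_⟩
  · intro A hA
    obtain ⟨ℓ, hℓ, h⟩ := mem_cone_iff.1 hA
    rw [LinearMap.sum_apply]
    refine Finset.sum_nonneg fun o _ => ?_
    change 0 ≤ quadMinor A _ _ _ _
    rw [hdual o ℓ A h]
    exact hℓ o
  · ext A
    rw [Set.mem_inter_iff, Set.mem_ofPred_eq, and_congr_right_iff]
    intro hA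
    obtain ⟨ℓ, hℓ, h⟩ := mem_cone_iff.1 hA
    have hval : ∀ o, quadMinorForm (k o) (i o) (l o) (j o) A = ℓ o := fun o => hdual o ℓ A h
    rw [LinearMap.sum_apply]
    simp only [hval]
    rw [Finset.sum_eq_zero_iff_of_nonneg fun o _ => hℓ o]
    simp only [Finset.mem_filter, Finset.mem_univ, true_and]
    rw [← isWeight_sidesOf_iff hℓ hZ, cone_eq_splitCone]
    constructor
    · rintro ⟨w, hw, hAw⟩
      rwa [T.isSymbicSplitSystem_sides.weight_eq_of_hasSplitForm hS' (isWeight_weight hℓ) hw h hAw]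
    · exact fun hw => ⟨_, hw, h⟩

/-- The matrix with all lengths `1` has full support on the splits of `T`, and its weights are
unique. -/
theorem sides_subset_of_cone_subset {T T' : SymbicTree n} (h : T.cone ⊆ T'.cone) :
    T.sides ⊆ T'.sides := by
  intro B hB
  have hw := isWeight_weight (T := T) (ℓ := 1) fun _ => zero_le_one
  have hA : HasSplitForm (∑ o, (1 : T.EdgeOrbit → ℝ) o • T.generator o) (T.weight 1) := by
    rw [← sub_mem_scalingSpace_iff, sub_self]
    exact zero_mem _
  obtain ⟨ℓ, hℓ, h'⟩ := mem_cone_iff.1 (h (mem_cone_iff.2 ⟨1, fun _ => zero_le_one, hA⟩))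
  have heq := T.isSymbicSplitSystem_sides.weight_eq_of_hasSplitForm
    T'.isSymbicSplitSystem_sides hw (isWeight_weight hℓ) hA h'
  refine (isWeight_weight hℓ).mem_of_ne_zero B ?_
  rw [← heq]
  obtain ⟨e, u, hu, rfl⟩ := exists_internalEdge hB
  rw [weight_leafSide _ e hu]
  exact one_ne_zero

theorem cone_eq_iff_sides_eq (T T' : SymbicTree n) : T.cone = T'.cone ↔ T.sides = T'.sides := by
  constructor
  · exact fun h => (sides_subset_of_cone_subset h.subset).antisymm
      (sides_subset_of_cone_subset h.superset)
  · intro h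
    rw [cone_eq_splitCone, cone_eq_splitCone, h]

theorem isSimplicialFan_range_cone (n : ℕ) :
    IsSimplicialFan (scalingSpace n) (Set.range (SymbicTree.cone (n := n))) where
  finite := by
    -- A cone depends only on the splits of its tree, and there are finitely many sets of splits.
    refine (Set.finite_range (splitCone (n := n))).subset ?_
    rintro _ ⟨T, rfl⟩
    exact ⟨T.sides, (cone_eq_splitCone T).symm⟩
  simplicial := by
    rintro _ ⟨T, rfl⟩
    rw [cone_eq_coneOver]
    exact IsSimplicialCone.of_linearIndependent T.linearIndependent_generator
  face_mem := by
    rintro _ ⟨T, rfl⟩ F hF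
    exact cone_face_mem hF
  inter_face := by
    rintro _ ⟨T, rfl⟩ _ ⟨T', rfl⟩
    exact ⟨isConeFace_inter T T', Set.inter_comm _ _ ▸ isConeFace_inter T' T⟩

theorem iUnion_cone (n : ℕ) : (⋃ T : SymbicTree n, T.cone) = symmTropRank n 2 := by
  refine Set.Subset.antisymm (Set.iUnion_subset fun T A hA => hA.1) fun A hA => ?_
  obtain ⟨T, hT⟩ := exists_sides_eq (isSymbicSplitSystem_isolationIndex hA)
  refine Set.mem_iUnion.2 ⟨T, ?_⟩
  rw [cone_eq_splitCone, hT]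
  exact ⟨_, isWeight_isolationIndex hA.1, hasSplitForm_isolationIndex hA⟩

end SymbicTree

theorem mainTheorem4 (n : ℕ) :
    IsSimplicialFan (scalingSpace n) (Set.range (SymbicTree.cone (n := n))) ∧
    (⋃ T : SymbicTree n, T.cone) = symmTropRank n 2 ∧
    (∀ T T' : SymbicTree n, T.cone = T'.cone ↔ T.Iso T') ∧
    (∀ T : SymbicTree n, ∃ v : T.EdgeOrbit → Matrix (Fin n) (Fin n) ℝ,
      LinearIndependent ℝ (fun o => (scalingSpace n).mkQ (v o)) ∧
      T.cone = coneOver (scalingSpace n) v ∧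
      ∀ ℓ : T.EdgeOrbit → ℝ, (∀ o, 0 ≤ ℓ o) → ∀ A : Matrix (Fin n) (Fin n) ℝ,
        (A ∈ symmTropRank n 2 ∧ HasTree A T ℓ) ↔
          A - ∑ o, ℓ o • v o ∈ scalingSpace n) :=
  ⟨SymbicTree.isSimplicialFan_range_cone n, SymbicTree.iUnion_cone n,
    fun T T' => (SymbicTree.cone_eq_iff_sides_eq T T').trans (SymbicTree.sides_eq_iff_iso T T'),
    fun T => ⟨T.generator, T.linearIndependent_generator, T.cone_eq_coneOver,
      fun _ hℓ A => SymbicTree.mem_symmTropRank_and_hasTree_iff hℓ A⟩⟩
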